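/- **Conventions.** All groups are countable and discrete; a pmp action is an action by measurable measure preserving transformations on a standard Borel probability space. For a free pmp action $\Gamma\curvearrowright^\sigma (X,\mu)$ put $A=L^\infty(X)\subset M=L^\infty(X)\rtimes\Gamma$, with canonical unitaries $u_g$ and trace $\tau$, so that $\sigma_g=\mathrm{Ad}(u_g)$ on $A$. For a free ultrafilter $\omega$ on $\mathbb N$ let $A^\omega\subset M^\omega$ be the tracial ultrapowers, $\sigma^\omega_g((a_n)_n)=(\sigma_g(a_n))_n$ the ultrapower action of $\Gamma$ on $A^\omega$, $\mathcal N_M(A)=\{u\in\mathcal U(M): uAu^*=A\}$ the normalizer of $A$ in $M$, and $M(\omega)=A^\omega\vee\mathcal N_M(A)\subset M^\omega$ the von Neumann algebra generated by $A^\omega$ and $\mathcal N_M(A)$. For a free pmp action $\Lambda\curvearrowright^\rho(Y,\nu)$ write likewise $B\subset N$, $B^\omega$, $\rho^\omega$, $N(\omega)$. * $\Gamma\curvearrowright X$ is *strongly ergodic* if $\mu(E_n)\mu(X\setminus E_n)\to0$ for every sequence of measurable sets $E_n$ with $\mu(gE_n\,\triangle\,E_n)\to0$ for all $g\in\Gamma$.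 * An *orbit equivalence* (OE) of $\Gamma\curvearrowright X$ and $\Lambda\curvearrowright Y$ is an isomorphism of probability spaces $\Delta:X\to Y$ with $\Delta(\Gamma x)=\Lambda\Delta(x)$ for a.e. $x$. The action $\Gamma\curvearrowright X$ is *OE-superrigid* if for every OE $\Delta$ of it with a free pmp action $\Lambda\curvearrowright Y$ of a countable group there are an automorphism $\phi$ of $(Y,\nu)$ with $\phi(y)\in\Lambda y$ for a.e. $y$ and a group isomorphism $\delta:\Gamma\to\Lambda$ with $\phi\Delta(gx)=\delta(g)\phi\Delta(x)$ for all $g$ and a.e. $x$. * An isomorphism $\theta:A^\omega\simeq B^\omega$ *implements an $\omega$-OE* if it extends to a trace preserving $*$-isomorphism $M(\omega)\simeq N(\omega)$. It *implements an app-OE* if moreover it is of ultraproduct form, $\theta=(\theta_n)_n$ with trace preserving isomorphisms $\theta_n:A\simeq B$. * A trace preserving $\theta:A^\omega\simeq B^\omega$ is an *$\omega$-conjugacy* if there is a group isomorphism $\delta:\Gamma\to\Lambda$ with $\theta\sigma^\omega_g=\rho^\omega_{\delta(g)}\theta$ for all $g$; it is an *app-conjugacy* if moreover it is of ultraproduct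 form. **Proposition.** Let $\Gamma$ be a countable group such that every free, strongly ergodic pmp action of $\Gamma$ is OE-superrigid. Let $\Gamma\curvearrowright^\sigma X$ be a free, strongly ergodic pmp action and $\omega$ a free ultrafilter on $\mathbb N$. Then $\sigma$ is $\omega$-OE superrigid and app-OE superrigid: every $\omega$-OE (respectively app-OE) of $\sigma$ with a free pmp action $\Lambda\curvearrowright^\rho Y$ of a countable group comes from an $\omega$-conjugacy (respectively app-conjugacy). More specifically, if $\theta:A^\omega\simeq B^\omega$ implements an $\omega$-OE of $\sigma$ and such a $\rho$, then there is a unitary $u\in N(\omega)$ with $uB^\omega u^*=B^\omega$ such that $$\mathrm{Ad}(u)\,\bigl(\theta\,\sigma^\omega(\Gamma)\,\theta^{-1}\bigr)\,\mathrm{Ad}(u)^{-1}=\rho^\omega(\Lambda)$$ as sets of automorphisms of $B^\omega$, $\mathrm{Ad}(u)\circ\theta$ is an $\omega$-conjugacy, and, if $\theta$ implements an app-OE, $\mathrm{Ad}(u)\circ\theta$ is an app-conjugacy. -/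

import Mathlib

open MeasureTheory Filter Topology
open scoped ENNReal

namespace UltraOE

set_option linter.unusedSectionVars false

noncomputable section

/-! ### Probability measure preserving actions -/

section Actions

variable (Γ : Type) [Group Γ] {X : Type} [MeasurableSpace X] [MulAction Γ X]

/-- The action is (essentially) free. -/
def IsFree (μ : Measure X) : Prop :=
  ∀ᵐ x ∂μ, ∀ g : Γ, g ≠ 1 → g • x ≠ x

/-- Strong ergodicity in the sense of Schmidt: every asymptotically invariant sequence of
measurable sets is asymptotically null or conull. -/
def StronglyErgodic (μ : Measure X) : Prop :=
  ∀ E : ℕ → Set X, (∀ n, MeasurableSet (E n)) →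
    (∀ g : Γ, Tendsto (fun n => μ (symmDiff ((fun x => g • x) ⁻¹' E n) (E n))) atTop (𝓝 0)) →
    Tendsto (fun n => μ (E n) * μ (E n)ᶜ) atTop (𝓝 0)

/-- `Δ` is an isomorphism of measure spaces, up to null sets. -/
def IsMeasureIso {X Y : Type} [MeasurableSpace X] [MeasurableSpace Y]
    (μ : Measure X) (ν : Measure Y) (Δ : X → Y) : Prop :=
  MeasurePreserving Δ μ ν ∧ ∃ Δ' : Y → X, MeasurePreserving Δ' ν μ ∧
    (∀ᵐ x ∂μ, Δ' (Δ x) = x) ∧ (∀ᵐ y ∂ν, Δ (Δ' y) = y)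

/-- `φ` belongs to the full group of the action: it is an automorphism of the measure space
which maps almost every point into its own orbit. -/
def InFullGroup (μ : Measure X) (φ : X → X) : Prop :=
  IsMeasureIso μ μ φ ∧ ∀ᵐ x ∂μ, φ x ∈ MulAction.orbit Γ x

/-- `Δ` is an orbit equivalence of `Γ ↷ (X, μ)` and `Λ ↷ (Y, ν)`: an isomorphism of measure
spaces which maps almost every `Γ`-orbit onto a `Λ`-orbit. -/
def IsOE (Λ : Type) [Group Λ] {Y : Type} [MeasurableSpace Y] [MulAction Λ Y]
    (μ : Measure X) (ν : Measure Y) (Δ : X → Y) : Prop :=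
  IsMeasureIso μ ν Δ ∧ ∀ᵐ x ∂μ, Δ '' MulAction.orbit Γ x = MulAction.orbit Λ (Δ x)

/-- The action `Γ ↷ (X, μ)` is OE-superrigid: every orbit equivalence `Δ` with a free pmp action
of a countable group `Λ` comes from a conjugacy, that is, `φ ∘ Δ` is a conjugacy (with respect to
some isomorphism `δ` of the groups) for some `φ` in the full group of the action of `Λ`. -/
def OESuperrigid (μ : Measure X) : Prop :=
  ∀ (Λ : Type) [Group Λ] [Countable Λ]
    (Y : Type) [MeasurableSpace Y] [StandardBorelSpace Y] [MulAction Λ Y] [MeasurableConstSMul Λ Y]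
    (ν : Measure Y) [IsProbabilityMeasure ν] [SMulInvariantMeasure Λ Y ν],
    IsFree Λ ν → ∀ Δ : X → Y, IsOE Γ Λ μ ν Δ →
      ∃ φ : Y → Y, InFullGroup Λ ν φ ∧ ∃ δ : Γ ≃* Λ,
        ∀ g : Γ, ∀ᵐ x ∂μ, φ (Δ (g • x)) = δ g • φ (Δ x)

end Actions

/-! ### The group measure space von Neumann algebra -/

section CrossedProduct

variable (Γ : Type) [Group Γ] [Countable Γ] [MeasurableSpace Γ] [DiscreteMeasurableSpace Γ]
  {X : Type} [MeasurableSpace X] (μ : Measure X) [IsProbabilityMeasure μ]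

/-- The Hilbert space `L²(Γ × X) = ℓ²(Γ) ⊗ L²(X)`; the vector `ξ` stands for `∑ ξ(g, ·) u_g`. -/
abbrev GMSSpace : Type := Lp ℂ 2 ((Measure.count : Measure Γ).prod μ)

variable {Γ μ} in
/-- `T` is the operator of multiplication by the function `F` on `Γ × X`. -/
def IsMulBy (T : GMSSpace Γ μ →L[ℂ] GMSSpace Γ μ) (F : Γ × X → ℂ) : Prop :=
  ∀ ξ : GMSSpace Γ μ, T ξ =ᵐ[(Measure.count : Measure Γ).prod μ] fun p => F p * ξ p

variable {Γ μ} in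
theorem exists_isMulBy {F : Γ × X → ℂ} (hF : Measurable F) {C : ℝ} (hC : ∀ p, ‖F p‖ ≤ C) :
    ∃ T : GMSSpace Γ μ →L[ℂ] GMSSpace Γ μ, IsMulBy T F := by
  have hm : MemLp F ∞ ((Measure.count : Measure Γ).prod μ) :=
    memLp_top_of_bound hF.aestronglyMeasurable C (.of_forall hC)
  refine ⟨(ContinuousLinearMap.mul ℂ ℂ).holderL _ ∞ 2 2 (hm.toLp F), fun ξ => ?_⟩
  filter_upwards [(ContinuousLinearMap.mul ℂ ℂ).coeFn_holder (r := 2) (hm.toLp F) ξ,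
    hm.coeFn_toLp] with p h1 h2
  simp only [ContinuousLinearMap.holderL_apply_apply]
  rw [h1, h2]; simp

variable {Γ μ} in
theorem isMulBy_ext {S T : GMSSpace Γ μ →L[ℂ] GMSSpace Γ μ} {F : Γ × X → ℂ}
    (hS : IsMulBy S F) (hT : IsMulBy T F) : S = T := by
  ext1 ξ
  exact Lp.ext ((hS ξ).trans (hT ξ).symm)

variable {Γ μ} in
theorem isMulBy_star {T : GMSSpace Γ μ →L[ℂ] GMSSpace Γ μ} {F : Γ × X → ℂ}
    (hT : IsMulBy T F) (hF : Measurable F) {C : ℝ} (hC : ∀ p, ‖F p‖ ≤ C) :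
    IsMulBy (star T) (fun p => (starRingEnd ℂ) (F p)) := by
  obtain ⟨S, hS⟩ := exists_isMulBy (μ := μ) (F := fun p => (starRingEnd ℂ) (F p)) (C := C)
    (Complex.continuous_conj.measurable.comp hF) (fun p => by simpa using hC p)
  have : S = star T := by
    rw [ContinuousLinearMap.star_eq_adjoint, ContinuousLinearMap.eq_adjoint_iff]
    intro x y
    rw [L2.inner_def, L2.inner_def]
    apply integral_congr_ae
    filter_upwards [hS x, hT y] with p h1 h2
    rw [h1, h2]
    simp only [RCLike.inner_apply, map_mul, Complex.conj_conj]
    ring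
  exact this ▸ hS

/-- The copy of `L^∞(X)` acting on `L²(Γ × X)` by `(a ξ)(h, x) = a(x) ξ(h, x)`. -/
def mulAlg : StarSubalgebra ℂ (GMSSpace Γ μ →L[ℂ] GMSSpace Γ μ) where
  carrier := {T | ∃ f : X → ℂ, Measurable f ∧ (∃ C : ℝ, ∀ x, ‖f x‖ ≤ C) ∧
    IsMulBy T (fun p => f p.2)}
  mul_mem' := by
    rintro S T ⟨f, hf, ⟨C, hC⟩, hS⟩ ⟨k, hk, ⟨D, hD⟩, hT⟩
    refine ⟨fun x => f x * k x, hf.mul hk, ⟨C * D, fun x => ?_⟩, fun ξ => ?_⟩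
    · rw [norm_mul]
      exact mul_le_mul (hC x) (hD x) (norm_nonneg _) ((norm_nonneg _).trans (hC x))
    · filter_upwards [hS (T ξ), hT ξ] with p h1 h2
      simp only [mul_apply_eq_comp]
      rw [h1, h2]; ring
  add_mem' := by
    rintro S T ⟨f, hf, ⟨C, hC⟩, hS⟩ ⟨k, hk, ⟨D, hD⟩, hT⟩
    refine ⟨fun x => f x + k x, hf.add hk, ⟨C + D, fun x => ?_⟩, fun ξ => ?_⟩
    · exact (norm_add_le _ _).trans (add_le_add (hC x) (hD x))
    · filter_upwards [hS ξ, hT ξ, Lp.coeFn_add (S ξ) (T ξ)] with p h1 h2 h3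
      simp only [add_apply]
      rw [h3, Pi.add_apply, h1, h2]; ring
  algebraMap_mem' := by
    intro c
    refine ⟨fun _ => c, measurable_const, ⟨‖c‖, fun _ => le_rfl⟩, fun ξ => ?_⟩
    rw [Algebra.algebraMap_eq_smul_one]
    filter_upwards [Lp.coeFn_smul c ξ] with p h
    simp only [smul_apply, one_apply_eq_self]
    rw [h]; simp
  star_mem' := by
    rintro T ⟨f, hf, ⟨C, hC⟩, hT⟩
    exact ⟨fun x => (starRingEnd ℂ) (f x), Complex.continuous_conj.measurable.comp hf,
      ⟨C, fun x => by simpa using hC x⟩, isMulBy_star hT (hf.comp measurable_snd) (fun p => hC p.2)⟩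

variable [MulAction Γ X] [MeasurableConstSMul Γ X] [SMulInvariantMeasure Γ X μ]


theorem measurePreserving_count {Γ : Type} [MeasurableSpace Γ] [DiscreteMeasurableSpace Γ]
    (e : Γ ≃ Γ) :
    MeasurePreserving e (Measure.count : Measure Γ) Measure.count := by
  refine ⟨.of_discrete, ?_⟩
  ext s hs
  rw [Measure.map_apply .of_discrete hs, Measure.count_apply (.of_discrete),
    Measure.count_apply hs,
    ← Set.InjOn.encard_image (e.injective.injOn), Set.image_preimage_eq _ e.surjective]

variable {Γ} in
theorem measurePreserving_diag (g : Γ) :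
    MeasurePreserving (fun p : Γ × X => (g * p.1, g • p.2))
      ((Measure.count : Measure Γ).prod μ) ((Measure.count : Measure Γ).prod μ) :=
  (measurePreserving_count (Equiv.mulLeft g)).prod (measurePreserving_smul g μ)

variable {Γ} in
theorem measurePreserving_right (g : Γ) :
    MeasurePreserving (fun p : Γ × X => (p.1 * g, p.2))
      ((Measure.count : Measure Γ).prod μ) ((Measure.count : Measure Γ).prod μ) :=
  (measurePreserving_count (Equiv.mulRight g)).prod (MeasurePreserving.id μ)

theorem measurePreserving_inv :
    MeasurePreserving (fun p : Γ × X => (p.1⁻¹, p.1⁻¹ • p.2))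
      ((Measure.count : Measure Γ).prod μ) ((Measure.count : Measure Γ).prod μ) :=
  (measurePreserving_count (Equiv.inv Γ)).skew_product (g := fun h x => h⁻¹ • x)
    (measurable_from_prod_countable_right fun h => measurable_const_smul h⁻¹)
    (.of_forall fun h => (measurePreserving_smul h⁻¹ μ).map_eq)

variable {Γ} in
/-- The canonical unitary `u_g`, acting by `(u_g ξ)(h, x) = ξ(g⁻¹ h, g⁻¹ x)`. -/
def canonOp (g : Γ) : GMSSpace Γ μ →L[ℂ] GMSSpace Γ μ :=
  (Lp.compMeasurePreservingₗᵢ ℂ _ (measurePreserving_diag μ g⁻¹)).toContinuousLinearMap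

variable {Γ} in
theorem canonOp_apply (g : Γ) (ξ : GMSSpace Γ μ) :
    canonOp μ g ξ =ᵐ[(Measure.count : Measure Γ).prod μ] fun p => ξ (g⁻¹ * p.1, g⁻¹ • p.2) :=
  Lp.coeFn_compMeasurePreserving ξ (measurePreserving_diag μ g⁻¹)

theorem canonOp_one : canonOp μ (1 : Γ) = 1 := by
  ext1 ξ
  refine Lp.ext ?_
  filter_upwards [canonOp_apply μ (1 : Γ) ξ] with p h
  rw [h]; simp

variable {Γ} in
theorem canonOp_mul (g h : Γ) : canonOp μ (g * h) = canonOp μ g * canonOp μ h := by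
  ext1 ξ
  refine Lp.ext ?_
  filter_upwards [canonOp_apply μ (g * h) ξ, canonOp_apply μ g (canonOp μ h ξ),
    (measurePreserving_diag μ g⁻¹).quasiMeasurePreserving.ae (canonOp_apply μ h ξ)] with p h1 h2 h3
  rw [h1, mul_apply_eq_comp, h2, h3]
  simp [mul_assoc, mul_smul]

variable {Γ} in
theorem star_canonOp (g : Γ) : star (canonOp μ g) = canonOp μ g⁻¹ := by
  rw [ContinuousLinearMap.star_eq_adjoint]
  symm
  rw [ContinuousLinearMap.eq_adjoint_iff]
  intro x y
  have h : canonOp μ g (canonOp μ g⁻¹ x) = x := by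
    rw [← mul_apply_eq_comp, ← canonOp_mul, mul_inv_cancel, canonOp_one]; simp
  conv_rhs => rw [← h]
  exact (LinearIsometry.inner_map_map (𝕜 := ℂ) (E := GMSSpace Γ μ) (E' := GMSSpace Γ μ)
    (Lp.compMeasurePreservingₗᵢ ℂ _ (measurePreserving_diag μ g⁻¹)) _ _).symm

variable {Γ} in
/-- `u_g a u_g^* = σ_g(a)`, where `σ_g(a)(x) = a(g⁻¹ x)`. -/
theorem canonOp_conj (g : Γ) {T : GMSSpace Γ μ →L[ℂ] GMSSpace Γ μ} {f : X → ℂ}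
    (hT : IsMulBy T fun p => f p.2) :
    IsMulBy (canonOp μ g * T * canonOp μ g⁻¹) fun p => f (g⁻¹ • p.2) := by
  intro ξ
  have hq := (measurePreserving_diag μ g⁻¹).quasiMeasurePreserving
  filter_upwards [canonOp_apply μ g (T (canonOp μ g⁻¹ ξ)), hq.ae (hT (canonOp μ g⁻¹ ξ)),
    hq.ae (canonOp_apply μ g⁻¹ ξ)] with p h1 h2 h3
  rw [mul_apply_eq_comp, mul_apply_eq_comp, h1, h2, h3]
  simp

/-- The group measure space von Neumann algebra `M = L^∞(X) ⋊ Γ`: the bicommutant of the set of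
operators consisting of `L^∞(X)` and the canonical unitaries. -/
def crossedProduct : StarSubalgebra ℂ (GMSSpace Γ μ →L[ℂ] GMSSpace Γ μ) :=
  StarSubalgebra.centralizer ℂ
    (StarSubalgebra.centralizer ℂ ((mulAlg Γ μ : Set _) ∪ Set.range (canonOp (Γ := Γ) μ)) : Set _)

theorem subset_crossedProduct :
    (mulAlg Γ μ : Set _) ∪ Set.range (canonOp (Γ := Γ) μ) ⊆ crossedProduct Γ μ := by
  intro x hx
  rw [SetLike.mem_coe, crossedProduct, StarSubalgebra.mem_centralizer_iff]
  intro y hy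
  rw [SetLike.mem_coe, StarSubalgebra.mem_centralizer_iff] at hy
  have h1 := hy x hx
  refine ⟨h1.1.symm, ?_⟩
  have h2 := congrArg star h1.2
  simpa using h2

theorem mulAlg_le_crossedProduct : mulAlg Γ μ ≤ crossedProduct Γ μ := fun _ hx =>
  subset_crossedProduct Γ μ (Or.inl hx)

/-- The trace vector `1 · u_e ∈ L²(Γ × X)`. -/
def traceVec : GMSSpace Γ μ :=
  indicatorConstLp 2 (μ := (Measure.count : Measure Γ).prod μ)
    (s := ({1} : Set Γ) ×ˢ (Set.univ : Set X)) (.prod (.of_discrete) .univ)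
    (by simp [Measure.prod_prod]) (1 : ℂ)

theorem integral_comp_of_measurePreserving {α : Type} [MeasurableSpace α] {ν : Measure α}
    {T : α → α} (hT : MeasurePreserving T ν ν) {F : α → ℂ} (hF : AEStronglyMeasurable F ν) :
    ∫ a, F (T a) ∂ν = ∫ a, F a ∂ν := by
  have h := integral_map (μ := ν) (f := F) hT.measurable.aemeasurable (by rwa [hT.map_eq])
  rw [hT.map_eq] at h
  exact h.symm

variable {Γ} in
/-- The right translation operator `(R_g ξ)(h, x) = ξ(h g, x)`. -/
def rightOp (g : Γ) : GMSSpace Γ μ →L[ℂ] GMSSpace Γ μ :=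
  (Lp.compMeasurePreservingₗᵢ ℂ _ (measurePreserving_right μ g)).toContinuousLinearMap

variable {Γ} in
theorem rightOp_apply (g : Γ) (ξ : GMSSpace Γ μ) :
    rightOp μ g ξ =ᵐ[(Measure.count : Measure Γ).prod μ] fun p => ξ (p.1 * g, p.2) :=
  Lp.coeFn_compMeasurePreserving ξ (measurePreserving_right μ g)

theorem crossedProduct_commute {x y : GMSSpace Γ μ →L[ℂ] GMSSpace Γ μ}
    (hx : x ∈ crossedProduct Γ μ)
    (h1 : ∀ z ∈ mulAlg Γ μ, z * y = y * z) (h2 : ∀ g : Γ, canonOp μ g * y = y * canonOp μ g) :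
    x * y = y * x := by
  rw [crossedProduct, StarSubalgebra.mem_centralizer_iff] at hx
  refine (hx y ?_).1.symm
  rw [SetLike.mem_coe, StarSubalgebra.mem_centralizer_iff]
  rintro z (hz | ⟨g, rfl⟩)
  · exact ⟨h1 z hz, h1 _ (star_mem hz)⟩
  · refine ⟨h2 g, ?_⟩
    rw [star_canonOp]
    exact h2 _

variable {Γ} in
theorem commute_rightOp {x : GMSSpace Γ μ →L[ℂ] GMSSpace Γ μ} (hx : x ∈ crossedProduct Γ μ)
    (g : Γ) : x * rightOp μ g = rightOp μ g * x := by
  have hq := (measurePreserving_right μ g).quasiMeasurePreserving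
  refine crossedProduct_commute Γ μ hx ?_ ?_
  · rintro z ⟨f, -, -, hz⟩
    ext1 ξ
    refine Lp.ext ?_
    rw [mul_apply_eq_comp, mul_apply_eq_comp]
    filter_upwards [hz (rightOp μ g ξ), rightOp_apply μ g ξ, rightOp_apply μ g (z ξ),
      hq.ae (hz ξ)] with p h1 h2 h3 h4
    rw [h1, h2, h3, h4]
  · intro h
    ext1 ξ
    refine Lp.ext ?_
    rw [mul_apply_eq_comp, mul_apply_eq_comp]
    filter_upwards [canonOp_apply μ h (rightOp μ g ξ), rightOp_apply μ g (canonOp μ h ξ),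
      (measurePreserving_diag μ h⁻¹).quasiMeasurePreserving.ae (rightOp_apply μ g ξ),
      hq.ae (canonOp_apply μ h ξ)] with p h1 h2 h3 h4
    rw [h1, h3, h2, h4]
    simp [mul_assoc]

variable {Γ} in
theorem commute_rightMul {x T : GMSSpace Γ μ →L[ℂ] GMSSpace Γ μ} (hx : x ∈ crossedProduct Γ μ)
    {f : X → ℂ} (hT : IsMulBy T fun p => f (p.1⁻¹ • p.2)) : x * T = T * x := by
  refine crossedProduct_commute Γ μ hx ?_ ?_
  · rintro z ⟨k, -, -, hz⟩
    ext1 ξ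
    refine Lp.ext ?_
    rw [mul_apply_eq_comp, mul_apply_eq_comp]
    filter_upwards [hz (T ξ), hT ξ, hT (z ξ), hz ξ] with p h1 h2 h3 h4
    rw [h1, h2, h3, h4]
    ring
  · intro h
    ext1 ξ
    refine Lp.ext ?_
    rw [mul_apply_eq_comp, mul_apply_eq_comp]
    filter_upwards [canonOp_apply μ h (T ξ), hT (canonOp μ h ξ),
      (measurePreserving_diag μ h⁻¹).quasiMeasurePreserving.ae (hT ξ),
      canonOp_apply μ h ξ] with p h1 h2 h3 h4
    rw [h1, h3, h2, h4]
    simp [mul_smul]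

variable {Γ} in
theorem setIntegral_star_traceVec {x : GMSSpace Γ μ →L[ℂ] GMSSpace Γ μ}
    (hx : x ∈ crossedProduct Γ μ) (g : Γ) {E : Set X} (hE : MeasurableSet E) :
    ∫ p in ({g} : Set Γ) ×ˢ E, (star x (traceVec Γ μ)) p ∂((Measure.count : Measure Γ).prod μ) =
    ∫ p in ({g} : Set Γ) ×ˢ E, (starRingEnd ℂ) ((x (traceVec Γ μ)) (p.1⁻¹, p.1⁻¹ • p.2))
      ∂((Measure.count : Measure Γ).prod μ) := by
  set ν : Measure (Γ × X) := (Measure.count : Measure Γ).prod μ with hν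
  set Ω := traceVec Γ μ with hΩ
  have hms : MeasurableSet (({g} : Set Γ) ×ˢ E) := .prod (.of_discrete) hE
  have hfin : ν (({g} : Set Γ) ×ˢ E) ≠ ∞ := by
    rw [hν, Measure.prod_prod]; simp
  have hmF : Measurable fun p : Γ × X => p.1⁻¹ • p.2 := (measurePreserving_inv Γ μ).measurable.snd
  set φ : X → ℂ := ((fun y => g • y) ⁻¹' E).indicator 1 with hφ
  have hφm : Measurable φ := measurable_one.indicator (measurable_const_smul g hE)
  obtain ⟨T, hT⟩ := exists_isMulBy (μ := μ) (F := fun p : Γ × X => φ (p.1⁻¹ • p.2)) (C := 1)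
    (hφm.comp hmF) (fun p => by
      by_cases h : p.1⁻¹ • p.2 ∈ (fun y => g • y) ⁻¹' E <;> simp [hφ, h])
  have hΩae : Ω =ᵐ[ν] (({1} : Set Γ) ×ˢ (Set.univ : Set X)).indicator fun _ => (1 : ℂ) :=
    indicatorConstLp_coeFn
  set e : GMSSpace Γ μ := indicatorConstLp 2 hms hfin (1 : ℂ) with he
  have heR : e = (T * rightOp μ g⁻¹) Ω := by
    refine Lp.ext ?_
    rw [mul_apply_eq_comp]
    filter_upwards [indicatorConstLp_coeFn (p := 2) (hs := hms) (hμs := hfin) (c := (1 : ℂ)),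
      hT (rightOp μ g⁻¹ Ω), rightOp_apply μ g⁻¹ Ω,
      (measurePreserving_right μ g⁻¹).quasiMeasurePreserving.ae hΩae] with p h1 h2 h3 h4
    rw [h1, h2, h3, h4]
    obtain ⟨k, y⟩ := p
    by_cases hk : k = g
    · subst hk
      by_cases hy : y ∈ E <;> simp [hφ, Set.indicator, hy]
    · have : ¬ k * g⁻¹ = 1 := fun h => hk (mul_inv_eq_one.1 h)
      simp [Set.indicator, hk, this]
  have hcomm : x * (T * rightOp μ g⁻¹) = (T * rightOp μ g⁻¹) * x := by
    rw [← mul_assoc, commute_rightMul μ hx hT, mul_assoc, commute_rightOp μ hx, mul_assoc]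
  have key : inner ℂ e (star x Ω) = (starRingEnd ℂ) (inner ℂ Ω (T (rightOp μ g⁻¹ (x Ω)))) := by
    rw [ContinuousLinearMap.star_eq_adjoint, ContinuousLinearMap.adjoint_inner_right, heR,
      ← mul_apply_eq_comp x, hcomm, inner_conj_symm]
    rfl
  rw [he, L2.inner_indicatorConstLp_one] at key
  have hΩi : inner ℂ Ω (T (rightOp μ g⁻¹ (x Ω))) =
      ∫ p in ({1} : Set Γ) ×ˢ (Set.univ : Set X), T (rightOp μ g⁻¹ (x Ω)) p ∂ν :=
    L2.inner_indicatorConstLp_one _ _ _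
  rw [key, hΩi, ← integral_conj,
    ← integral_indicator hms, ← integral_indicator (.prod (.of_discrete) .univ)]
  have hsm : AEStronglyMeasurable ((({g} : Set Γ) ×ˢ E).indicator fun p : Γ × X =>
      (starRingEnd ℂ) ((x Ω) (p.1⁻¹, p.1⁻¹ • p.2))) ν := by
    refine AEStronglyMeasurable.indicator ?_ hms
    exact Complex.continuous_conj.comp_aestronglyMeasurable
      ((Lp.aestronglyMeasurable _).comp_measurePreserving (measurePreserving_inv Γ μ))
  rw [← integral_comp_of_measurePreserving (measurePreserving_diag μ g) hsm]
  refine integral_congr_ae ?_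
  filter_upwards [hT (rightOp μ g⁻¹ (x Ω)), rightOp_apply μ g⁻¹ (x Ω)] with p h1 h2
  obtain ⟨k, y⟩ := p
  by_cases hk : k = 1
  · subst hk
    by_cases hy : g • y ∈ E
    · simp [hφ, Set.indicator, hy, h1, h2]
    · simp [hφ, Set.indicator, hy, h1, h2]
  · have : ¬ g * k = g := fun h => hk (by simpa using h)
    simp [Set.indicator, hk, this]

theorem star_traceVec {x : GMSSpace Γ μ →L[ℂ] GMSSpace Γ μ} (hx : x ∈ crossedProduct Γ μ) :
    star x (traceVec Γ μ) =ᵐ[(Measure.count : Measure Γ).prod μ]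
      fun p => (starRingEnd ℂ) ((x (traceVec Γ μ)) (p.1⁻¹, p.1⁻¹ • p.2)) := by
  set ν : Measure (Γ × X) := (Measure.count : Measure Γ).prod μ with hν
  have hU : (⋃ g : Γ, ({g} : Set Γ) ×ˢ (Set.univ : Set X)) = Set.univ := by
    ext p; simp
  suffices h : ∀ᵐ p ∂(ν.restrict Set.univ), star x (traceVec Γ μ) p =
      (starRingEnd ℂ) ((x (traceVec Γ μ)) (p.1⁻¹, p.1⁻¹ • p.2)) by
    rwa [Measure.restrict_univ] at h
  rw [← hU, ae_restrict_iUnion_iff]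
  intro g
  have hms : MeasurableSet (({g} : Set Γ) ×ˢ (Set.univ : Set X)) := .prod (.of_discrete) .univ
  have hfin : ν (({g} : Set Γ) ×ˢ (Set.univ : Set X)) ≠ ∞ := by
    rw [hν, Measure.prod_prod]; simp
  have : IsFiniteMeasure (ν.restrict (({g} : Set Γ) ×ˢ (Set.univ : Set X))) :=
    ⟨by rw [Measure.restrict_apply_univ]; exact hfin.lt_top⟩
  have hint : ∀ F : Γ × X → ℂ, MemLp F 2 ν →
      Integrable F (ν.restrict (({g} : Set Γ) ×ˢ (Set.univ : Set X))) := fun F hF =>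
    (hF.restrict _).integrable (by norm_num)
  have h2 : MemLp (fun p : Γ × X =>
      (starRingEnd ℂ) ((x (traceVec Γ μ)) (p.1⁻¹, p.1⁻¹ • p.2))) 2 ν :=
    ((Lp.memLp (x (traceVec Γ μ))).comp_measurePreserving (measurePreserving_inv Γ μ)).star
  refine Integrable.ae_eq_of_forall_setIntegral_eq _ _ (hint _ (Lp.memLp _)) (hint _ h2) ?_
  intro s hs _
  rw [Measure.restrict_restrict hs]
  have : s ∩ ({g} : Set Γ) ×ˢ (Set.univ : Set X) = ({g} : Set Γ) ×ˢ ((fun y => (g, y)) ⁻¹' s) := by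
    ext ⟨k, y⟩
    simp only [Set.mem_inter_iff, Set.mem_prod, Set.mem_singleton_iff, Set.mem_univ, and_true,
      Set.mem_preimage]
    constructor
    · rintro ⟨h, rfl⟩; exact ⟨rfl, h⟩
    · rintro ⟨rfl, h⟩; exact ⟨h, rfl⟩
  rw [this]
  exact setIntegral_star_traceVec μ hx g (measurable_prodMk_left hs)

/-- The vector state of `traceVec` is a trace on the group measure space algebra. -/
theorem norm_star_traceVec {x : GMSSpace Γ μ →L[ℂ] GMSSpace Γ μ} (hx : x ∈ crossedProduct Γ μ) :
    ‖star x (traceVec Γ μ)‖ = ‖x (traceVec Γ μ)‖ := by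
  rw [Lp.norm_def, Lp.norm_def, eLpNorm_congr_ae (star_traceVec Γ μ hx)]
  congr 1
  have h := eLpNorm_comp_measurePreserving (p := 2)
    (Lp.aestronglyMeasurable (x (traceVec Γ μ))) (measurePreserving_inv Γ μ)
  rw [← h]
  refine eLpNorm_congr_norm_ae (.of_forall fun p => ?_)
  simp

end CrossedProduct

/-! ### Tracial ultrapowers -/

section Ultrapower

variable {H : Type} [NormedAddCommGroup H] [InnerProductSpace ℂ H] [CompleteSpace H]

/-- `x ↦ ⟪Ω, x Ω⟫` is a trace on the operator algebra `M`. -/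
class IsTraceVector (M : StarSubalgebra ℂ (H →L[ℂ] H)) (Ω : H) : Prop where
  norm_star_apply : ∀ x ∈ M, ‖star x Ω‖ = ‖x Ω‖

variable (M : StarSubalgebra ℂ (H →L[ℂ] H)) (Ω : H) [IsTraceVector M Ω] (ω : Ultrafilter ℕ)

/-- The algebra `ℓ^∞(ℕ, M)` of bounded sequences in `M`. -/
def boundedSeq : StarSubalgebra ℂ (ℕ → M) where
  carrier := {x | ∃ C : ℝ, ∀ n, ‖(x n : H →L[ℂ] H)‖ ≤ C}
  mul_mem' := by
    rintro x y ⟨C, hC⟩ ⟨D, hD⟩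
    exact ⟨C * D, fun n => (norm_mul_le _ _).trans
      (mul_le_mul (hC n) (hD n) (norm_nonneg _) ((norm_nonneg _).trans (hC n)))⟩
  add_mem' := by
    rintro x y ⟨C, hC⟩ ⟨D, hD⟩
    exact ⟨C + D, fun n => (norm_add_le _ _).trans (add_le_add (hC n) (hD n))⟩
  algebraMap_mem' c := ⟨‖((algebraMap ℂ M c : M) : H →L[ℂ] H)‖, fun _ => le_rfl⟩
  star_mem' := by
    rintro x ⟨C, hC⟩
    exact ⟨C, fun n => (norm_star (x n : H →L[ℂ] H)).trans_le (hC n)⟩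

instance instRingBoundedSeq : Ring (boundedSeq M) := inferInstance

instance instSemiringBoundedSeq : Semiring (boundedSeq M) := inferInstance

instance instAddCommGroupBoundedSeq : AddCommGroup (boundedSeq M) := inferInstance

instance instAlgebraBoundedSeq : Algebra ℂ (boundedSeq M) := inferInstance

instance instStarRingBoundedSeq : StarRing (boundedSeq M) := inferInstance

/-- The ideal of the bounded sequences `x` with `lim_ω ‖x n‖₂ = 0`, where `‖x‖₂ = ‖x Ω‖`. -/
def nullIdeal : Ideal (boundedSeq M) where
  carrier := {x | Tendsto (fun n => ‖((x : ℕ → M) n : H →L[ℂ] H) Ω‖) ω (𝓝 0)}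
  zero_mem' := by simp
  add_mem' := by
    intro x y hx hy
    refine squeeze_zero (fun _ => norm_nonneg _) (fun n => norm_add_le _ _) ?_
    simpa using hx.add hy
  smul_mem' := by
    rintro ⟨c, C, hC⟩ x hx
    refine squeeze_zero (g := fun n => C * ‖((x : ℕ → M) n : H →L[ℂ] H) Ω‖)
      (fun _ => norm_nonneg _) (fun n => ?_) (by simpa using hx.const_mul C)
    exact ((c n : H →L[ℂ] H).le_opNorm _).trans
      (mul_le_mul_of_nonneg_right (hC n) (norm_nonneg _))

theorem star_mem_nullIdeal {x : boundedSeq M} (hx : x ∈ nullIdeal M Ω ω) :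
    star x ∈ nullIdeal M Ω ω := by
  refine hx.congr fun n => ?_
  exact (IsTraceVector.norm_star_apply _ (SetLike.coe_mem ((x : ℕ → M) n))).symm

instance instIsTwoSidedNullIdeal : (nullIdeal M Ω ω).IsTwoSided where
  mul_mem_of_left := by
    intro a b ha
    have h := star_mem_nullIdeal M Ω ω
      ((nullIdeal M Ω ω).mul_mem_left (star b) (star_mem_nullIdeal M Ω ω ha))
    simpa using h

/-- The tracial ultrapower `M^ω`. -/
def Ultrapower : Type := boundedSeq M ⧸ nullIdeal M Ω ω

instance instRingUltrapower : Ring (Ultrapower M Ω ω) :=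
  inferInstanceAs (Ring (boundedSeq M ⧸ nullIdeal M Ω ω))

instance instAlgebraUltrapower : Algebra ℂ (Ultrapower M Ω ω) :=
  inferInstanceAs (Algebra ℂ (boundedSeq M ⧸ nullIdeal M Ω ω))

/-- The element `(x_n)_n` of the ultrapower. -/
def mkU (x : boundedSeq M) : Ultrapower M Ω ω := Ideal.Quotient.mk (nullIdeal M Ω ω) x

instance instStarRingUltrapower : StarRing (Ultrapower M Ω ω) where
  star := Quotient.map' star (by
    intro x y h
    rw [Submodule.quotientRel_def] at h ⊢
    simpa using star_mem_nullIdeal M Ω ω h)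
  star_involutive := by
    rintro ⟨x⟩
    exact congrArg (mkU M Ω ω) (star_star x)
  star_mul := by
    rintro ⟨x⟩ ⟨y⟩
    exact congrArg (mkU M Ω ω) (star_mul x y)
  star_add := by
    rintro ⟨x⟩ ⟨y⟩
    exact congrArg (mkU M Ω ω) (star_add x y)

instance instStarModuleUltrapower : StarModule ℂ (Ultrapower M Ω ω) where
  star_smul := by
    rintro c ⟨x⟩
    exact congrArg (mkU M Ω ω) (star_smul c x)

/-- The quotient map `ℓ^∞(ℕ, M) → M^ω` as a homomorphism of *-algebras. -/
def mkHom : boundedSeq M →⋆ₐ[ℂ] Ultrapower M Ω ω :=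
  { Ideal.Quotient.mkₐ ℂ (nullIdeal M Ω ω) with
    map_star' := fun _ => rfl }

variable {M} in
theorem exists_tendsto_state (x : boundedSeq M) :
    ∃ l : ℂ, Tendsto (fun n => inner ℂ Ω (((x : ℕ → M) n : H →L[ℂ] H) Ω)) ω (𝓝 l) := by
  obtain ⟨x, C, hC⟩ := x
  have hmem : ∀ n, inner ℂ Ω ((x n : H →L[ℂ] H) Ω) ∈ Metric.closedBall (0 : ℂ) (‖Ω‖ * (C * ‖Ω‖)) := by
    intro n
    rw [mem_closedBall_zero_iff]
    refine (norm_inner_le_norm _ _).trans (mul_le_mul_of_nonneg_left ?_ (norm_nonneg _))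
    exact ((x n : H →L[ℂ] H).le_opNorm _).trans
      (mul_le_mul_of_nonneg_right (hC n) (norm_nonneg _))
  obtain ⟨l, -, hl⟩ := (isCompact_closedBall (0 : ℂ) (‖Ω‖ * (C * ‖Ω‖))).ultrafilter_le_nhds
    (ω.map fun n => inner ℂ Ω ((x n : H →L[ℂ] H) Ω))
    (by rw [Ultrafilter.coe_map, le_principal_iff]; exact mem_map.2 (Filter.univ_mem' hmem))
  exact ⟨l, hl⟩

/-- The trace `τ((x_n)_n) = lim_ω ⟪Ω, x_n Ω⟫` of the ultrapower. -/
def utrace : Ultrapower M Ω ω → ℂ :=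
  Quotient.lift (fun x : boundedSeq M =>
    limUnder (ω : Filter ℕ) fun n => inner ℂ Ω (((x : ℕ → M) n : H →L[ℂ] H) Ω)) (by
    intro x y h
    have h' : x - y ∈ nullIdeal M Ω ω := (Submodule.quotientRel_def _).1 h
    obtain ⟨l, hl⟩ := exists_tendsto_state Ω ω x
    have h0 : Tendsto (fun n => inner ℂ Ω ((((x - y : boundedSeq M) : ℕ → M) n : H →L[ℂ] H) Ω))
        ω (𝓝 0) := by
      refine squeeze_zero_norm (fun n => norm_inner_le_norm (𝕜 := ℂ) _ _) ?_
      simpa using Tendsto.const_mul ‖Ω‖ h'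
    have hl' : Tendsto (fun n => inner ℂ Ω (((y : ℕ → M) n : H →L[ℂ] H) Ω)) ω (𝓝 l) := by
      have := hl.sub h0
      rw [sub_zero] at this
      refine this.congr fun n => ?_
      rw [← inner_sub_right]
      simp
    exact hl.limUnder_eq.trans hl'.limUnder_eq.symm)

theorem tendsto_utrace (x : boundedSeq M) :
    Tendsto (fun n => inner ℂ Ω (((x : ℕ → M) n : H →L[ℂ] H) Ω)) ω
      (𝓝 (utrace M Ω ω (mkU M Ω ω x))) := by
  obtain ⟨l, hl⟩ := exists_tendsto_state Ω ω x
  have : utrace M Ω ω (mkU M Ω ω x) = l := hl.limUnder_eq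
  rwa [this]

/-- The norm `‖x‖₂ = τ(x^* x)^{1/2}` of the ultrapower. -/
def twoNorm (x : Ultrapower M Ω ω) : ℝ := Real.sqrt (utrace M Ω ω (star x * x)).re

/-- The constant sequence `x`. -/
def constSeq (x : M) : boundedSeq M := ⟨fun _ => x, ‖(x : H →L[ℂ] H)‖, fun _ => le_rfl⟩

/-- The element of the ultrapower given by a constant sequence. -/
def constU (x : M) : Ultrapower M Ω ω := mkU M Ω ω (constSeq M x)

/-- `M ⊂ M^ω` on the level of unitaries. -/
def constUnitary (u : unitary M) : unitary (Ultrapower M Ω ω) :=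
  ⟨constU M Ω ω u, by
    rw [Unitary.mem_iff]
    constructor
    · refine Eq.trans ?_ (map_one (mkHom M Ω ω))
      exact congrArg (mkU M Ω ω) (Subtype.ext (funext fun _ => Unitary.coe_star_mul_self u))
    · refine Eq.trans ?_ (map_one (mkHom M Ω ω))
      exact congrArg (mkU M Ω ω) (Subtype.ext (funext fun _ => Unitary.coe_mul_star_self u))⟩

/-- The ultrapower `A^ω ⊂ M^ω` of a subalgebra `A ⊂ M`: the classes of the bounded sequences
in `A`. -/
def subUltrapower (A : StarSubalgebra ℂ M) : StarSubalgebra ℂ (Ultrapower M Ω ω) where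
  carrier := {q | ∃ x : boundedSeq M, (∀ n, (x : ℕ → M) n ∈ A) ∧ mkU M Ω ω x = q}
  mul_mem' := by
    rintro _ _ ⟨x, hx, rfl⟩ ⟨y, hy, rfl⟩
    exact ⟨x * y, fun n => mul_mem (hx n) (hy n), rfl⟩
  add_mem' := by
    rintro _ _ ⟨x, hx, rfl⟩ ⟨y, hy, rfl⟩
    exact ⟨x + y, fun n => add_mem (hx n) (hy n), rfl⟩
  algebraMap_mem' c := ⟨algebraMap ℂ _ c, fun _ => A.algebraMap_mem c, rfl⟩
  star_mem' := by
    rintro _ ⟨x, hx, rfl⟩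
    exact ⟨star x, fun n => star_mem (hx n), rfl⟩

theorem mkU_mem_subUltrapower {A : StarSubalgebra ℂ M} (x : boundedSeq M)
    (hx : ∀ n, (x : ℕ → M) n ∈ A) : mkU M Ω ω x ∈ subUltrapower M Ω ω A := ⟨x, hx, rfl⟩

/-- The normalizer of a *-subalgebra `A` of `R`: the unitaries `u` of `R` with `u A u^* = A`. -/
def normalizer {R : Type} [Ring R] [StarRing R] [Algebra ℂ R] [StarModule ℂ R]
    (A : StarSubalgebra ℂ R) : Set (unitary R) :=
  {u | ∀ a : R, Unitary.conjStarAlgAut ℂ R u a ∈ A ↔ a ∈ A}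

/-- The automorphism `Ad(u)` of `A` for `u` in the normalizer of `A`. -/
def Ad {R : Type} [Ring R] [StarRing R] [Algebra ℂ R] [StarModule ℂ R]
    {A : StarSubalgebra ℂ R} (u : unitary R) (hu : u ∈ normalizer A) : A ≃⋆ₐ[ℂ] A where
  toFun a := ⟨Unitary.conjStarAlgAut ℂ R u a, (hu a).2 a.2⟩
  invFun a := ⟨(Unitary.conjStarAlgAut ℂ R u).symm a, (hu _).1 (by
    rw [StarAlgEquiv.apply_symm_apply]; exact a.2)⟩
  left_inv a := Subtype.ext ((Unitary.conjStarAlgAut ℂ R u).symm_apply_apply a)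
  right_inv a := Subtype.ext ((Unitary.conjStarAlgAut ℂ R u).apply_symm_apply a)
  map_mul' a b := Subtype.ext (map_mul (Unitary.conjStarAlgAut ℂ R u) (a : R) (b : R))
  map_add' a b := Subtype.ext (map_add (Unitary.conjStarAlgAut ℂ R u) (a : R) (b : R))
  map_star' a := Subtype.ext (map_star (Unitary.conjStarAlgAut ℂ R u) (a : R))
  map_smul' c a := Subtype.ext (map_smul (Unitary.conjStarAlgAut ℂ R u) c (a : R))

theorem constU_conj_mem {A : StarSubalgebra ℂ M} {v w : M}
    (hv : ∀ a ∈ A, v * a * w ∈ A) {q : Ultrapower M Ω ω} (hq : q ∈ subUltrapower M Ω ω A) :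
    constU M Ω ω v * q * constU M Ω ω w ∈ subUltrapower M Ω ω A := by
  obtain ⟨x, hx, rfl⟩ := hq
  exact ⟨constSeq M v * x * constSeq M w, fun n => hv _ (hx n), rfl⟩

theorem constUnitary_mem_normalizer {A : StarSubalgebra ℂ M} {u : unitary M}
    (hu : u ∈ normalizer A) : constUnitary M Ω ω u ∈ normalizer (subUltrapower M Ω ω A) := by
  intro q
  have hs : star (constU M Ω ω (u : M)) = constU M Ω ω (star (u : M)) := rfl
  have hc : (constUnitary M Ω ω u : Ultrapower M Ω ω) = constU M Ω ω (u : M) := rfl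
  have h1 := Unitary.coe_star_mul_self (constUnitary M Ω ω u)
  rw [hc, hs] at h1
  rw [Unitary.conjStarAlgAut_apply, hc, hs]
  constructor
  · intro h
    have h2 := constU_conj_mem M Ω ω (v := star (u : M)) (w := (u : M)) (fun a ha => by
      refine (hu _).1 ?_
      rw [← Unitary.conjStarAlgAut_symm_apply (S := ℂ), StarAlgEquiv.apply_symm_apply]
      exact ha) h
    have h3 : constU M Ω ω (star (u : M)) * (constU M Ω ω (u : M) * q * constU M Ω ω (star (u : M)))
        * constU M Ω ω (u : M) = (constU M Ω ω (star (u : M)) * constU M Ω ω (u : M)) * q *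
          (constU M Ω ω (star (u : M)) * constU M Ω ω (u : M)) := by
      simp only [mul_assoc]
    rwa [h3, h1, one_mul, mul_one] at h2
  · exact constU_conj_mem M Ω ω fun a ha => (hu a).2 ha

/-- A *-subalgebra of the finite von Neumann algebra `M^ω` is a von Neumann subalgebra iff it is
closed in the norm `‖ ‖₂`. -/
def IsVNSubalgebra (Q : StarSubalgebra ℂ (Ultrapower M Ω ω)) : Prop :=
  ∀ x, (∀ ε : ℝ, 0 < ε → ∃ y ∈ Q, twoNorm M Ω ω (x - y) < ε) → x ∈ Q

/-- `M(ω) = A^ω ∨ N_M(A)`: the von Neumann subalgebra of `M^ω` generated by `A^ω` and the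
normalizer of `A` in `M`. -/
def cartanUltrapower (A : StarSubalgebra ℂ M) : StarSubalgebra ℂ (Ultrapower M Ω ω) :=
  sInf {Q | IsVNSubalgebra M Ω ω Q ∧ subUltrapower M Ω ω A ≤ Q ∧
    ∀ u ∈ normalizer A, constU M Ω ω (u : M) ∈ Q}

theorem subUltrapower_le_cartanUltrapower (A : StarSubalgebra ℂ M) :
    subUltrapower M Ω ω A ≤ cartanUltrapower M Ω ω A :=
  le_sInf fun _ hQ => hQ.2.1

end Ultrapower

/-! ### Ultrapowers of actions, ω-orbit equivalence and approximate orbit equivalence -/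

section Main

variable (Γ : Type) [Group Γ] [Countable Γ] [MeasurableSpace Γ] [DiscreteMeasurableSpace Γ]
  {X : Type} [MeasurableSpace X] (μ : Measure X) [IsProbabilityMeasure μ]
  [MulAction Γ X] [MeasurableConstSMul Γ X] [SMulInvariantMeasure Γ X μ]

instance instIsTraceVectorCrossedProduct : IsTraceVector (crossedProduct Γ μ) (traceVec Γ μ) :=
  ⟨fun _ hx => norm_star_traceVec Γ μ hx⟩

/-- The Cartan subalgebra `A = L^∞(X)` of `M = L^∞(X) ⋊ Γ`. -/
def cartan : StarSubalgebra ℂ (crossedProduct Γ μ) :=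
  (mulAlg Γ μ).comap (crossedProduct Γ μ).subtype

/-- The trace of `M = L^∞(X) ⋊ Γ`; on `A = L^∞(X)` it is `a ↦ ∫ a dμ`. -/
def crossedTrace (x : crossedProduct Γ μ) : ℂ :=
  inner ℂ (traceVec Γ μ) ((x : GMSSpace Γ μ →L[ℂ] GMSSpace Γ μ) (traceVec Γ μ))

variable {Γ} in
/-- The canonical unitary `u_g ∈ M`. -/
def canonUnitary (g : Γ) : unitary (crossedProduct Γ μ) :=
  ⟨⟨canonOp μ g, subset_crossedProduct Γ μ (Or.inr ⟨g, rfl⟩)⟩, by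
    rw [Unitary.mem_iff]
    constructor <;> refine Subtype.ext ?_
    · change star (canonOp μ g) * canonOp μ g = 1
      rw [star_canonOp, ← canonOp_mul, inv_mul_cancel, canonOp_one]
    · change canonOp μ g * star (canonOp μ g) = 1
      rw [star_canonOp, ← canonOp_mul, mul_inv_cancel, canonOp_one]⟩

variable {Γ} in
theorem canonOp_conj_mem (g : Γ) {T : GMSSpace Γ μ →L[ℂ] GMSSpace Γ μ} (hT : T ∈ mulAlg Γ μ) :
    canonOp μ g * T * canonOp μ g⁻¹ ∈ mulAlg Γ μ := by
  obtain ⟨f, hf, ⟨C, hC⟩, h⟩ := hT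
  exact ⟨fun x => f (g⁻¹ • x), hf.comp (measurable_const_smul g⁻¹), ⟨C, fun x => hC _⟩,
    canonOp_conj μ g h⟩

variable {Γ} in
theorem canonUnitary_mem_normalizer (g : Γ) : canonUnitary μ g ∈ normalizer (cartan Γ μ) := by
  intro a
  have h : ∀ b : crossedProduct Γ μ, b ∈ cartan Γ μ ↔
      (b : GMSSpace Γ μ →L[ℂ] GMSSpace Γ μ) ∈ mulAlg Γ μ := fun _ => Iff.rfl
  have hc : ((Unitary.conjStarAlgAut ℂ (crossedProduct Γ μ) (canonUnitary μ g) a :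
      crossedProduct Γ μ) : GMSSpace Γ μ →L[ℂ] GMSSpace Γ μ) =
      canonOp μ g * a * canonOp μ g⁻¹ := by
    rw [← star_canonOp]; rfl
  rw [h, h, hc]
  refine ⟨fun h1 => ?_, canonOp_conj_mem μ g⟩
  have h2 := canonOp_conj_mem μ g⁻¹ h1
  have h3 : canonOp μ g⁻¹ * (canonOp μ g * (a : GMSSpace Γ μ →L[ℂ] GMSSpace Γ μ) * canonOp μ g⁻¹)
      * canonOp μ g⁻¹⁻¹ = (canonOp μ g⁻¹ * canonOp μ g) * a * (canonOp μ g⁻¹ * canonOp μ g) := by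
    rw [inv_inv]; simp only [mul_assoc]
  rwa [h3, ← canonOp_mul, inv_mul_cancel, canonOp_one, one_mul, mul_one] at h2

variable (ω : Ultrafilter ℕ)

/-- The ultrapower `M^ω` of `M = L^∞(X) ⋊ Γ`. -/
abbrev MPow : Type := Ultrapower (crossedProduct Γ μ) (traceVec Γ μ) ω

/-- The ultrapower `A^ω ⊂ M^ω` of `A = L^∞(X)`. -/
abbrev APow : StarSubalgebra ℂ (MPow Γ μ ω) :=
  subUltrapower (crossedProduct Γ μ) (traceVec Γ μ) ω (cartan Γ μ)

/-- The von Neumann algebra `M(ω) = A^ω ∨ N_M(A) ⊂ M^ω`. -/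
abbrev MOmega : StarSubalgebra ℂ (MPow Γ μ ω) :=
  cartanUltrapower (crossedProduct Γ μ) (traceVec Γ μ) ω (cartan Γ μ)

/-- The normalizer `N_{M(ω)}(A^ω)` of `A^ω` in `M(ω)`. -/
def normalizerOmega : Set (unitary (MPow Γ μ ω)) :=
  {u | u ∈ normalizer (APow Γ μ ω) ∧ (u : MPow Γ μ ω) ∈ MOmega Γ μ ω}

variable {Γ} in
/-- The ultrapower action `σ^ω` of `Γ` on `A^ω`, `σ^ω_g((a_n)_n) = (σ_g(a_n))_n`, where
`σ_g(a) = u_g a u_g^*`. -/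
def ultraAction (g : Γ) : APow Γ μ ω ≃⋆ₐ[ℂ] APow Γ μ ω :=
  Ad (constUnitary _ _ ω (canonUnitary μ g))
    (constUnitary_mem_normalizer _ _ ω (canonUnitary_mem_normalizer μ g))

theorem ultraAction_mkU (g : Γ) (x : boundedSeq (crossedProduct Γ μ))
    (hx : ∀ n, (x : ℕ → crossedProduct Γ μ) n ∈ cartan Γ μ) :
    (ultraAction μ ω g ⟨mkU _ (traceVec Γ μ) ω x, mkU_mem_subUltrapower _ _ ω x hx⟩ :
      MPow Γ μ ω) = mkU _ (traceVec Γ μ) ω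
        (constSeq _ (canonUnitary μ g : crossedProduct Γ μ) * x *
          constSeq _ (star (canonUnitary μ g : crossedProduct Γ μ))) := rfl

section Two

variable {Γ ω}
  {Λ : Type} [Group Λ] [Countable Λ] [MeasurableSpace Λ] [DiscreteMeasurableSpace Λ]
  {Y : Type} [MeasurableSpace Y] (ν : Measure Y) [IsProbabilityMeasure ν]
  [MulAction Λ Y] [MeasurableConstSMul Λ Y] [SMulInvariantMeasure Λ Y ν]

/-- `θ : A^ω ≃ B^ω` implements an ω-orbit equivalence: it is the restriction of a trace preserving
isomorphism `Θ` of the Cartan inclusions `A^ω ⊂ M(ω)` and `B^ω ⊂ N(ω)`. -/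
def ImplementsOmegaOE (θ : APow Γ μ ω ≃⋆ₐ[ℂ] APow Λ ν ω) : Prop :=
  ∃ Θ : MOmega Γ μ ω ≃⋆ₐ[ℂ] MOmega Λ ν ω,
    (∀ x, utrace _ (traceVec Λ ν) ω (Θ x : MPow Λ ν ω) = utrace _ (traceVec Γ μ) ω (x : MPow Γ μ ω)) ∧
    ∀ a : APow Γ μ ω,
      (Θ ⟨a, subUltrapower_le_cartanUltrapower _ _ ω _ a.2⟩ : MPow Λ ν ω) = θ a

/-- `θ : A^ω ≃ B^ω` is of ultraproduct form `θ = (θ_n)_n`, for trace preserving isomorphisms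
`θ_n : A ≃ B`. -/
def IsUltraproductForm (θ : APow Γ μ ω ≃⋆ₐ[ℂ] APow Λ ν ω) : Prop :=
  ∃ θn : ℕ → (cartan Γ μ ≃⋆ₐ[ℂ] cartan Λ ν),
    (∀ n a, crossedTrace Λ ν (θn n a) = crossedTrace Γ μ a) ∧
    ∀ (x : boundedSeq (crossedProduct Γ μ)) (y : boundedSeq (crossedProduct Λ ν))
      (hx : ∀ n, (x : ℕ → crossedProduct Γ μ) n ∈ cartan Γ μ),
      (∀ n, (y : ℕ → crossedProduct Λ ν) n = θn n ⟨(x : ℕ → crossedProduct Γ μ) n, hx n⟩) →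
      (θ ⟨mkU _ (traceVec Γ μ) ω x, mkU_mem_subUltrapower _ _ ω x hx⟩ : MPow Λ ν ω) =
        mkU _ (traceVec Λ ν) ω y

/-- `θ : A^ω ≃ B^ω` is an ω-conjugacy: it is trace preserving and intertwines the ultrapower
actions, up to some isomorphism `δ` of the groups. -/
def IsOmegaConjugacy (θ : APow Γ μ ω ≃⋆ₐ[ℂ] APow Λ ν ω) : Prop :=
  (∀ a : APow Γ μ ω, utrace _ (traceVec Λ ν) ω (θ a : MPow Λ ν ω) =
    utrace _ (traceVec Γ μ) ω (a : MPow Γ μ ω)) ∧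
  ∃ δ : Γ ≃* Λ, ∀ (g : Γ) (a : APow Γ μ ω),
    θ (ultraAction μ ω g a) = ultraAction ν ω (δ g) (θ a)

end Two

/-- The action `Γ ↷ (X, μ)` is ω-OE superrigid: every ω-orbit equivalence `θ` with a free pmp
action of a countable group comes from an ω-conjugacy, that is, `Ad(u) ∘ θ` is an ω-conjugacy for
some `u ∈ N_{N(ω)}(B^ω)`. -/
def OmegaOESuperrigid : Prop :=
  ∀ (Λ : Type) [Group Λ] [Countable Λ] [MeasurableSpace Λ] [DiscreteMeasurableSpace Λ]
    (Y : Type) [MeasurableSpace Y] [StandardBorelSpace Y] [MulAction Λ Y] [MeasurableConstSMul Λ Y]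
    (ν : Measure Y) [IsProbabilityMeasure ν] [SMulInvariantMeasure Λ Y ν],
    IsFree Λ ν → ∀ θ : APow Γ μ ω ≃⋆ₐ[ℂ] APow Λ ν ω, ImplementsOmegaOE μ ν θ →
      ∃ (u : unitary (MPow Λ ν ω)) (hu : u ∈ normalizerOmega Λ ν ω),
        IsOmegaConjugacy μ ν (θ.trans (Ad u hu.1))

/-- The action `Γ ↷ (X, μ)` is app-OE superrigid (tested along `ω`): every approximate orbit
equivalence with a free pmp action of a countable group, i.e. every ω-orbit equivalence `θ` of
ultraproduct form, comes from an approximate conjugacy, that is, for some `u ∈ N_{N(ω)}(B^ω)`,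
`Ad(u) ∘ θ` is an ω-conjugacy and is again of ultraproduct form. -/
def AppOESuperrigid : Prop :=
  ∀ (Λ : Type) [Group Λ] [Countable Λ] [MeasurableSpace Λ] [DiscreteMeasurableSpace Λ]
    (Y : Type) [MeasurableSpace Y] [StandardBorelSpace Y] [MulAction Λ Y] [MeasurableConstSMul Λ Y]
    (ν : Measure Y) [IsProbabilityMeasure ν] [SMulInvariantMeasure Λ Y ν],
    IsFree Λ ν → ∀ θ : APow Γ μ ω ≃⋆ₐ[ℂ] APow Λ ν ω, ImplementsOmegaOE μ ν θ →
      IsUltraproductForm μ ν θ →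
      ∃ (u : unitary (MPow Λ ν ω)) (hu : u ∈ normalizerOmega Λ ν ω),
        IsOmegaConjugacy μ ν (θ.trans (Ad u hu.1)) ∧
        IsUltraproductForm μ ν (θ.trans (Ad u hu.1))

end Main

end

end UltraOE

open UltraOE

/-!
# OE-superrigidity passes to ultrapowers of the Cartan inclusion

Let `Θ : M(ω) ≃ N(ω)` extend `θ : A^ω ≃ B^ω`. The unitaries `w_g = Θ(u_g)` lie in `N(ω)`, normalize
`B^ω` and implement the automorphisms `α_g = θ σ^ω_g θ⁻¹` (`conjAction`,
`ImplementsOmegaOE.exists_normalizer`). Write `β_h = ρ^ω_h`. The proof turns the two actions `α` of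
`Γ` and `β` of `Λ` on the nonseparable algebra `B^ω` into two actions on one probability space,
applies the hypothesis on `Γ` there, and lifts the result back to `N(ω)`.

*Same orbits.* Elements of `N(ω)` are limits in `‖ ‖₂` of sums `∑ b_h u_h` with `b_h ∈ B^ω`
(`MOmega_le_twoClosure`). Reading off the Fourier coefficients of a normalizing unitary of `N(ω)`
shows that it acts on `B^ω` piecewise by the automorphisms `β_h` (`exists_piecewise_ultraAction`).
Hence each `α_g` is piecewise given by the `β_h`, and, by symmetry, each `β_h` by the `α_g`.

*Point realization.* Countably many projections of `B^ω` suffice to record that both actions are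
free and that they have the same orbits, and the family can be chosen invariant under both
(`IsCoding`, `ImplementsOmegaOE.exists_isCoding`). Lifting these projections to sequences of subsets
of `Y` gives maps `Y → {0,1}^I`; the limit of the image measures along `ω` is a measure on
`{0,1}^I` whose measure algebra embeds into the projections of `B^ω` (`IsModel`,
`exists_isModel`). On this space `Γ` and `Λ` act by permutations of the coordinates, preserving
the measure, essentially freely and with the same orbits. An asymptotically invariant sequence of
sets for `Γ` lifts, by a diagonal choice, to one in `X`, so that the action of `Γ` is strongly
ergodic (`IsModel.stronglyErgodic`).

*Rigidity.* By hypothesis this action of `Γ` is OE-superrigid. For the identity map as orbit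
equivalence this yields `δ : Γ ≃ Λ` and an element `ψ` of the full group of `Λ` which conjugates
the two actions (`OESuperrigid.exists_conjugacy`, `IsCoding.exists_conjugacy`).

*Return to `N(ω)`.* The pieces `{ψ = h⁻¹}` are projections of `B^ω`; a greedy construction
(`exists_isFullGroupPair`) lifts them to honest elements of the full group of `Λ ↷ Y`, that is, to
unitaries `u_n ∈ N` normalizing `B`. The unitary `u = (u_n)_n` lies in `N(ω)` and `Ad(u)` implements
`ψ` (`exists_unitary_lift`, `IsCoding.exists_realizes`). So `Ad(u) α_g = β_{δ(g)} Ad(u)` holds on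
the chosen projections. It then holds on all of `B^ω`, because an automorphism of `B^ω` that is
implemented in `N(ω)` and fixes projections witnessing the freeness of `Λ` is trivial (`Ad_eq_self`,
`Ad_conj_eq_of_family`). Since `u` is given by a sequence of unitaries normalizing `B`, composition
with `Ad(u)` preserves isomorphisms of ultraproduct form (`IsUltraproductForm.trans_Ad`).
-/

open MeasureTheory Filter Topology
open scoped ENNReal

namespace UltraOE

noncomputable section

set_option linter.unusedSectionVars false

/-! ### Multiplication operators and the vectors of operators -/

section Operators

variable {Γ : Type} [Group Γ] [Countable Γ] [MeasurableSpace Γ] [DiscreteMeasurableSpace Γ]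
  {X : Type} [MeasurableSpace X] {μ : Measure X} [IsProbabilityMeasure μ]

theorem enorm_sq_eq_lintegral {α : Type} [MeasurableSpace α] {κ : Measure α} (ξ : Lp ℂ 2 κ) :
    ‖ξ‖ₑ ^ 2 = ∫⁻ p, ‖ξ p‖ₑ ^ 2 ∂κ := by
  rw [Lp.enorm_def, eLpNorm_eq_lintegral_rpow_enorm_toReal (by norm_num) (by norm_num)]
  simp only [ENNReal.toReal_ofNat, one_div]
  rw [← ENNReal.rpow_natCast, ← ENNReal.rpow_mul]
  norm_num

theorem lintegral_count_prod {F : Γ × X → ℝ≥0∞} (hF : AEMeasurable F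
    ((Measure.count : Measure Γ).prod μ)) :
    ∫⁻ p, F p ∂((Measure.count : Measure Γ).prod μ) = ∑' h, ∫⁻ y, F (h, y) ∂μ := by
  rw [lintegral_prod _ hF, lintegral_count]

theorem ae_slice {P : Γ × X → Prop} (hP : ∀ᵐ p ∂((Measure.count : Measure Γ).prod μ), P p)
    (h : Γ) : ∀ᵐ y ∂μ, P (h, y) := by
  have := Measure.ae_ae_of_ae_prod hP
  rw [ae_iff, Measure.count_eq_zero_iff] at this
  by_contra hc
  exact (Set.eq_empty_iff_forall_notMem.1 this h) hc

/-- The square norm of a slice `ξ(h, ·)` is at most that of `ξ`. -/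
theorem lintegral_slice_le (ξ : GMSSpace Γ μ) (h : Γ) :
    ∫⁻ y, ‖ξ (h, y)‖ₑ ^ 2 ∂μ ≤ ‖ξ‖ₑ ^ 2 := by
  rw [enorm_sq_eq_lintegral, lintegral_count_prod]
  · exact ENNReal.le_tsum (f := fun h => ∫⁻ y, ‖ξ (h, y)‖ₑ ^ 2 ∂μ) h
  · exact (Lp.stronglyMeasurable ξ).measurable.enorm.pow_const 2 |>.aemeasurable

theorem traceVec_apply : (traceVec Γ μ : Γ × X → ℂ) =ᵐ[(Measure.count : Measure Γ).prod μ]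
    (({1} : Set Γ) ×ˢ (Set.univ : Set X)).indicator fun _ => (1 : ℂ) :=
  indicatorConstLp_coeFn

/-- A complex function is bounded and measurable. -/
def BddMeas (f : X → ℂ) : Prop := Measurable f ∧ ∃ C : ℝ, ∀ x, ‖f x‖ ≤ C

theorem exists_isMulBy_norm_le {F : Γ × X → ℂ} (hF : Measurable F) {C : ℝ} (hC0 : 0 ≤ C)
    (hC : ∀ p, ‖F p‖ ≤ C) :
    ∃ T : GMSSpace Γ μ →L[ℂ] GMSSpace Γ μ, IsMulBy T F ∧ ‖T‖ ≤ C := by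
  obtain ⟨T, hT⟩ := exists_isMulBy (μ := μ) hF hC
  refine ⟨T, hT, T.opNorm_le_bound hC0 fun ξ => ?_⟩
  refine Lp.norm_le_mul_norm_of_ae_le_mul ?_
  filter_upwards [hT ξ] with p hp
  rw [hp, norm_mul]
  exact mul_le_mul_of_nonneg_right (hC p) (norm_nonneg _)

variable [MulAction Γ X] [MeasurableConstSMul Γ X] [SMulInvariantMeasure Γ X μ]

theorem exists_fnOp {f : X → ℂ} (hf : BddMeas f) :
    ∃ T : crossedProduct Γ μ, IsMulBy (T : GMSSpace Γ μ →L[ℂ] GMSSpace Γ μ) (fun p => f p.2) ∧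
      T ∈ cartan Γ μ ∧ ∀ C : ℝ, (∀ x, ‖f x‖ ≤ C) → ‖(T : GMSSpace Γ μ →L[ℂ] GMSSpace Γ μ)‖ ≤ C := by
  obtain ⟨hm, C, hC⟩ := hf
  obtain ⟨T, hT⟩ := exists_isMulBy (Γ := Γ) (μ := μ) (F := fun p => f p.2)
    (hm.comp measurable_snd) (fun p => hC p.2)
  have hTm : T ∈ mulAlg Γ μ := ⟨f, hm, ⟨C, hC⟩, hT⟩
  refine ⟨⟨T, mulAlg_le_crossedProduct Γ μ hTm⟩, hT, hTm, fun D hD => ?_⟩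
  have hne : Nonempty X := nonempty_of_isProbabilityMeasure μ
  obtain ⟨S, hS, hSn⟩ := exists_isMulBy_norm_le (Γ := Γ) (μ := μ) (F := fun p => f p.2) (C := D)
    (hm.comp measurable_snd) ((norm_nonneg _).trans (hD hne.some)) (fun p => hD p.2)
  exact isMulBy_ext hT hS ▸ hSn

variable (Γ μ) in
/-- The bounded measurable function `f` as an element of `L^∞(X) ⊂ L^∞(X) ⋊ Γ`. -/
def fnOp (f : X → ℂ) (hf : BddMeas f) : crossedProduct Γ μ := (exists_fnOp hf).choose

theorem fnOp_isMulBy {f : X → ℂ} (hf : BddMeas f) :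
    IsMulBy (fnOp Γ μ f hf : GMSSpace Γ μ →L[ℂ] GMSSpace Γ μ) (fun p => f p.2) :=
  (exists_fnOp hf).choose_spec.1

theorem fnOp_mem {f : X → ℂ} (hf : BddMeas f) : fnOp Γ μ f hf ∈ cartan Γ μ :=
  (exists_fnOp hf).choose_spec.2.1

theorem norm_fnOp_le {f : X → ℂ} (hf : BddMeas f) {C : ℝ} (hC : ∀ x, ‖f x‖ ≤ C) :
    ‖(fnOp Γ μ f hf : GMSSpace Γ μ →L[ℂ] GMSSpace Γ μ)‖ ≤ C :=
  (exists_fnOp hf).choose_spec.2.2 C hC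

theorem eq_fnOp {T : crossedProduct Γ μ} {f : X → ℂ} (hf : BddMeas f)
    (hT : IsMulBy (T : GMSSpace Γ μ →L[ℂ] GMSSpace Γ μ) (fun p => f p.2)) : T = fnOp Γ μ f hf :=
  Subtype.ext (isMulBy_ext hT (fnOp_isMulBy hf))

theorem exists_eq_fnOp {T : crossedProduct Γ μ} (hT : T ∈ cartan Γ μ) :
    ∃ f, ∃ hf : BddMeas f, T = fnOp Γ μ f hf := by
  obtain ⟨f, hf, hC, h⟩ := hT
  exact ⟨f, ⟨hf, hC⟩, eq_fnOp _ h⟩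

theorem BddMeas.mul {f g : X → ℂ} (hf : BddMeas f) (hg : BddMeas g) :
    BddMeas fun x => f x * g x := by
  obtain ⟨hf, C, hC⟩ := hf
  obtain ⟨hg, D, hD⟩ := hg
  refine ⟨hf.mul hg, C * D, fun x => ?_⟩
  rw [norm_mul]
  exact mul_le_mul (hC x) (hD x) (norm_nonneg _) ((norm_nonneg _).trans (hC x))

theorem BddMeas.sub {f g : X → ℂ} (hf : BddMeas f) (hg : BddMeas g) :
    BddMeas fun x => f x - g x := by
  obtain ⟨hf, C, hC⟩ := hf
  obtain ⟨hg, D, hD⟩ := hg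
  exact ⟨hf.sub hg, C + D, fun x => (norm_sub_le _ _).trans (add_le_add (hC x) (hD x))⟩

theorem BddMeas.smul_comp {f : X → ℂ} (hf : BddMeas f) (g : Γ) : BddMeas fun x => f (g • x) :=
  ⟨hf.1.comp (measurable_const_smul g), hf.2.imp fun _ hC _ => hC _⟩

theorem fnOp_mul {f g : X → ℂ} (hf : BddMeas f) (hg : BddMeas g) :
    fnOp Γ μ f hf * fnOp Γ μ g hg = fnOp Γ μ _ (hf.mul hg) := by
  refine eq_fnOp _ fun ξ => ?_
  filter_upwards [fnOp_isMulBy (μ := μ) hf ((fnOp Γ μ g hg : GMSSpace Γ μ →L[ℂ] GMSSpace Γ μ) ξ),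
    fnOp_isMulBy (μ := μ) hg ξ] with p h1 h2
  change ((fnOp Γ μ f hf : GMSSpace Γ μ →L[ℂ] GMSSpace Γ μ)
    ((fnOp Γ μ g hg : GMSSpace Γ μ →L[ℂ] GMSSpace Γ μ) ξ)) p = _
  rw [h1, h2, mul_assoc]

theorem fnOp_sub {f g : X → ℂ} (hf : BddMeas f) (hg : BddMeas g) :
    fnOp Γ μ f hf - fnOp Γ μ g hg = fnOp Γ μ _ (hf.sub hg) := by
  refine eq_fnOp _ fun ξ => ?_
  filter_upwards [fnOp_isMulBy (μ := μ) hf ξ,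
    fnOp_isMulBy (μ := μ) hg ξ, Lp.coeFn_sub ((fnOp Γ μ f hf : GMSSpace Γ μ →L[ℂ] GMSSpace Γ μ) ξ)
      ((fnOp Γ μ g hg : GMSSpace Γ μ →L[ℂ] GMSSpace Γ μ) ξ)] with p h1 h2 h3
  change (((fnOp Γ μ f hf : GMSSpace Γ μ →L[ℂ] GMSSpace Γ μ) ξ -
    (fnOp Γ μ g hg : GMSSpace Γ μ →L[ℂ] GMSSpace Γ μ) ξ) : GMSSpace Γ μ) p = _
  rw [h3, Pi.sub_apply, h1, h2, sub_mul]

theorem bddMeas_one : BddMeas fun _ : X => (1 : ℂ) :=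
  ⟨measurable_const, 1, fun _ => by simp⟩

theorem fnOp_one : fnOp Γ μ (fun _ => 1) bddMeas_one = 1 := by
  symm
  refine eq_fnOp _ fun ξ => ?_
  filter_upwards with p
  change ξ p = _
  simp

theorem fnOp_canon_conj (g : Γ) {f : X → ℂ} (hf : BddMeas f) :
    (canonUnitary μ g : crossedProduct Γ μ) * fnOp Γ μ f hf *
      star (canonUnitary μ g : crossedProduct Γ μ) = fnOp Γ μ _ (hf.smul_comp g⁻¹) := by
  refine eq_fnOp _ ?_
  have := canonOp_conj μ g (fnOp_isMulBy (μ := μ) hf)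
  rw [← star_canonOp] at this
  exact this

/-- The vector `x Ω ∈ L²(Γ × X)` of `x ∈ M`; its value at `(h, ·)` is the Fourier coefficient
`E(x u_h^*)`. -/
def vec (x : crossedProduct Γ μ) : GMSSpace Γ μ :=
  (x : GMSSpace Γ μ →L[ℂ] GMSSpace Γ μ) (traceVec Γ μ)

theorem vec_sub (x y : crossedProduct Γ μ) : vec (x - y) = vec x - vec y := rfl
theorem vec_add (x y : crossedProduct Γ μ) : vec (x + y) = vec x + vec y := rfl
theorem vec_mul (x y : crossedProduct Γ μ) :
    vec (x * y) = (x : GMSSpace Γ μ →L[ℂ] GMSSpace Γ μ) (vec y) := rfl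

theorem vec_fnOp_mul {f : X → ℂ} (hf : BddMeas f) (x : crossedProduct Γ μ) :
    vec (fnOp Γ μ f hf * x) =ᵐ[(Measure.count : Measure Γ).prod μ] fun p => f p.2 * vec x p :=
  fnOp_isMulBy hf _

theorem measurable_inv_smul : Measurable fun p : Γ × X => p.1⁻¹ • p.2 :=
  measurable_from_prod_countable_right fun h => measurable_const_smul h⁻¹

/-- Right multiplication by `f` multiplies the `h`-th Fourier coefficient by `f(h⁻¹ ·)`: multiplication
by `f(h⁻¹ x)` on `L²(Γ × X)` agrees with `f` on `Ω` and commutes with `M`. -/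
theorem vec_mul_fnOp {f : X → ℂ} (hf : BddMeas f) (x : crossedProduct Γ μ) :
    vec (x * fnOp Γ μ f hf) =ᵐ[(Measure.count : Measure Γ).prod μ]
      fun p => f (p.1⁻¹ • p.2) * vec x p := by
  obtain ⟨hm, C, hC⟩ := hf
  obtain ⟨T, hT⟩ := exists_isMulBy (Γ := Γ) (μ := μ) (F := fun p => f (p.1⁻¹ • p.2))
    (hm.comp measurable_inv_smul) (fun p => hC _)
  have h1 : vec (fnOp Γ μ f ⟨hm, C, hC⟩) = T (traceVec Γ μ) := by
    refine Lp.ext ?_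
    filter_upwards [fnOp_isMulBy (μ := μ) ⟨hm, C, hC⟩ (traceVec Γ μ), hT (traceVec Γ μ),
      traceVec_apply (Γ := Γ) (μ := μ)] with p h1 h2 h3
    refine h1.trans (Eq.trans ?_ h2.symm)
    rw [h3]
    by_cases hp : p.1 = 1
    · simp [hp]
    · simp [Set.indicator, hp]
  have h2 : vec (x * fnOp Γ μ f ⟨hm, C, hC⟩) = T (vec x) := by
    rw [vec_mul, h1]
    exact DFunLike.congr_fun (commute_rightMul μ x.2 hT) (traceVec Γ μ)
  rw [h2]
  exact hT _

theorem vec_canon (g : Γ) : vec (canonUnitary μ g : crossedProduct Γ μ) =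
    rightOp μ g⁻¹ (traceVec Γ μ) := by
  refine Lp.ext ?_
  filter_upwards [canonOp_apply μ g (traceVec Γ μ), rightOp_apply μ g⁻¹ (traceVec Γ μ),
    (measurePreserving_diag μ g⁻¹).quasiMeasurePreserving.ae (traceVec_apply (Γ := Γ) (μ := μ)),
    (measurePreserving_right μ g⁻¹).quasiMeasurePreserving.ae (traceVec_apply (Γ := Γ) (μ := μ))]
    with p h1 h2 h3 h4
  refine h1.trans (Eq.trans ?_ h2.symm)
  rw [h3, h4]
  by_cases hp : p.1 = g
  · simp [hp]
  · have h5 : ¬ p.1 * g⁻¹ = 1 := fun h => hp (mul_inv_eq_one.1 h)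
    have h6 : ¬ g⁻¹ * p.1 = 1 := fun h => hp (inv_mul_eq_one.1 h).symm
    simp [Set.indicator, h5, h6]

/-- `b u_g Ω` is the function `b` placed on the slice `{g} × X`. -/
theorem vec_fnOp_canon (g : Γ) {f : X → ℂ} (hf : BddMeas f) :
    vec (fnOp Γ μ f hf * (canonUnitary μ g : crossedProduct Γ μ))
      =ᵐ[(Measure.count : Measure Γ).prod μ]
      (({g} : Set Γ) ×ˢ (Set.univ : Set X)).indicator fun p => f p.2 := by
  filter_upwards [vec_fnOp_mul hf (canonUnitary μ g : crossedProduct Γ μ),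
    rightOp_apply μ g⁻¹ (traceVec Γ μ),
    (measurePreserving_right μ g⁻¹).quasiMeasurePreserving.ae (traceVec_apply (Γ := Γ) (μ := μ))]
    with p h1 h2 h3
  rw [h1, vec_canon, h2, h3]
  by_cases hp : p.1 = g
  · simp [hp]
  · have h5 : ¬ p.1 * g⁻¹ = 1 := fun h => hp (mul_inv_eq_one.1 h)
    simp [Set.indicator, h5, hp]

theorem vec_fnOp {f : X → ℂ} (hf : BddMeas f) :
    vec (fnOp Γ μ f hf) =ᵐ[(Measure.count : Measure Γ).prod μ]
      (({1} : Set Γ) ×ˢ (Set.univ : Set X)).indicator fun p => f p.2 := by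
  have h := vec_fnOp_canon (μ := μ) (1 : Γ) hf
  have h1 : (canonUnitary μ (1 : Γ) : crossedProduct Γ μ) = 1 :=
    Subtype.ext (canonOp_one (Γ := Γ) μ)
  rwa [h1, mul_one] at h

theorem enorm_vec_fnOp {f : X → ℂ} (hf : BddMeas f) :
    ‖vec (fnOp Γ μ f hf)‖ₑ ^ 2 = ∫⁻ x, ‖f x‖ₑ ^ 2 ∂μ := by
  rw [enorm_sq_eq_lintegral]
  have h : ∫⁻ p, ‖vec (fnOp Γ μ f hf) p‖ₑ ^ 2 ∂((Measure.count : Measure Γ).prod μ) =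
      ∫⁻ p, ‖(({1} : Set Γ) ×ˢ (Set.univ : Set X)).indicator (fun p : Γ × X => f p.2) p‖ₑ ^ 2
        ∂((Measure.count : Measure Γ).prod μ) := by
    refine lintegral_congr_ae ?_
    filter_upwards [vec_fnOp hf] with p hp
    rw [hp]
  rw [h, lintegral_count_prod, tsum_eq_single 1]
  · simp
  · intro k hk
    simp [Set.indicator, hk]
  · exact ((hf.1.comp measurable_snd).indicator (.prod .of_discrete .univ)).enorm.pow_const 2
      |>.aemeasurable

end Operators

/-! ### Fourier series in the group measure space algebra -/

section Fourier

variable {Γ : Type} [Group Γ] [Countable Γ] [MeasurableSpace Γ] [DiscreteMeasurableSpace Γ]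
  {X : Type} [MeasurableSpace X] {μ : Measure X} [IsProbabilityMeasure μ]
  [MulAction Γ X] [MeasurableConstSMul Γ X] [SMulInvariantMeasure Γ X μ]

theorem measurable_vec (x : crossedProduct Γ μ) : Measurable (vec x) :=
  (Lp.stronglyMeasurable (vec x)).measurable

theorem measurable_vec_slice (x : crossedProduct Γ μ) (h : Γ) :
    Measurable fun y => vec x (h, y) :=
  (measurable_vec x).comp measurable_prodMk_left

theorem bddMeas_indicator {E : Set X} (hE : MeasurableSet E) :
    BddMeas (E.indicator fun _ => (1 : ℂ)) := by
  refine ⟨measurable_const.indicator hE, 1, fun x => ?_⟩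
  by_cases hx : x ∈ E <;> simp [hx]

/-- The Fourier coefficients of `x` are bounded by `‖x‖`. -/
theorem ae_enorm_vec_slice_le (x : crossedProduct Γ μ) (h : Γ) :
    ∀ᵐ y ∂μ, ‖vec x (h, y)‖ ≤ ‖(x : GMSSpace Γ μ →L[ℂ] GMSSpace Γ μ)‖ := by
  have key : (fun y => ‖vec x (h, y)‖ₑ ^ 2) ≤ᵐ[μ]
      fun _ => ‖(x : GMSSpace Γ μ →L[ℂ] GMSSpace Γ μ)‖ₑ ^ 2 := by
    refine ae_le_of_forall_setLIntegral_le_of_sigmaFinite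
      ((measurable_vec_slice x h).enorm.pow_const 2) fun s hs _ => ?_
    -- The `h`-th slice of `x 1_{h⁻¹ s} Ω` is `1_s` times the `h`-th coefficient of `x`,
    -- and `‖1_{h⁻¹ s} Ω‖² = μ(s)`.
    have hs' : MeasurableSet ((fun y => h • y) ⁻¹' s) := measurable_const_smul h hs
    have h1 := lintegral_slice_le (vec (x * fnOp Γ μ _ (bddMeas_indicator hs'))) h
    have h2 : ∫⁻ y, ‖vec (x * fnOp Γ μ _ (bddMeas_indicator hs')) (h, y)‖ₑ ^ 2 ∂μ =
        ∫⁻ y in s, ‖vec x (h, y)‖ₑ ^ 2 ∂μ := by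
      rw [← lintegral_indicator hs]
      refine lintegral_congr_ae ?_
      filter_upwards [ae_slice (vec_mul_fnOp (bddMeas_indicator hs') x) h] with y hy
      rw [hy]
      by_cases hys : y ∈ s <;> simp [Set.indicator, hys]
    rw [h2] at h1
    refine h1.trans ?_
    rw [setLIntegral_const, vec_mul]
    have h3 := (x : GMSSpace Γ μ →L[ℂ] GMSSpace Γ μ).le_opENorm
      (vec (fnOp Γ μ _ (bddMeas_indicator hs')))
    have h4 : ‖vec (fnOp Γ μ _ (bddMeas_indicator hs'))‖ₑ ^ 2 = μ s := by
      rw [enorm_vec_fnOp, ← measure_preimage_smul h s (μ := μ), ← lintegral_indicator_one hs']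
      refine lintegral_congr fun y => ?_
      by_cases hy : y ∈ (fun y => h • y) ⁻¹' s <;> simp [Set.indicator, hy]
    calc _ ≤ (‖(x : GMSSpace Γ μ →L[ℂ] GMSSpace Γ μ)‖ₑ *
        ‖vec (fnOp Γ μ _ (bddMeas_indicator hs'))‖ₑ) ^ 2 := by gcongr
      _ = _ := by rw [mul_pow, h4]
  filter_upwards [key] with y hy
  have h5 : ‖vec x (h, y)‖ₑ ≤ ‖(x : GMSSpace Γ μ →L[ℂ] GMSSpace Γ μ)‖ₑ :=
    (ENNReal.pow_le_pow_left_iff two_ne_zero).1 hy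
  simpa [enorm_le_iff_norm_le] using h5

/-- The Fourier coefficients of `x` have bounded representatives. -/
theorem exists_coeff (x : crossedProduct Γ μ) (h : Γ) :
    ∃ f : X → ℂ, BddMeas f ∧ ∀ᵐ y ∂μ, f y = vec x (h, y) := by
  set C := ‖(x : GMSSpace Γ μ →L[ℂ] GMSSpace Γ μ)‖
  have hm := measurable_vec_slice x h
  refine ⟨{y | ‖vec x (h, y)‖ ≤ C}.indicator fun y => vec x (h, y),
    ⟨hm.indicator (measurableSet_le hm.norm measurable_const), C, fun y => ?_⟩, ?_⟩
  · by_cases hy : ‖vec x (h, y)‖ ≤ C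
    · simp [Set.indicator, hy]
    · simp only [Set.indicator, Set.mem_ofPred_eq, hy, if_false, norm_zero]
      exact norm_nonneg _
  · filter_upwards [ae_enorm_vec_slice_le x h] with y hy
    exact Set.indicator_of_mem (s := {y | ‖vec x (h, y)‖ ≤ C}) hy _

theorem ae_of_ae_slice {P : Γ × X → Prop} (hP : ∀ h, ∀ᵐ y ∂μ, P (h, y)) :
    ∀ᵐ p ∂((Measure.count : Measure Γ).prod μ), P p := by
  have h : ∀ᵐ p ∂((Measure.count : Measure Γ).prod μ), ∀ h, P (h, p.2) :=
    ae_all_iff.2 fun h => Measure.quasiMeasurePreserving_snd.ae (hP h)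
  filter_upwards [h] with p hp using hp p.1

theorem vec_finset_sum {b : Γ → X → ℂ} (hb : ∀ h, BddMeas (b h)) (F : Finset Γ) :
    vec (∑ h ∈ F, fnOp Γ μ (b h) (hb h) * (canonUnitary μ h : crossedProduct Γ μ))
      =ᵐ[(Measure.count : Measure Γ).prod μ]
      ({p | p.1 ∈ F} : Set (Γ × X)).indicator fun p => b p.1 p.2 := by
  classical
  induction F using Finset.induction_on with
  | empty =>
    have : vec (0 : crossedProduct Γ μ) = 0 := rfl
    filter_upwards [Lp.coeFn_zero ℂ 2 ((Measure.count : Measure Γ).prod μ)] with p hp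
    rw [Finset.sum_empty, this]
    simpa using hp
  | insert a F ha ih =>
    rw [Finset.sum_insert ha, vec_add]
    filter_upwards [ih, vec_fnOp_canon (μ := μ) a (hb a), Lp.coeFn_add
      (vec (fnOp Γ μ (b a) (hb a) * (canonUnitary μ a : crossedProduct Γ μ)))
      (vec (∑ h ∈ F, fnOp Γ μ (b h) (hb h) * (canonUnitary μ h : crossedProduct Γ μ)))]
      with p h1 h2 h3
    rw [h3, Pi.add_apply, h1, h2]
    obtain ⟨k, y⟩ := p
    by_cases hk : k = a
    · subst hk; simp [Set.indicator, ha]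
    · simp [Set.indicator, hk]

theorem summable_slices (x : crossedProduct Γ μ) :
    ∑' h, ∫⁻ y, ‖vec x (h, y)‖ₑ ^ 2 ∂μ = ‖vec x‖ₑ ^ 2 := by
  rw [enorm_sq_eq_lintegral, lintegral_count_prod]
  exact ((measurable_vec x).enorm.pow_const 2).aemeasurable

/-- The Fourier series of `x` converges to `x` in the norm `‖ ‖₂`. -/
theorem exists_vec_sub_lt (x : crossedProduct Γ μ) {ε : ℝ} (hε : 0 < ε) :
    ∃ (b : Γ → X → ℂ) (hb : ∀ h, BddMeas (b h)) (F : Finset Γ),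
      ‖vec (x - ∑ h ∈ F, fnOp Γ μ (b h) (hb h) * (canonUnitary μ h : crossedProduct Γ μ))‖ < ε := by
  classical
  choose b hb hbx using exists_coeff x
  have hlim := ENNReal.tendsto_tsum_compl_atTop_zero
    (f := fun h => ∫⁻ y, ‖vec x (h, y)‖ₑ ^ 2 ∂μ) (by
      rw [summable_slices]; exact ENNReal.pow_ne_top enorm_ne_top)
  have hpos : (0 : ℝ≥0∞) < ENNReal.ofReal ε ^ 2 := by positivity
  obtain ⟨F, hF⟩ := (hlim.eventually (gt_mem_nhds hpos)).exists
  refine ⟨b, hb, F, ?_⟩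
  set y := ∑ h ∈ F, fnOp Γ μ (b h) (hb h) * (canonUnitary μ h : crossedProduct Γ μ) with hy
  have hvec : vec (x - y) =ᵐ[(Measure.count : Measure Γ).prod μ]
      fun p => if p.1 ∈ F then 0 else vec x p := by
    rw [vec_sub]
    filter_upwards [vec_finset_sum (μ := μ) hb F, Lp.coeFn_sub (vec x) (vec y),
      ae_of_ae_slice (P := fun p => b p.1 p.2 = vec x p) hbx] with p h1 h2 h3
    rw [h2, Pi.sub_apply, h1, Set.indicator_apply]
    simp only [Set.mem_ofPred_eq]
    split_ifs with hp
    · rw [h3, sub_self]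
    · rw [sub_zero]
  have h1 : ‖vec (x - y)‖ₑ ^ 2 = ∑' b : {h // h ∉ F}, ∫⁻ y, ‖vec x (b, y)‖ₑ ^ 2 ∂μ := by
    rw [← summable_slices, ← tsum_subtype_eq_of_support_subset (s := {h | h ∉ F})]
    · refine tsum_congr fun h => lintegral_congr_ae ?_
      filter_upwards [ae_slice hvec h] with z hz
      rw [hz, if_neg h.2]
    · intro h hh hF'
      refine hh ?_
      simp only
      rw [lintegral_eq_zero_iff ((measurable_vec_slice (x - y) h).enorm.pow_const 2)]
      filter_upwards [ae_slice hvec h] with z hz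
      rw [hz, if_pos hF']
      simp
  rw [← h1] at hF
  have h2 := (ENNReal.pow_lt_pow_left_iff two_ne_zero).1 hF
  rwa [← ofReal_norm, ENNReal.ofReal_lt_ofReal_iff hε] at h2

end Fourier

/-! ### The trace and the norm `‖ ‖₂` of the ultrapower -/

section UltrapowerNorm

variable {H : Type} [NormedAddCommGroup H] [InnerProductSpace ℂ H] [CompleteSpace H]
  {M : StarSubalgebra ℂ (H →L[ℂ] H)} {Ω : H} [IsTraceVector M Ω] {ω : Ultrafilter ℕ}

theorem exists_mkU (x : Ultrapower M Ω ω) : ∃ y : boundedSeq M, mkU M Ω ω y = x :=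
  Ideal.Quotient.mk_surjective x

theorem mkU_sub (x y : boundedSeq M) : mkU M Ω ω (x - y) = mkU M Ω ω x - mkU M Ω ω y := rfl

theorem mkU_eq_zero_iff {x : boundedSeq M} : mkU M Ω ω x = 0 ↔
    Tendsto (fun n => ‖((x : ℕ → M) n : H →L[ℂ] H) Ω‖) ω (𝓝 0) :=
  Ideal.Quotient.eq_zero_iff_mem

theorem mkU_eq_iff {x y : boundedSeq M} : mkU M Ω ω x = mkU M Ω ω y ↔
    Tendsto (fun n => ‖(((x : ℕ → M) n - (y : ℕ → M) n : M) : H →L[ℂ] H) Ω‖) ω (𝓝 0) := by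
  rw [← sub_eq_zero, ← mkU_sub, mkU_eq_zero_iff]
  rfl

theorem inner_star_mul (x y : M) : inner ℂ Ω (((star x * y : M) : H →L[ℂ] H) Ω) =
    inner ℂ ((x : H →L[ℂ] H) Ω) ((y : H →L[ℂ] H) Ω) := by
  change inner ℂ Ω (star (x : H →L[ℂ] H) ((y : H →L[ℂ] H) Ω)) = _
  rw [ContinuousLinearMap.star_eq_adjoint, ContinuousLinearMap.adjoint_inner_right]

theorem tendsto_inner (x y : boundedSeq M) :
    Tendsto (fun n => inner ℂ (((x : ℕ → M) n : H →L[ℂ] H) Ω) (((y : ℕ → M) n : H →L[ℂ] H) Ω)) ω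
      (𝓝 (utrace M Ω ω (star (mkU M Ω ω x) * mkU M Ω ω y))) :=
  (tendsto_utrace M Ω ω (star x * y)).congr fun n =>
    inner_star_mul ((x : ℕ → M) n) ((y : ℕ → M) n)

theorem tendsto_twoNorm (x : boundedSeq M) :
    Tendsto (fun n => ‖((x : ℕ → M) n : H →L[ℂ] H) Ω‖) ω (𝓝 (twoNorm M Ω ω (mkU M Ω ω x))) := by
  have h := (Complex.continuous_re.tendsto _).comp (tendsto_inner (Ω := Ω) (ω := ω) x x)
  refine ((Real.continuous_sqrt.tendsto _).comp h).congr fun n => ?_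
  have h1 := norm_sq_eq_re_inner (𝕜 := ℂ) (((x : ℕ → M) n : H →L[ℂ] H) Ω)
  simp only [Function.comp]
  change Real.sqrt (RCLike.re (inner ℂ _ _)) = _
  rw [← h1, Real.sqrt_sq (norm_nonneg _)]

theorem twoNorm_nonneg (x : Ultrapower M Ω ω) : 0 ≤ twoNorm M Ω ω x := Real.sqrt_nonneg _

theorem twoNorm_eq_zero {x : Ultrapower M Ω ω} : twoNorm M Ω ω x = 0 ↔ x = 0 := by
  obtain ⟨x, rfl⟩ := exists_mkU x
  rw [mkU_eq_zero_iff]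
  have h := tendsto_twoNorm (Ω := Ω) (ω := ω) x
  exact ⟨fun h0 => h0 ▸ h, fun h0 => tendsto_nhds_unique h h0⟩

theorem twoNorm_zero : twoNorm M Ω ω 0 = 0 := twoNorm_eq_zero.2 rfl

theorem twoNorm_add_le (x y : Ultrapower M Ω ω) :
    twoNorm M Ω ω (x + y) ≤ twoNorm M Ω ω x + twoNorm M Ω ω y := by
  obtain ⟨x, rfl⟩ := exists_mkU x
  obtain ⟨y, rfl⟩ := exists_mkU y
  exact le_of_tendsto_of_tendsto' (tendsto_twoNorm (x + y))
    ((tendsto_twoNorm x).add (tendsto_twoNorm y)) fun n => norm_add_le _ _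

theorem twoNorm_star (x : Ultrapower M Ω ω) : twoNorm M Ω ω (star x) = twoNorm M Ω ω x := by
  obtain ⟨x, rfl⟩ := exists_mkU x
  exact tendsto_nhds_unique (tendsto_twoNorm (star x)) ((tendsto_twoNorm x).congr fun n =>
    (IsTraceVector.norm_star_apply (M := M) (Ω := Ω) _ (SetLike.coe_mem ((x : ℕ → M) n))).symm)

theorem exists_twoNorm_mul_le (x : Ultrapower M Ω ω) :
    ∃ C : ℝ, 0 ≤ C ∧ ∀ y, twoNorm M Ω ω (x * y) ≤ C * twoNorm M Ω ω y := by
  obtain ⟨x, rfl⟩ := exists_mkU x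
  obtain ⟨C, hC⟩ := x.2
  refine ⟨C, (norm_nonneg _).trans (hC 0), fun y => ?_⟩
  obtain ⟨y, rfl⟩ := exists_mkU y
  refine le_of_tendsto_of_tendsto' (tendsto_twoNorm (x * y))
    ((tendsto_twoNorm y).const_mul C) fun n => ?_
  exact (((x : ℕ → M) n : H →L[ℂ] H).le_opNorm _).trans
    (mul_le_mul_of_nonneg_right (hC n) (norm_nonneg _))

theorem exists_twoNorm_mul_le' (x : Ultrapower M Ω ω) :
    ∃ C : ℝ, 0 ≤ C ∧ ∀ y, twoNorm M Ω ω (y * x) ≤ C * twoNorm M Ω ω y := by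
  obtain ⟨C, hC, h⟩ := exists_twoNorm_mul_le (star x)
  refine ⟨C, hC, fun y => ?_⟩
  rw [← twoNorm_star, star_mul, ← twoNorm_star y]
  exact h _

theorem twoNorm_unitary_mul (u : unitary (Ultrapower M Ω ω)) (x : Ultrapower M Ω ω) :
    twoNorm M Ω ω (u * x) = twoNorm M Ω ω x := by
  unfold twoNorm
  rw [star_mul, mul_assoc, ← mul_assoc (star (u : Ultrapower M Ω ω)), Unitary.coe_star_mul_self,
    one_mul]

theorem twoNorm_mul_unitary (u : unitary (Ultrapower M Ω ω)) (x : Ultrapower M Ω ω) :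
    twoNorm M Ω ω (x * u) = twoNorm M Ω ω x := by
  rw [← twoNorm_star, star_mul, ← Unitary.coe_star, twoNorm_unitary_mul, twoNorm_star]

theorem norm_utrace_star_mul_le (x y : Ultrapower M Ω ω) :
    ‖utrace M Ω ω (star x * y)‖ ≤ twoNorm M Ω ω x * twoNorm M Ω ω y := by
  obtain ⟨x, rfl⟩ := exists_mkU x
  obtain ⟨y, rfl⟩ := exists_mkU y
  exact le_of_tendsto_of_tendsto' (tendsto_inner x y).norm
    ((tendsto_twoNorm x).mul (tendsto_twoNorm y)) fun n => norm_inner_le_norm _ _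

theorem utrace_add (x y : Ultrapower M Ω ω) :
    utrace M Ω ω (x + y) = utrace M Ω ω x + utrace M Ω ω y := by
  obtain ⟨x, rfl⟩ := exists_mkU x
  obtain ⟨y, rfl⟩ := exists_mkU y
  refine tendsto_nhds_unique (tendsto_utrace M Ω ω (x + y))
    (((tendsto_utrace M Ω ω x).add (tendsto_utrace M Ω ω y)).congr fun n => ?_)
  rw [← inner_add_right]
  rfl

theorem utrace_smul (c : ℂ) (x : Ultrapower M Ω ω) :
    utrace M Ω ω (c • x) = c * utrace M Ω ω x := by
  obtain ⟨x, rfl⟩ := exists_mkU x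
  refine tendsto_nhds_unique (tendsto_utrace M Ω ω (c • x))
    (((tendsto_utrace M Ω ω x).const_mul c).congr fun n => ?_)
  rw [← inner_smul_right]
  rfl

theorem utrace_zero : utrace M Ω ω 0 = 0 := by
  have := utrace_smul (M := M) (Ω := Ω) (ω := ω) 0 0
  rwa [zero_smul, zero_mul] at this

theorem utrace_sub (x y : Ultrapower M Ω ω) :
    utrace M Ω ω (x - y) = utrace M Ω ω x - utrace M Ω ω y := by
  rw [eq_sub_iff_add_eq, ← utrace_add, sub_add_cancel]

/-- The vector state of a trace vector is a trace. Only `‖x^* Ω‖ = ‖x Ω‖` is part of the definition;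
the trace property follows by polarization. -/
theorem inner_trace_comm (x y : M) :
    inner ℂ Ω (((x * y : M) : H →L[ℂ] H) Ω) = inner ℂ Ω (((y * x : M) : H →L[ℂ] H) Ω) := by
  have hn : ∀ a b : M, ‖(star (a : H →L[ℂ] H)) Ω + (b : H →L[ℂ] H) Ω‖ =
      ‖(star (b : H →L[ℂ] H)) Ω + (a : H →L[ℂ] H) Ω‖ := by
    intro a b
    have := IsTraceVector.norm_star_apply (M := M) (Ω := Ω) _ (SetLike.coe_mem (star a + b))
    simp only [StarMemClass.coe_star, AddMemClass.coe_add, star_add, star_star,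
      add_apply] at this
    rw [← this, add_comm]
  have h1 := inner_star_mul (Ω := Ω) (star x) y
  have h2 := inner_star_mul (Ω := Ω) (star y) x
  rw [star_star] at h1 h2
  rw [h1, h2, inner_eq_sum_norm_sq_div_four, inner_eq_sum_norm_sq_div_four]
  simp only [StarMemClass.coe_star]
  have e1 := hn x y
  have e2 : ‖(star (x : H →L[ℂ] H)) Ω - (y : H →L[ℂ] H) Ω‖ =
      ‖(star (y : H →L[ℂ] H)) Ω - (x : H →L[ℂ] H) Ω‖ := by
    have := hn x (-y)
    simp only [NegMemClass.coe_neg, star_neg, neg_apply] at this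
    rw [sub_eq_add_neg, this, neg_add_eq_sub, norm_sub_rev]
  have e3 : ∀ c : ℂ, ‖c‖ = 1 → star c = -c →
      ‖(star (x : H →L[ℂ] H)) Ω + c • (y : H →L[ℂ] H) Ω‖ =
      ‖(star (y : H →L[ℂ] H)) Ω + (-(c⁻¹)) • (x : H →L[ℂ] H) Ω‖ := by
    intro c hc hcs
    have hc0 : c ≠ 0 := by rintro rfl; simp at hc
    have := hn x (c • y)
    simp only [SetLike.val_smul, star_smul, smul_apply] at this
    rw [this, hcs]
    have h4 : (star (y : H →L[ℂ] H)) Ω + (-(c⁻¹)) • (x : H →L[ℂ] H) Ω =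
        (-(c⁻¹)) • ((-c) • (star (y : H →L[ℂ] H)) Ω + (x : H →L[ℂ] H) Ω) := by
      rw [smul_add, smul_smul]
      simp [hc0]
    rw [h4, norm_smul]
    simp [hc]
  have e4 := e3 Complex.I (by simp) (by simp)
  have e5 := e3 (-Complex.I) (by simp) (by simp)
  simp only [Complex.inv_I, neg_neg, inv_neg, neg_smul, ← sub_eq_add_neg] at e4 e5
  rw [e1, e2]
  simp only [RCLike.I_to_complex]
  rw [e4, e5]

theorem utrace_mul_comm (x y : Ultrapower M Ω ω) :
    utrace M Ω ω (x * y) = utrace M Ω ω (y * x) := by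
  obtain ⟨x, rfl⟩ := exists_mkU x
  obtain ⟨y, rfl⟩ := exists_mkU y
  exact tendsto_nhds_unique (tendsto_utrace M Ω ω (x * y))
    ((tendsto_utrace M Ω ω (y * x)).congr fun n => inner_trace_comm _ _)

theorem utrace_conj (u : unitary (Ultrapower M Ω ω)) (x : Ultrapower M Ω ω) :
    utrace M Ω ω (u * x * star (u : Ultrapower M Ω ω)) = utrace M Ω ω x := by
  rw [utrace_mul_comm, ← mul_assoc, Unitary.coe_star_mul_self, one_mul]

/-- The closure of a *-subalgebra of `M^ω` in the norm `‖ ‖₂`. -/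
def twoClosure (S : StarSubalgebra ℂ (Ultrapower M Ω ω)) :
    StarSubalgebra ℂ (Ultrapower M Ω ω) where
  carrier := {x | ∀ ε : ℝ, 0 < ε → ∃ y ∈ S, twoNorm M Ω ω (x - y) < ε}
  mul_mem' := by
    intro x y hx hy ε hε
    obtain ⟨C, hC, h1⟩ := exists_twoNorm_mul_le' y
    obtain ⟨x', hx', h2⟩ := hx (ε / 2 / (C + 1)) (by positivity)
    obtain ⟨D, hD, h3⟩ := exists_twoNorm_mul_le x'
    obtain ⟨y', hy', h4⟩ := hy (ε / 2 / (D + 1)) (by positivity)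
    refine ⟨x' * y', mul_mem hx' hy', ?_⟩
    have h5 : x * y - x' * y' = (x - x') * y + x' * (y - y') := by
      rw [sub_mul, mul_sub]; abel
    have h6 : ∀ {E t : ℝ}, 0 ≤ E → t < ε / 2 / (E + 1) → E * t < ε / 2 := by
      intro E t hE ht
      rw [lt_div_iff₀ (by positivity)] at ht
      rcases le_or_gt 0 t with h | h
      · nlinarith
      · nlinarith
    rw [h5]
    calc _ ≤ _ := twoNorm_add_le _ _
      _ ≤ C * twoNorm M Ω ω (x - x') + D * twoNorm M Ω ω (y - y') := add_le_add (h1 _) (h3 _)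
      _ < ε / 2 + ε / 2 := add_lt_add (h6 hC h2) (h6 hD h4)
      _ = ε := add_halves ε
  add_mem' := by
    intro x y hx hy ε hε
    obtain ⟨x', hx', h2⟩ := hx (ε / 2) (by positivity)
    obtain ⟨y', hy', h4⟩ := hy (ε / 2) (by positivity)
    refine ⟨x' + y', add_mem hx' hy', ?_⟩
    rw [add_sub_add_comm]
    calc _ ≤ _ := twoNorm_add_le _ _
      _ < ε / 2 + ε / 2 := add_lt_add h2 h4
      _ = ε := add_halves ε
  algebraMap_mem' c ε hε := ⟨_, S.algebraMap_mem c, by rwa [sub_self, twoNorm_zero]⟩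
  star_mem' := by
    intro x hx ε hε
    obtain ⟨y, hy, h⟩ := hx ε hε
    exact ⟨star y, star_mem hy, by rwa [← star_sub, twoNorm_star]⟩

theorem le_twoClosure (S : StarSubalgebra ℂ (Ultrapower M Ω ω)) : S ≤ twoClosure S :=
  fun x hx ε hε => ⟨x, hx, by rwa [sub_self, twoNorm_zero]⟩

theorem isVNSubalgebra_twoClosure (S : StarSubalgebra ℂ (Ultrapower M Ω ω)) :
    IsVNSubalgebra M Ω ω (twoClosure S) := by
  intro x hx ε hε
  obtain ⟨y, hy, h1⟩ := hx (ε / 2) (by positivity)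
  obtain ⟨z, hz, h2⟩ := hy (ε / 2) (by positivity)
  refine ⟨z, hz, ?_⟩
  rw [← sub_add_sub_cancel x y z]
  calc _ ≤ _ := twoNorm_add_le _ _
    _ < ε / 2 + ε / 2 := add_lt_add h1 h2
    _ = ε := add_halves ε

/-- `M(ω)`, defined as an infimum, is itself closed in `‖ ‖₂`. -/
theorem isVNSubalgebra_cartanUltrapower (A : StarSubalgebra ℂ M) :
    IsVNSubalgebra M Ω ω (cartanUltrapower M Ω ω A) := by
  intro x hx
  rw [cartanUltrapower, StarSubalgebra.mem_sInf]
  intro Q hQ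
  refine hQ.1 x fun ε hε => ?_
  obtain ⟨y, hy, h⟩ := hx ε hε
  rw [cartanUltrapower, StarSubalgebra.mem_sInf] at hy
  exact ⟨y, hy Q hQ, h⟩

theorem constU_mem_cartanUltrapower {A : StarSubalgebra ℂ M} {u : unitary M}
    (hu : u ∈ normalizer A) : constU M Ω ω (u : M) ∈ cartanUltrapower M Ω ω A := by
  rw [cartanUltrapower, StarSubalgebra.mem_sInf]
  exact fun Q hQ => hQ.2.2 u hu

end UltrapowerNorm

/-! ### Functions and projections in `A^ω` -/

section Functions

variable {Γ : Type} [Group Γ] [Countable Γ] [MeasurableSpace Γ] [DiscreteMeasurableSpace Γ]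
  {X : Type} [MeasurableSpace X] {μ : Measure X} [IsProbabilityMeasure μ]
  [MulAction Γ X] [MeasurableConstSMul Γ X] [SMulInvariantMeasure Γ X μ] {ω : Ultrafilter ℕ}

/-- A uniformly bounded sequence of measurable functions. -/
def BddSeq (f : ℕ → X → ℂ) : Prop := (∀ n, Measurable (f n)) ∧ ∃ C : ℝ, ∀ n x, ‖f n x‖ ≤ C

theorem BddSeq.bddMeas {f : ℕ → X → ℂ} (hf : BddSeq f) (n : ℕ) : BddMeas (f n) :=
  ⟨hf.1 n, hf.2.imp fun _ hC => hC n⟩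

theorem BddSeq.mul {f g : ℕ → X → ℂ} (hf : BddSeq f) (hg : BddSeq g) :
    BddSeq fun n x => f n x * g n x := by
  obtain ⟨hf, C, hC⟩ := hf
  obtain ⟨hg, D, hD⟩ := hg
  refine ⟨fun n => (hf n).mul (hg n), C * D, fun n x => ?_⟩
  rw [norm_mul]
  exact mul_le_mul (hC n x) (hD n x) (norm_nonneg _) ((norm_nonneg _).trans (hC n x))

theorem BddSeq.sub {f g : ℕ → X → ℂ} (hf : BddSeq f) (hg : BddSeq g) :
    BddSeq fun n x => f n x - g n x := by
  obtain ⟨hf, C, hC⟩ := hf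
  obtain ⟨hg, D, hD⟩ := hg
  exact ⟨fun n => (hf n).sub (hg n), C + D,
    fun n x => (norm_sub_le _ _).trans (add_le_add (hC n x) (hD n x))⟩

theorem BddSeq.smul_comp {f : ℕ → X → ℂ} (hf : BddSeq f) (g : Γ) :
    BddSeq fun n x => f n (g • x) :=
  ⟨fun n => (hf.1 n).comp (measurable_const_smul g), hf.2.imp fun _ hC n _ => hC n _⟩

theorem bddSeq_indicator {E : ℕ → Set X} (hE : ∀ n, MeasurableSet (E n)) :
    BddSeq fun n => (E n).indicator fun _ => (1 : ℂ) := by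
  refine ⟨fun n => measurable_const.indicator (hE n), 1, fun n x => ?_⟩
  by_cases hx : x ∈ E n <;> simp [hx]

variable (Γ μ) in
/-- A uniformly bounded sequence of functions as a bounded sequence in `M`. -/
def fnSeq (f : ℕ → X → ℂ) (hf : BddSeq f) : boundedSeq (crossedProduct Γ μ) :=
  ⟨fun n => fnOp Γ μ (f n) (hf.bddMeas n), by
    obtain ⟨C, hC⟩ := hf.2
    exact ⟨C, fun n => norm_fnOp_le _ (hC n)⟩⟩

variable (Γ μ ω) in
/-- The element of `A^ω` given by a uniformly bounded sequence of functions. -/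
def fnU (f : ℕ → X → ℂ) (hf : BddSeq f) : APow Γ μ ω :=
  ⟨mkU _ (traceVec Γ μ) ω (fnSeq Γ μ f hf), mkU_mem_subUltrapower _ _ ω _ fun n => fnOp_mem (hf.bddMeas n)⟩

theorem coe_fnU (f : ℕ → X → ℂ) (hf : BddSeq f) : (fnU Γ μ ω f hf : MPow Γ μ ω) =
    mkU (crossedProduct Γ μ) (traceVec Γ μ) ω (fnSeq Γ μ f hf) := rfl

theorem mkU_congr {x y : boundedSeq (crossedProduct Γ μ)}
    (h : ∀ n, (x : ℕ → crossedProduct Γ μ) n = (y : ℕ → crossedProduct Γ μ) n) :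
    mkU (crossedProduct Γ μ) (traceVec Γ μ) ω x = mkU (crossedProduct Γ μ) (traceVec Γ μ) ω y :=
  congrArg _ (Subtype.ext (funext h))

variable (Γ μ ω) in
/-- The projection of `A^ω` given by a sequence of measurable sets. -/
def setU (E : ℕ → Set X) (hE : ∀ n, MeasurableSet (E n)) : APow Γ μ ω :=
  fnU Γ μ ω _ (bddSeq_indicator hE)

theorem fnOp_congr {f g : X → ℂ} (hf : BddMeas f) (hg : BddMeas g) (h : f =ᵐ[μ] g) :
    fnOp Γ μ f hf = fnOp Γ μ g hg := by
  refine eq_fnOp _ fun ξ => ?_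
  filter_upwards [fnOp_isMulBy (μ := μ) hf ξ, ae_of_ae_slice (Γ := Γ) (P := fun p => f p.2 = g p.2)
    fun _ => h] with p h1 h2
  rw [h1, h2]

theorem ae_norm_le_of_fnOp {f : X → ℂ} (hf : BddMeas f) :
    ∀ᵐ x ∂μ, ‖f x‖ ≤ ‖(fnOp Γ μ f hf : GMSSpace Γ μ →L[ℂ] GMSSpace Γ μ)‖ := by
  filter_upwards [ae_enorm_vec_slice_le (fnOp Γ μ f hf) 1, ae_slice (vec_fnOp (μ := μ) hf) (1 : Γ)]
    with x h1 h2
  rw [h2] at h1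
  simpa using h1

/-- Every element of `A^ω` is given by a uniformly bounded sequence of functions: outside a null set
the functions representing `a_n` are bounded by the norms of the `a_n`. -/
theorem exists_fnU (a : APow Γ μ ω) : ∃ f, ∃ hf : BddSeq f, a = fnU Γ μ ω f hf := by
  obtain ⟨_, x, hx, rfl⟩ := a
  obtain ⟨C, hC⟩ := x.2
  choose f hf hfx using fun n => exists_eq_fnOp (hx n)
  have hm : ∀ n, MeasurableSet {y | ‖f n y‖ ≤ C} := fun n =>
    measurableSet_le (hf n).1.norm measurable_const
  have hb : BddSeq fun n => {y | ‖f n y‖ ≤ C}.indicator (f n) := by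
    refine ⟨fun n => (hf n).1.indicator (hm n), C, fun n y => ?_⟩
    by_cases hy : ‖f n y‖ ≤ C
    · simp [Set.indicator, hy]
    · simp only [Set.indicator, Set.mem_ofPred_eq, hy, if_false, norm_zero]
      exact (norm_nonneg _).trans (hC 0)
  refine ⟨_, hb, Subtype.ext (mkU_congr (ω := ω) fun n => ?_)⟩
  refine (hfx n).trans ?_
  refine fnOp_congr (hf n) (hb.bddMeas n) ?_
  filter_upwards [ae_norm_le_of_fnOp (Γ := Γ) (μ := μ) (hf n)] with y hy
  rw [← hfx n] at hy
  rw [Set.indicator_of_mem (s := {y | ‖f n y‖ ≤ C}) (hy.trans (hC n))]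

theorem tendsto_norm_zero_iff {E : Type} [SeminormedAddCommGroup E] {ξ : ℕ → E} {l : Filter ℕ} :
    Tendsto (fun n => ‖ξ n‖) l (𝓝 0) ↔ Tendsto (fun n => ‖ξ n‖ₑ ^ 2) l (𝓝 0) := by
  have h1 : Tendsto (fun n => ‖ξ n‖) l (𝓝 0) ↔ Tendsto (fun n => ‖ξ n‖ₑ) l (𝓝 0) := by
    constructor
    · intro h
      simpa using ENNReal.tendsto_ofReal h
    · intro h
      simpa [Function.comp_def] using (ENNReal.tendsto_toReal ENNReal.zero_ne_top).comp h
  rw [h1]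
  constructor
  · intro h
    simpa using ENNReal.Tendsto.pow (n := 2) h
  · intro h
    have := (ENNReal.continuous_rpow_const (y := (1 / 2 : ℝ))).tendsto 0 |>.comp h
    simp only [Function.comp_def] at this
    rw [ENNReal.zero_rpow_of_pos (by norm_num)] at this
    refine this.congr fun n => ?_
    rw [← ENNReal.rpow_natCast, ← ENNReal.rpow_mul]
    norm_num

theorem fnU_eq_zero_iff {f : ℕ → X → ℂ} {hf : BddSeq f} :
    fnU Γ μ ω f hf = 0 ↔ Tendsto (fun n => ∫⁻ x, ‖f n x‖ₑ ^ 2 ∂μ) ω (𝓝 0) := by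
  rw [← ZeroMemClass.coe_eq_zero, coe_fnU, mkU_eq_zero_iff, tendsto_norm_zero_iff]
  refine tendsto_congr fun n => ?_
  exact enorm_vec_fnOp (Γ := Γ) (μ := μ) (hf.bddMeas n)

theorem fnU_congr {f g : ℕ → X → ℂ} {hf : BddSeq f} (hg : BddSeq g) (h : f = g) :
    fnU Γ μ ω f hf = fnU Γ μ ω g hg := by subst h; rfl

theorem fnU_mul {f g : ℕ → X → ℂ} (hf : BddSeq f) (hg : BddSeq g) :
    fnU Γ μ ω f hf * fnU Γ μ ω g hg = fnU Γ μ ω _ (hf.mul hg) := by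
  refine Subtype.ext ?_
  change mkU (crossedProduct Γ μ) (traceVec Γ μ) ω (fnSeq Γ μ f hf * fnSeq Γ μ g hg) = _
  exact mkU_congr fun n => fnOp_mul (hf.bddMeas n) (hg.bddMeas n)

theorem fnU_sub {f g : ℕ → X → ℂ} (hf : BddSeq f) (hg : BddSeq g) :
    fnU Γ μ ω f hf - fnU Γ μ ω g hg = fnU Γ μ ω _ (hf.sub hg) := by
  refine Subtype.ext ?_
  change mkU (crossedProduct Γ μ) (traceVec Γ μ) ω (fnSeq Γ μ f hf - fnSeq Γ μ g hg) = _
  exact mkU_congr fun n => fnOp_sub (hf.bddMeas n) (hg.bddMeas n)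

theorem fnU_eq_iff {f g : ℕ → X → ℂ} {hf : BddSeq f} {hg : BddSeq g} :
    fnU Γ μ ω f hf = fnU Γ μ ω g hg ↔
      Tendsto (fun n => ∫⁻ x, ‖f n x - g n x‖ₑ ^ 2 ∂μ) ω (𝓝 0) := by
  rw [← sub_eq_zero, fnU_sub, fnU_eq_zero_iff]

theorem bddSeq_one : BddSeq fun (_ : ℕ) (_ : X) => (1 : ℂ) :=
  ⟨fun _ => measurable_const, 1, fun _ _ => by simp⟩

theorem fnU_one : fnU Γ μ ω (fun _ _ => 1) bddSeq_one = 1 := by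
  refine Subtype.ext ?_
  change _ = mkU (crossedProduct Γ μ) (traceVec Γ μ) ω 1
  exact mkU_congr fun n => fnOp_one

theorem ultraAction_fnU (g : Γ) {f : ℕ → X → ℂ} (hf : BddSeq f) :
    ultraAction μ ω g (fnU Γ μ ω f hf) = fnU Γ μ ω _ (hf.smul_comp g⁻¹) := by
  refine Subtype.ext ?_
  have h := ultraAction_mkU Γ μ ω g (fnSeq Γ μ f hf) fun n => fnOp_mem (hf.bddMeas n)
  refine Eq.trans h (mkU_congr fun n => ?_)
  change (canonUnitary μ g : crossedProduct Γ μ) * fnOp Γ μ (f n) (hf.bddMeas n) *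
    star (canonUnitary μ g : crossedProduct Γ μ) = _
  exact fnOp_canon_conj g (hf.bddMeas n)

theorem APow_mul_comm (a b : APow Γ μ ω) : a * b = b * a := by
  obtain ⟨f, hf, rfl⟩ := exists_fnU a
  obtain ⟨g, hg, rfl⟩ := exists_fnU b
  rw [fnU_mul, fnU_mul]
  exact fnU_congr _ (funext fun n => funext fun x => mul_comm _ _)

theorem tendsto_twoNorm_fnU {f : ℕ → X → ℂ} (hf : BddSeq f) :
    Tendsto (fun n => ∫⁻ x, ‖f n x‖ₑ ^ 2 ∂μ) ω
      (𝓝 (ENNReal.ofReal (twoNorm _ (traceVec Γ μ) ω (fnU Γ μ ω f hf : MPow Γ μ ω)) ^ 2)) := by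
  have h := ENNReal.tendsto_ofReal (tendsto_twoNorm (Ω := traceVec Γ μ) (ω := ω) (fnSeq Γ μ f hf))
  refine (ENNReal.Tendsto.pow (n := 2) h).congr fun n => ?_
  rw [ofReal_norm]
  exact enorm_vec_fnOp (hf.bddMeas n)

theorem setU_congr {E F : ℕ → Set X} {hE : ∀ n, MeasurableSet (E n)}
    (hF : ∀ n, MeasurableSet (F n)) (h : E = F) : setU Γ μ ω E hE = setU Γ μ ω F hF := by
  subst h; rfl

theorem lintegral_indicator_sub {E F : Set X} (hE : MeasurableSet E) (hF : MeasurableSet F) :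
    ∫⁻ x, ‖E.indicator (fun _ => (1 : ℂ)) x - F.indicator (fun _ => (1 : ℂ)) x‖ₑ ^ 2 ∂μ =
      μ (symmDiff E F) := by
  rw [← lintegral_indicator_one (hE.symmDiff hF)]
  refine lintegral_congr fun x => ?_
  by_cases h1 : x ∈ E <;> by_cases h2 : x ∈ F <;> simp [Set.indicator, h1, h2, Set.mem_symmDiff]

theorem setU_eq_iff {E F : ℕ → Set X} {hE : ∀ n, MeasurableSet (E n)}
    {hF : ∀ n, MeasurableSet (F n)} : setU Γ μ ω E hE = setU Γ μ ω F hF ↔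
      Tendsto (fun n => μ (symmDiff (E n) (F n))) ω (𝓝 0) := by
  refine fnU_eq_iff.trans (tendsto_congr fun n => ?_)
  exact lintegral_indicator_sub (hE n) (hF n)

theorem tendsto_measure_setU {E : ℕ → Set X} (hE : ∀ n, MeasurableSet (E n)) :
    Tendsto (fun n => μ (E n)) ω
      (𝓝 (ENNReal.ofReal (twoNorm _ (traceVec Γ μ) ω (setU Γ μ ω E hE : MPow Γ μ ω)) ^ 2)) := by
  refine (tendsto_twoNorm_fnU (bddSeq_indicator hE)).congr fun n => ?_
  rw [← lintegral_indicator_one (hE n)]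
  refine lintegral_congr fun x => ?_
  by_cases h1 : x ∈ E n <;> simp [Set.indicator, h1]

theorem setU_mul {E F : ℕ → Set X} (hE : ∀ n, MeasurableSet (E n))
    (hF : ∀ n, MeasurableSet (F n)) : setU Γ μ ω E hE * setU Γ μ ω F hF =
      setU Γ μ ω (fun n => E n ∩ F n) (fun n => (hE n).inter (hF n)) := by
  refine (fnU_mul _ _).trans (fnU_congr _ (funext fun n => funext fun x => ?_))
  by_cases h1 : x ∈ E n <;> by_cases h2 : x ∈ F n <;> simp [Set.indicator, h1, h2]

theorem setU_empty : setU Γ μ ω (fun _ => ∅) (fun _ => .empty) = 0 := by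
  refine fnU_eq_zero_iff.2 ?_
  simp

theorem setU_eq_zero_iff {E : ℕ → Set X} {hE : ∀ n, MeasurableSet (E n)} :
    setU Γ μ ω E hE = 0 ↔ Tendsto (fun n => μ (E n)) ω (𝓝 0) := by
  rw [← setU_empty, setU_eq_iff]
  refine tendsto_congr fun n => ?_
  rw [← Set.bot_eq_empty, symmDiff_bot]

theorem one_sub_setU {E : ℕ → Set X} (hE : ∀ n, MeasurableSet (E n)) :
    1 - setU Γ μ ω E hE = setU Γ μ ω (fun n => (E n)ᶜ) (fun n => (hE n).compl) := by
  rw [← fnU_one]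
  refine (fnU_sub _ _).trans (fnU_congr _ (funext fun n => funext fun x => ?_))
  by_cases h1 : x ∈ E n <;> simp [Set.indicator, h1]

theorem ultraAction_setU (g : Γ) {E : ℕ → Set X} (hE : ∀ n, MeasurableSet (E n)) :
    ultraAction μ ω g (setU Γ μ ω E hE) =
      setU Γ μ ω (fun n => (fun x => g⁻¹ • x) ⁻¹' E n)
        (fun n => measurable_const_smul g⁻¹ (hE n)) :=
  ultraAction_fnU g _

theorem setU_mul_self {E : ℕ → Set X} (hE : ∀ n, MeasurableSet (E n)) :
    setU Γ μ ω E hE * setU Γ μ ω E hE = setU Γ μ ω E hE := by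
  rw [setU_mul]
  exact setU_congr _ (funext fun n => Set.inter_self _)

theorem star_setU {E : ℕ → Set X} (hE : ∀ n, MeasurableSet (E n)) :
    star (setU Γ μ ω E hE) = setU Γ μ ω E hE := by
  refine Subtype.ext ?_
  change mkU (crossedProduct Γ μ) (traceVec Γ μ) ω
    (star (fnSeq Γ μ _ (bddSeq_indicator hE))) = _
  refine mkU_congr fun n => ?_
  refine eq_fnOp (Γ := Γ) (μ := μ) ((bddSeq_indicator hE).bddMeas n) ?_
  have hb := (bddSeq_indicator hE).bddMeas n
  obtain ⟨C, hC⟩ := hb.2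
  have h := isMulBy_star (fnOp_isMulBy (Γ := Γ) (μ := μ) hb) (hb.1.comp measurable_snd)
    (fun p => hC p.2)
  intro ξ
  refine (h ξ).trans (.of_forall fun p => ?_)
  by_cases h1 : p.2 ∈ E n <;> simp [Set.indicator, h1]

/-- Idempotents of `A^ω` lift to sequences of measurable sets. -/
theorem exists_setU_of_mul_self {a : APow Γ μ ω} (ha : a * a = a) :
    ∃ E, ∃ hE : ∀ n, MeasurableSet (E n), a = setU Γ μ ω E hE := by
  obtain ⟨f, hf, rfl⟩ := exists_fnU a
  -- Cut at distance `1/2` from `1`: then `|z - 1_{|z - 1| < 1/2}| ≤ 2 |z² - z|` for all `z ∈ ℂ`.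
  have hE : ∀ n, MeasurableSet {x | ‖f n x - 1‖ < 1 / 2} := fun n =>
    measurableSet_lt ((hf.1 n).sub measurable_const).norm measurable_const
  refine ⟨_, hE, ?_⟩
  rw [fnU_mul, fnU_eq_iff] at ha
  refine fnU_eq_iff.2 ?_
  have h4 := ENNReal.Tendsto.const_mul (a := 4) ha (Or.inr (by norm_num))
  rw [mul_zero] at h4
  refine tendsto_of_tendsto_of_tendsto_of_le_of_le tendsto_const_nhds h4 (fun _ => bot_le)
    fun n => ?_
  simp only
  rw [← lintegral_const_mul' _ _ (by norm_num)]
  refine lintegral_mono fun x => ?_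
  have h5 : ‖f n x - {x | ‖f n x - 1‖ < 1 / 2}.indicator (fun _ => (1 : ℂ)) x‖ ≤
      2 * ‖f n x * f n x - f n x‖ := by
    have h6 : f n x * f n x - f n x = f n x * (f n x - 1) := by ring
    rw [h6, norm_mul]
    by_cases hx : ‖f n x - 1‖ < 1 / 2
    · rw [Set.indicator_of_mem (s := {x | ‖f n x - 1‖ < 1 / 2}) hx]
      have h7 : 1 / 2 ≤ ‖f n x‖ := by
        have := norm_sub_norm_le (1 : ℂ) (1 - f n x)
        rw [sub_sub_cancel, norm_one, norm_sub_rev] at this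
        linarith
      nlinarith [norm_nonneg (f n x - 1)]
    · rw [Set.indicator_of_notMem (s := {x | ‖f n x - 1‖ < 1 / 2}) hx, sub_zero]
      nlinarith [norm_nonneg (f n x)]
  have h8 : ‖f n x - {x | ‖f n x - 1‖ < 1 / 2}.indicator (fun _ => (1 : ℂ)) x‖ₑ ≤
      2 * ‖f n x * f n x - f n x‖ₑ := by
    have := ENNReal.ofReal_le_ofReal h5
    rwa [ENNReal.ofReal_mul (by norm_num), ofReal_norm, ofReal_norm, ENNReal.ofReal_ofNat] at this
  calc _ ≤ (2 * ‖f n x * f n x - f n x‖ₑ) ^ 2 := by gcongr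
    _ = _ := by rw [mul_pow]; norm_num

/-- A family of elements of `A^ω` whose common annihilator is `0`. -/
def Full {ι : Type} (t : ι → APow Γ μ ω) : Prop := ∀ x, (∀ i, x * t i = 0) → x = 0

theorem lintegral_biUnion_finset_le {ι : Type} (J : Finset ι) (s : ι → Set X) (f : X → ℝ≥0∞) :
    ∫⁻ x in ⋃ i ∈ J, s i, f x ∂μ ≤ ∑ i ∈ J, ∫⁻ x in s i, f x ∂μ := by
  classical
  induction J using Finset.induction_on with
  | empty => simp
  | insert a J ha ih =>
    rw [Finset.set_biUnion_insert, Finset.sum_insert ha]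
    exact (lintegral_union_le _ _ _).trans (add_le_add le_rfl ih)

/-- A family of sequences of sets which covers `X` asymptotically, up to arbitrarily small
measure, by finitely many members is full. -/
theorem full_of_cover {ι : Type} {E : ι → ℕ → Set X} (hE : ∀ i n, MeasurableSet (E i n))
    (hc : ∀ ε : ℝ≥0∞, 0 < ε → ∃ J : Finset ι, ∀ᶠ n in (ω : Filter ℕ),
      μ (⋃ i ∈ J, E i n)ᶜ < ε) : Full fun i => setU Γ μ ω (E i) (hE i) := by
  intro x hx
  obtain ⟨f, hf, rfl⟩ := exists_fnU x
  obtain ⟨C, hC⟩ := hf.2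
  have hset : ∀ i, Tendsto (fun n => ∫⁻ x in E i n, ‖f n x‖ₑ ^ 2 ∂μ) ω (𝓝 0) := by
    intro i
    have h := hx i
    simp only [setU] at h
    rw [fnU_mul, fnU_eq_zero_iff] at h
    refine h.congr fun n => ?_
    rw [← lintegral_indicator (hE i n)]
    refine lintegral_congr fun x => ?_
    by_cases h1 : x ∈ E i n <;> simp [Set.indicator, h1]
  refine fnU_eq_zero_iff.2 (ENNReal.tendsto_nhds_zero.2 fun δ hδ => ?_)
  obtain ⟨ε, hε, hεδ⟩ : ∃ ε : ℝ≥0∞, 0 < ε ∧ ENNReal.ofReal C ^ 2 * ε ≤ δ / 2 := by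
    rcases eq_or_ne (ENNReal.ofReal C ^ 2) 0 with h0 | h0
    · exact ⟨1, one_pos, by simp [h0]⟩
    · refine ⟨δ / 2 / ENNReal.ofReal C ^ 2, ?_, ENNReal.mul_div_le⟩
      exact ENNReal.div_pos (ENNReal.div_pos hδ.ne' (by norm_num)).ne' (by finiteness)
  obtain ⟨J, hJ⟩ := hc ε hε
  have hsum : Tendsto (fun n => ∑ i ∈ J, ∫⁻ x in E i n, ‖f n x‖ₑ ^ 2 ∂μ) ω (𝓝 0) := by
    have := tendsto_finsetSum J fun i _ => hset i
    simpa using this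
  have hd2 : 0 < δ / 2 := ENNReal.div_pos hδ.ne' (by norm_num)
  filter_upwards [hJ, ENNReal.tendsto_nhds_zero.1 hsum (δ / 2) hd2] with n h1 h2
  have hmU : MeasurableSet (⋃ i ∈ J, E i n) := Finset.measurableSet_biUnion J fun i _ => hE i n
  rw [← lintegral_add_compl _ hmU]
  refine (add_le_add ((lintegral_biUnion_finset_le J (fun i => E i n) _).trans h2)
    (?_ : _ ≤ δ / 2)).trans (ENNReal.add_halves δ).le
  calc _ ≤ ∫⁻ x in (⋃ i ∈ J, E i n)ᶜ, ENNReal.ofReal C ^ 2 ∂μ := by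
        refine lintegral_mono fun x => ?_
        gcongr
        rw [← ofReal_norm]
        exact ENNReal.ofReal_le_ofReal (hC n x)
    _ = ENNReal.ofReal C ^ 2 * μ (⋃ i ∈ J, E i n)ᶜ := setLIntegral_const _ _
    _ ≤ ENNReal.ofReal C ^ 2 * ε := by gcongr
    _ ≤ δ / 2 := hεδ

end Functions

/-! ### Generation of `M(ω)` by monomials -/

section Generation

variable {Γ : Type} [Group Γ] [Countable Γ] [MeasurableSpace Γ] [DiscreteMeasurableSpace Γ]
  {X : Type} [MeasurableSpace X] {μ : Measure X} [IsProbabilityMeasure μ]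
  [MulAction Γ X] [MeasurableConstSMul Γ X] [SMulInvariantMeasure Γ X μ] {ω : Ultrafilter ℕ}

variable (μ ω) in
/-- The canonical unitary `u_g` as an element of `M^ω`. -/
def uU (g : Γ) : unitary (MPow Γ μ ω) :=
  constUnitary (crossedProduct Γ μ) (traceVec Γ μ) ω (canonUnitary μ g)

theorem canonUnitary_mul (g h : Γ) :
    canonUnitary μ (g * h) = canonUnitary μ g * canonUnitary μ h :=
  Subtype.ext (Subtype.ext (canonOp_mul μ g h))

theorem canonUnitary_one : canonUnitary μ (1 : Γ) = 1 :=
  Subtype.ext (Subtype.ext (canonOp_one Γ μ))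

theorem uU_mul (g h : Γ) : uU μ ω (g * h) = uU μ ω g * uU μ ω h := by
  unfold uU
  rw [canonUnitary_mul]
  rfl

theorem uU_one : uU μ ω (1 : Γ) = 1 := by
  unfold uU
  rw [canonUnitary_one]
  rfl

theorem uU_inv (g : Γ) : uU μ ω g⁻¹ = star (uU μ ω g) := by
  have h : uU μ ω g⁻¹ * uU μ ω g = 1 := by rw [← uU_mul, inv_mul_cancel, uU_one]
  exact eq_inv_of_mul_eq_one_left h

theorem coe_Ad {R : Type} [Ring R] [StarRing R] [Algebra ℂ R] [StarModule ℂ R]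
    {A : StarSubalgebra ℂ R} {u : unitary R} (hu : u ∈ normalizer A) (a : A) :
    (Ad u hu a : R) = u * a * star (u : R) := rfl

theorem coe_ultraAction (g : Γ) (a : APow Γ μ ω) : (ultraAction μ ω g a : MPow Γ μ ω) =
    uU μ ω g * a * star (uU μ ω g : MPow Γ μ ω) := rfl

theorem uU_mul_coe (g : Γ) (a : APow Γ μ ω) :
    (uU μ ω g : MPow Γ μ ω) * a = ultraAction μ ω g a * uU μ ω g := by
  rw [coe_ultraAction, mul_assoc, Unitary.coe_star_mul_self, mul_one]

theorem ultraAction_mul (g h : Γ) (a : APow Γ μ ω) :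
    ultraAction μ ω (g * h) a = ultraAction μ ω g (ultraAction μ ω h a) := by
  refine Subtype.ext ?_
  simp only [coe_ultraAction, uU_mul, Submonoid.coe_mul, star_mul, mul_assoc]

theorem ultraAction_one (a : APow Γ μ ω) : ultraAction μ ω (1 : Γ) a = a := by
  refine Subtype.ext ?_
  simp only [coe_ultraAction, uU_one, OneMemClass.coe_one, star_one, one_mul, mul_one]

theorem uU_mem_normalizer (g : Γ) : uU μ ω g ∈ normalizer (APow Γ μ ω) :=
  constUnitary_mem_normalizer _ _ ω (canonUnitary_mem_normalizer μ g)

theorem uU_mem_MOmega (g : Γ) : (uU μ ω g : MPow Γ μ ω) ∈ MOmega Γ μ ω :=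
  constU_mem_cartanUltrapower (canonUnitary_mem_normalizer μ g)

variable (Γ μ ω) in
/-- The linear span of the products `a u_g`, `a ∈ A^ω`, `g ∈ Γ`. -/
def monomialSpan : Submodule ℂ (MPow Γ μ ω) :=
  Submodule.span ℂ {x | ∃ (a : APow Γ μ ω) (g : Γ), x = a * uU μ ω g}

theorem mul_uU_mem_monomialSpan (a : APow Γ μ ω) (g : Γ) :
    (a : MPow Γ μ ω) * uU μ ω g ∈ monomialSpan Γ μ ω := Submodule.subset_span ⟨a, g, rfl⟩

theorem coe_mem_monomialSpan (a : APow Γ μ ω) : (a : MPow Γ μ ω) ∈ monomialSpan Γ μ ω := by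
  have := mul_uU_mem_monomialSpan a (1 : Γ)
  rwa [uU_one, OneMemClass.coe_one, mul_one] at this

variable (Γ μ ω) in
/-- The algebraic crossed product of `A^ω` by `Γ` inside `M^ω`. -/
def algCrossed : StarSubalgebra ℂ (MPow Γ μ ω) where
  carrier := monomialSpan Γ μ ω
  mul_mem' := by
    intro x y hx hy
    have h := Submodule.mul_mem_mul hx hy
    rw [monomialSpan, Submodule.span_mul_span] at h
    refine Submodule.span_le.2 ?_ h
    rintro _ ⟨_, ⟨a, g, rfl⟩, _, ⟨b, k, rfl⟩, rfl⟩
    have : (a : MPow Γ μ ω) * uU μ ω g * (b * uU μ ω k) =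
        ((a * ultraAction μ ω g b : APow Γ μ ω) : MPow Γ μ ω) * uU μ ω (g * k) := by
      rw [mul_assoc, ← mul_assoc (uU μ ω g : MPow Γ μ ω), uU_mul_coe, uU_mul]
      simp only [MulMemClass.coe_mul, mul_assoc]
    simp only [this]
    exact mul_uU_mem_monomialSpan _ _
  add_mem' := fun hx hy => Submodule.add_mem _ hx hy
  algebraMap_mem' c := by
    have := coe_mem_monomialSpan (algebraMap ℂ (APow Γ μ ω) c)
    exact this
  star_mem' := by
    intro x hx
    change x ∈ monomialSpan Γ μ ω at hx
    change star x ∈ monomialSpan Γ μ ω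
    rw [monomialSpan] at hx
    induction hx using Submodule.span_induction with
    | mem x hx =>
      obtain ⟨a, g, rfl⟩ := hx
      rw [star_mul, ← Unitary.coe_star, ← uU_inv]
      have := uU_mul_coe (μ := μ) (ω := ω) g⁻¹ (star a)
      rw [StarMemClass.coe_star] at this
      rw [this]
      exact mul_uU_mem_monomialSpan _ _
    | zero => rw [star_zero]; exact Submodule.zero_mem _
    | add x y _ _ hx hy => rw [star_add]; exact Submodule.add_mem _ hx hy
    | smul c x _ hx => rw [star_smul]; exact Submodule.smul_mem _ _ hx

/-- On the constant sequences `M ⊂ M^ω` the norm `‖ ‖₂` is that of `M`. -/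
theorem twoNorm_constU (x : crossedProduct Γ μ) :
    twoNorm _ (traceVec Γ μ) ω (constU _ _ ω x) = ‖vec x‖ :=
  tendsto_nhds_unique (tendsto_twoNorm (Ω := traceVec Γ μ) (ω := ω) (constSeq _ x))
    tendsto_const_nhds

theorem constU_sum {ι : Type} (F : Finset ι) (x : ι → crossedProduct Γ μ) :
    constU _ (traceVec Γ μ) ω (∑ i ∈ F, x i) = ∑ i ∈ F, constU _ (traceVec Γ μ) ω (x i) := by
  let φ : crossedProduct Γ μ →+ MPow Γ μ ω :=
    { toFun := constU _ (traceVec Γ μ) ω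
      map_zero' := rfl
      map_add' := fun _ _ => rfl }
  exact map_sum φ x F

theorem BddMeas.bddSeq {f : X → ℂ} (hf : BddMeas f) : BddSeq fun _ : ℕ => f :=
  ⟨fun _ => hf.1, hf.2.imp fun _ hC _ => hC⟩

theorem constU_mem_twoClosure (x : crossedProduct Γ μ) :
    constU _ (traceVec Γ μ) ω x ∈ twoClosure (algCrossed Γ μ ω) := by
  intro ε hε
  obtain ⟨b, hb, F, hF⟩ := exists_vec_sub_lt x hε
  refine ⟨constU _ (traceVec Γ μ) ω
    (∑ h ∈ F, fnOp Γ μ (b h) (hb h) * (canonUnitary μ h : crossedProduct Γ μ)), ?_, ?_⟩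
  · rw [constU_sum]
    refine sum_mem fun h _ => ?_
    exact mul_uU_mem_monomialSpan (fnU Γ μ ω _ (hb h).bddSeq) h
  · rw [← twoNorm_constU (ω := ω)] at hF
    exact hF

/-- `M(ω)` is contained in the closure of the span of the products `a u_g`: the normalizer of `A` lies
in `M`, and elements of `M` are approximated by their Fourier series. -/
theorem MOmega_le_twoClosure : MOmega Γ μ ω ≤ twoClosure (algCrossed Γ μ ω) := by
  refine sInf_le ⟨isVNSubalgebra_twoClosure _, ?_, fun u _ => constU_mem_twoClosure _⟩
  exact fun a ha => le_twoClosure _ (coe_mem_monomialSpan ⟨a, ha⟩)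

/-- An element of `M(ω)` orthogonal to all products `a u_g` is zero, being a limit in `‖ ‖₂` of
elements of their span. -/
theorem eq_zero_of_orthogonal {z : MPow Γ μ ω} (hz : z ∈ MOmega Γ μ ω)
    (h : ∀ (a : APow Γ μ ω) (g : Γ),
      utrace _ (traceVec Γ μ) ω (star ((a : MPow Γ μ ω) * uU μ ω g) * z) = 0) : z = 0 := by
  have hS : ∀ y ∈ monomialSpan Γ μ ω, utrace _ (traceVec Γ μ) ω (star y * z) = 0 := by
    intro y hy
    rw [monomialSpan] at hy
    induction hy using Submodule.span_induction with
    | mem x hx =>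
      obtain ⟨a, g, rfl⟩ := hx
      exact h a g
    | zero => rw [star_zero, zero_mul, utrace_zero]
    | add x y _ _ hx hy => rw [star_add, add_mul, utrace_add, hx, hy, add_zero]
    | smul c x _ hx => rw [star_smul, smul_mul_assoc, utrace_smul, hx, mul_zero]
  have h0 : utrace _ (traceVec Γ μ) ω (star z * z) = 0 := by
    by_contra hne
    set N := twoNorm _ (traceVec Γ μ) ω z with hN
    have hN0 : 0 ≤ N := twoNorm_nonneg z
    have hpos : 0 < ‖utrace _ (traceVec Γ μ) ω (star z * z)‖ := norm_pos_iff.2 hne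
    obtain ⟨y, hy, hyz⟩ := MOmega_le_twoClosure hz
      (‖utrace _ (traceVec Γ μ) ω (star z * z)‖ / (N + 1)) (by positivity)
    have h1 : utrace _ (traceVec Γ μ) ω (star z * z) =
        utrace _ (traceVec Γ μ) ω (star (z - y) * z) := by
      rw [star_sub, sub_mul, utrace_sub, hS y hy, sub_zero]
    have h2 := norm_utrace_star_mul_le (z - y) z
    rw [← h1, ← hN] at h2
    rw [lt_div_iff₀ (by positivity)] at hyz
    have h3 := twoNorm_nonneg (z - y)
    rcases h3.eq_or_lt with h4 | h4
    · rw [← h4, zero_mul] at h2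
      linarith
    · nlinarith
  rw [← twoNorm_eq_zero, twoNorm, h0, Complex.zero_re, Real.sqrt_zero]

end Generation

/-! ### Piecewise description of the normalizer of `A^ω` in `M(ω)` -/

section Normalizer

variable {Γ : Type} [Group Γ] [Countable Γ] [MeasurableSpace Γ] [DiscreteMeasurableSpace Γ]
  {X : Type} [MeasurableSpace X] {μ : Measure X} [IsProbabilityMeasure μ]
  [MulAction Γ X] [MeasurableConstSMul Γ X] [SMulInvariantMeasure Γ X μ] {ω : Ultrafilter ℕ}

theorem norm_inner_vec_le {b f : X → ℂ} (hb : BddMeas b) (hf : BddMeas f)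
    (x : crossedProduct Γ μ) (h : Γ) {B C : ℝ} (hB0 : 0 ≤ B) (hC0 : 0 ≤ C) (hB : ∀ y, ‖b y‖ ≤ B)
    (hC : ∀ y, ‖f y‖ * ‖vec x (h, y)‖ ≤ C) :
    ‖inner ℂ (vec (fnOp Γ μ b hb * (canonUnitary μ h : crossedProduct Γ μ)))
      (vec (fnOp Γ μ f hf * x))‖ ≤ B * C := by
  rw [L2.inner_def]
  have hle : ‖∫ p, inner ℂ (vec (fnOp Γ μ b hb * (canonUnitary μ h : crossedProduct Γ μ)) p)
      (vec (fnOp Γ μ f hf * x) p) ∂((Measure.count : Measure Γ).prod μ)‖ₑ ≤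
      ENNReal.ofReal (B * C) := by
    refine (enorm_integral_le_lintegral_enorm _).trans ?_
    calc _ ≤ ∫⁻ p, (({h} : Set Γ) ×ˢ (Set.univ : Set X)).indicator
          (fun _ => ENNReal.ofReal (B * C)) p ∂((Measure.count : Measure Γ).prod μ) := by
          refine lintegral_mono_ae ?_
          filter_upwards [vec_fnOp_canon (μ := μ) h hb, vec_fnOp_mul hf x] with p h1 h2
          rw [h1, h2]
          by_cases hp : p.1 = h
          · have hmem : p ∈ ({h} : Set Γ) ×ˢ (Set.univ : Set X) := by simp [hp]
            rw [Set.indicator_of_mem hmem, Set.indicator_of_mem hmem, ← ofReal_norm]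
            refine ENNReal.ofReal_le_ofReal ?_
            refine (norm_inner_le_norm _ _).trans ?_
            rw [norm_mul]
            have : p = (h, p.2) := Prod.ext hp rfl
            rw [this]
            exact mul_le_mul (hB _) (hC _) (by positivity) hB0
          · have hmem : p ∉ ({h} : Set Γ) ×ˢ (Set.univ : Set X) := by simp [hp]
            rw [Set.indicator_of_notMem hmem, Set.indicator_of_notMem hmem]
            simp
      _ = ENNReal.ofReal (B * C) := by
          rw [lintegral_indicator_const (.prod .of_discrete .univ), Measure.prod_prod]
          simp
  rw [← ofReal_norm] at hle
  exact (ENNReal.ofReal_le_ofReal_iff (by positivity)).1 hle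

/-- The set on which the `h`-th Fourier coefficient of `x_n` is larger than `1 / (k + 1)`, for
`i = (h, k)`. -/
def coeffSet (x : boundedSeq (crossedProduct Γ μ)) (i : Γ × ℕ) (n : ℕ) : Set X :=
  {y | 1 / ((i.2 : ℝ) + 1) < ‖vec ((x : ℕ → crossedProduct Γ μ) n) (i.1, y)‖}

theorem measurableSet_coeffSet (x : boundedSeq (crossedProduct Γ μ)) (i : Γ × ℕ) (n : ℕ) :
    MeasurableSet (coeffSet x i n) :=
  measurableSet_lt measurable_const (measurable_vec_slice _ _).norm

/-- The inner product of `f x` with `b u_h` involves only the `h`-th Fourier coefficient of `f x`. -/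
theorem norm_utrace_monomial_le {b f : ℕ → X → ℂ} (hb : BddSeq b) (hf : BddSeq f)
    (x : boundedSeq (crossedProduct Γ μ)) (h : Γ) {B C : ℝ} (hB0 : 0 ≤ B) (hC0 : 0 ≤ C)
    (hB : ∀ n y, ‖b n y‖ ≤ B)
    (hC : ∀ n y, ‖f n y‖ * ‖vec ((x : ℕ → crossedProduct Γ μ) n) (h, y)‖ ≤ C) :
    ‖utrace _ (traceVec Γ μ) ω (star ((fnU Γ μ ω b hb : MPow Γ μ ω) * (uU μ ω h : MPow Γ μ ω)) *
      ((fnU Γ μ ω f hf : MPow Γ μ ω) * mkU _ (traceVec Γ μ) ω x))‖ ≤ B * C :=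
  le_of_tendsto (tendsto_inner (Ω := traceVec Γ μ) (ω := ω)
    (fnSeq Γ μ b hb * constSeq _ (canonUnitary μ h : crossedProduct Γ μ))
    (fnSeq Γ μ f hf * x)).norm (.of_forall fun n =>
      norm_inner_vec_le (hb.bddMeas n) (hf.bddMeas n) ((x : ℕ → crossedProduct Γ μ) n)
        h hB0 hC0 (hB n) (hC n))

/-- At almost every point some Fourier coefficient of a unitary `w ∈ M(ω)` does not vanish: if `y`
vanishes on all the sets `coeffSet`, then `y w` is orthogonal to all products `a u_h`, so that
`y w = 0` and `y = 0`. -/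
theorem full_coeffSet {w : unitary (MPow Γ μ ω)} (hw' : (w : MPow Γ μ ω) ∈ MOmega Γ μ ω)
    {x : boundedSeq (crossedProduct Γ μ)} (hx : mkU _ (traceVec Γ μ) ω x = (w : MPow Γ μ ω)) :
    Full fun i => setU Γ μ ω (coeffSet x i) (measurableSet_coeffSet x i) := by
  intro y hy
  have hz : (y : MPow Γ μ ω) * (w : MPow Γ μ ω) = 0 := by
    refine eq_zero_of_orthogonal
      (mul_mem (subUltrapower_le_cartanUltrapower _ _ ω _ y.2) hw') fun a h => ?_
    obtain ⟨f, hf, rfl⟩ := exists_fnU y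
    obtain ⟨b, hb, rfl⟩ := exists_fnU a
    obtain ⟨C, hC⟩ := hf.2
    obtain ⟨B, hB⟩ := hb.2
    have hne : Nonempty X := nonempty_of_isProbabilityMeasure μ
    have hC0 : 0 ≤ C := (norm_nonneg _).trans (hC 0 hne.some)
    have hB0 : 0 ≤ B := (norm_nonneg _).trans (hB 0 hne.some)
    refine norm_le_zero_iff.1 (ge_of_tendsto' (f := fun k : ℕ => B * (C * (1 / ((k : ℝ) + 1))))
      (x := atTop) ?_ fun k => ?_)
    · simpa using (tendsto_one_div_add_atTop_nhds_zero_nat.const_mul C).const_mul B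
    -- Since `y` vanishes on `coeffSet x (h, k)`, its representatives may be cut off there; then the
    -- `h`-th coefficient of `y w` is at most `C / (k + 1)`, for every `k`.
    have hb' : BddSeq fun n y => f n y * (coeffSet x (h, k) n)ᶜ.indicator (fun _ => (1 : ℂ)) y :=
      hf.mul (bddSeq_indicator fun n => (measurableSet_coeffSet x (h, k) n).compl)
    have h1 : fnU Γ μ ω f hf = fnU Γ μ ω _ hb' := by
      have h2 : fnU Γ μ ω f hf * (1 - setU Γ μ ω (coeffSet x (h, k))
          (measurableSet_coeffSet x (h, k))) = fnU Γ μ ω f hf := by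
        have := hy (h, k)
        beta_reduce at this
        rw [mul_sub, this, mul_one, sub_zero]
      rw [one_sub_setU, setU, fnU_mul] at h2
      exact h2.symm
    rw [h1, ← hx]
    refine norm_utrace_monomial_le hb hb' x h hB0 (by positivity) hB fun n y => ?_
    by_cases hyR : y ∈ coeffSet x (h, k) n
    · simp only [Set.indicator, Set.mem_compl_iff, hyR, not_true, if_false, mul_zero,
        norm_zero, zero_mul]
      positivity
    · simp only [Set.indicator, Set.mem_compl_iff, hyR, not_false_iff, if_true, mul_one]
      exact mul_le_mul (hC n y) (not_lt.1 hyR) (norm_nonneg _) hC0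
  have h3 : (y : MPow Γ μ ω) * (w : MPow Γ μ ω) * star (w : MPow Γ μ ω) = 0 := by
    rw [hz, zero_mul]
  have h4 : (w : MPow Γ μ ω) * star (w : MPow Γ μ ω) = 1 := Unitary.coe_mul_star_self w
  rw [mul_assoc, h4, mul_one] at h3
  exact Subtype.ext h3

theorem tendsto_vec_of_mkU_mul_eq {a b : ℕ → X → ℂ} (ha : BddSeq a) (hb : BddSeq b)
    {x : boundedSeq (crossedProduct Γ μ)}
    (h : (fnU Γ μ ω a ha : MPow Γ μ ω) * mkU _ (traceVec Γ μ) ω x =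
      mkU _ (traceVec Γ μ) ω x * (fnU Γ μ ω b hb : MPow Γ μ ω)) :
    Tendsto (fun n => ‖vec (fnOp Γ μ (a n) (ha.bddMeas n) * (x : ℕ → crossedProduct Γ μ) n -
      (x : ℕ → crossedProduct Γ μ) n * fnOp Γ μ (b n) (hb.bddMeas n))‖) ω (𝓝 0) :=
  (mkU_eq_iff (M := crossedProduct Γ μ) (Ω := traceVec Γ μ) (ω := ω)
    (x := fnSeq Γ μ a ha * x) (y := x * fnSeq Γ μ b hb)).1 h

/-- Where the `h`-th Fourier coefficient of `w` does not vanish, `Ad(w)` acts as `σ^ω_h`: compare the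
`h`-th Fourier coefficients `Ad(w)(b) w_h` and `σ_h(b) w_h` of the two sides of
`Ad(w)(b) w = w b`. -/
theorem Ad_mul_coeffSet {w : unitary (MPow Γ μ ω)} (hw : w ∈ normalizer (APow Γ μ ω))
    {x : boundedSeq (crossedProduct Γ μ)} (hx : mkU _ (traceVec Γ μ) ω x = (w : MPow Γ μ ω))
    (h : Γ) (k : ℕ) (b : APow Γ μ ω) :
    Ad w hw b * setU Γ μ ω (coeffSet x (h, k)) (measurableSet_coeffSet x (h, k)) =
      ultraAction μ ω h b * setU Γ μ ω (coeffSet x (h, k)) (measurableSet_coeffSet x (h, k)) := by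
  have hcomm : (Ad w hw b : MPow Γ μ ω) * w = w * b := by
    rw [coe_Ad, mul_assoc, Unitary.coe_star_mul_self, mul_one]
  obtain ⟨f', hf', hAd⟩ := exists_fnU (Ad w hw b)
  rw [hAd] at hcomm ⊢
  clear hAd
  obtain ⟨f, hf, rfl⟩ := exists_fnU b
  rw [ultraAction_fnU, setU, fnU_mul, fnU_mul, fnU_eq_iff]
  rw [← hx] at hcomm
  have hlim := tendsto_vec_of_mkU_mul_eq hf' hf hcomm
  rw [tendsto_norm_zero_iff] at hlim
  -- On `coeffSet x (h, k)` division by the `h`-th coefficient of `w` costs a factor `k + 1`.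
  have h4 := ENNReal.Tendsto.const_mul (a := ((k : ℝ≥0∞) + 1) ^ 2) hlim
    (Or.inr (by finiteness))
  rw [mul_zero] at h4
  refine tendsto_of_tendsto_of_tendsto_of_le_of_le tendsto_const_nhds h4 (fun _ => bot_le)
    fun n => ?_
  have h5 := lintegral_slice_le (vec (fnOp Γ μ (f' n) (hf'.bddMeas n) *
    (x : ℕ → crossedProduct Γ μ) n - (x : ℕ → crossedProduct Γ μ) n *
      fnOp Γ μ (f n) (hf.bddMeas n))) h
  refine le_trans ?_ (mul_le_mul_right h5 (((k : ℝ≥0∞) + 1) ^ 2))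
  rw [← lintegral_const_mul' _ _ (by finiteness)]
  refine lintegral_mono_ae ?_
  rw [vec_sub]
  filter_upwards [ae_slice (Lp.coeFn_sub (vec (fnOp Γ μ (f' n) (hf'.bddMeas n) *
    (x : ℕ → crossedProduct Γ μ) n)) (vec ((x : ℕ → crossedProduct Γ μ) n *
      fnOp Γ μ (f n) (hf.bddMeas n)))) h,
    ae_slice (vec_fnOp_mul (hf'.bddMeas n) ((x : ℕ → crossedProduct Γ μ) n)) h,
    ae_slice (vec_mul_fnOp (hf.bddMeas n) ((x : ℕ → crossedProduct Γ μ) n)) h] with y h6 h7 h8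
  rw [h6, Pi.sub_apply, h7, h8]
  rw [← sub_mul, ← sub_mul, enorm_mul, enorm_mul, mul_pow, mul_pow, mul_left_comm]
  refine mul_le_mul_right ?_ _
  by_cases hyR : y ∈ coeffSet x (h, k) n
  · rw [Set.indicator_of_mem hyR, enorm_one, one_pow, ← mul_pow]
    refine one_le_pow₀ ?_
    have h9 : (1 : ℝ) ≤ ((k : ℝ) + 1) * ‖vec ((x : ℕ → crossedProduct Γ μ) n) (h, y)‖ := by
      have : 1 / ((k : ℝ) + 1) < ‖vec ((x : ℕ → crossedProduct Γ μ) n) (h, y)‖ := hyR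
      rw [div_lt_iff₀ (by positivity)] at this
      linarith
    have h10 := ENNReal.ofReal_le_ofReal h9
    rw [ENNReal.ofReal_one, ENNReal.ofReal_mul (by positivity), ofReal_norm,
      ENNReal.ofReal_add (by positivity) zero_le_one, ENNReal.ofReal_one,
      ENNReal.ofReal_natCast] at h10
    exact h10
  · rw [Set.indicator_of_notMem hyR, enorm_zero, zero_pow two_ne_zero]
    exact bot_le

/-- A unitary `w ∈ M(ω)` normalizing `A^ω` acts on `A^ω` piecewise by the automorphisms `σ^ω_h`:
there are projections in `A^ω` with no common annihilator, on each of which `Ad(w)` coincides with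
some `σ^ω_h`. -/
theorem exists_piecewise_ultraAction {w : unitary (MPow Γ μ ω)}
    (hw : w ∈ normalizer (APow Γ μ ω)) (hw' : (w : MPow Γ μ ω) ∈ MOmega Γ μ ω) :
    ∃ r : Γ × ℕ → APow Γ μ ω, Full r ∧ (∀ i, r i * r i = r i) ∧
      ∀ i b, Ad w hw b * r i = ultraAction μ ω i.1 b * r i := by
  obtain ⟨x, hx⟩ := exists_mkU (w : MPow Γ μ ω)
  exact ⟨_, full_coeffSet hw' hx, fun i => setU_mul_self _,
    fun i b => Ad_mul_coeffSet hw hx i.1 i.2 b⟩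

end Normalizer

/-! ### Unitaries of full group elements -/

section FullGroup

variable {Γ : Type} [Group Γ] [Countable Γ] [MeasurableSpace Γ] [DiscreteMeasurableSpace Γ]
  {X : Type} [MeasurableSpace X] {μ : Measure X} [IsProbabilityMeasure μ]
  [MulAction Γ X] [MeasurableConstSMul Γ X] [SMulInvariantMeasure Γ X μ]

variable (μ) in
/-- The maps `x ↦ c x • x` and `x ↦ c' x • x` are mutually inverse elements of the full group. -/
structure IsFullGroupPair (c c' : X → Γ) : Prop where
  measurable : Measurable c
  measurable' : Measurable c'
  mp : MeasurePreserving (fun x => c x • x) μ μ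
  mp' : MeasurePreserving (fun x => c' x • x) μ μ
  inv : ∀ᵐ x ∂μ, c' (c x • x) * c x = 1
  inv' : ∀ᵐ x ∂μ, c (c' x • x) * c' x = 1

theorem IsFullGroupPair.symm {c c' : X → Γ} (h : IsFullGroupPair μ c c') :
    IsFullGroupPair μ c' c :=
  ⟨h.measurable', h.measurable, h.mp', h.mp, h.inv', h.inv⟩

theorem IsFullGroupPair.measurePreserving {c c' : X → Γ} (h : IsFullGroupPair μ c c') :
    MeasurePreserving (fun p : Γ × X => (c p.2 * p.1, c p.2 • p.2))
      ((Measure.count : Measure Γ).prod μ) ((Measure.count : Measure Γ).prod μ) := by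
  have h1 : MeasurePreserving (fun p : X × Γ => (c p.1 • p.1, c p.1 * p.2))
      (μ.prod (Measure.count : Measure Γ)) (μ.prod (Measure.count : Measure Γ)) := by
    refine h.mp.skew_product (g := fun x k => c x * k) ?_ (.of_forall fun x =>
      (measurePreserving_count (Equiv.mulLeft (c x))).map_eq)
    exact (Measurable.of_discrete (f := fun q : Γ × Γ => q.1 * q.2)).comp
      ((h.measurable.comp measurable_fst).prodMk measurable_snd)
  exact Measure.measurePreserving_swap.comp (h1.comp Measure.measurePreserving_swap)

/-- The unitary operator `(U ξ)(h, x) = ξ(c(x) h, c(x) x)` of the full group element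
`x ↦ c x • x`. -/
def fullOp {c c' : X → Γ} (h : IsFullGroupPair μ c c') : GMSSpace Γ μ →L[ℂ] GMSSpace Γ μ :=
  (Lp.compMeasurePreservingₗᵢ ℂ _ h.measurePreserving).toContinuousLinearMap

theorem fullOp_apply {c c' : X → Γ} (h : IsFullGroupPair μ c c') (ξ : GMSSpace Γ μ) :
    fullOp h ξ =ᵐ[(Measure.count : Measure Γ).prod μ]
      fun p => ξ (c p.2 * p.1, c p.2 • p.2) :=
  Lp.coeFn_compMeasurePreserving ξ h.measurePreserving

theorem fullOp_mul_symm {c c' : X → Γ} (h : IsFullGroupPair μ c c') :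
    fullOp h * fullOp h.symm = 1 := by
  ext1 ξ
  refine Lp.ext ?_
  filter_upwards [fullOp_apply h (fullOp h.symm ξ),
    h.measurePreserving.quasiMeasurePreserving.ae (fullOp_apply h.symm ξ),
    ae_of_ae_slice (Γ := Γ) (P := fun p => c' (c p.2 • p.2) * c p.2 = 1) fun _ => h.inv]
    with p h1 h2 h3
  rw [mul_apply_eq_comp, h1, h2]
  rw [← mul_assoc, ← mul_smul, h3, one_mul, one_smul]
  rfl

theorem star_fullOp {c c' : X → Γ} (h : IsFullGroupPair μ c c') :
    star (fullOp h) = fullOp h.symm := by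
  rw [ContinuousLinearMap.star_eq_adjoint]
  symm
  rw [ContinuousLinearMap.eq_adjoint_iff]
  intro x y
  have h1 : fullOp h (fullOp h.symm x) = x := by
    rw [← mul_apply_eq_comp, fullOp_mul_symm]; simp
  conv_rhs => rw [← h1]
  exact (LinearIsometry.inner_map_map (𝕜 := ℂ) (E := GMSSpace Γ μ) (E' := GMSSpace Γ μ)
    (Lp.compMeasurePreservingₗᵢ ℂ _ h.measurePreserving) _ _).symm

theorem IsFullGroupPair.measurableSet {c c' : X → Γ} (h : IsFullGroupPair μ c c') (g : Γ) :
    MeasurableSet {x | c x = g} := h.measurable (.of_discrete (s := {g}))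

theorem fnOp_apply_fullOp {c c' : X → Γ} (h : IsFullGroupPair μ c c') (g : Γ)
    (ξ : GMSSpace Γ μ) :
    (fnOp Γ μ _ (bddMeas_indicator (h.measurableSet g⁻¹)) : GMSSpace Γ μ →L[ℂ] GMSSpace Γ μ)
      (fullOp h ξ) =
    (fnOp Γ μ _ (bddMeas_indicator (h.measurableSet g⁻¹)) : GMSSpace Γ μ →L[ℂ] GMSSpace Γ μ)
      (canonOp μ g ξ) := by
  refine Lp.ext ?_
  filter_upwards [fnOp_isMulBy (bddMeas_indicator (h.measurableSet g⁻¹)) (fullOp h ξ),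
    fnOp_isMulBy (bddMeas_indicator (h.measurableSet g⁻¹)) (canonOp μ g ξ), fullOp_apply h ξ,
    canonOp_apply μ g ξ] with p h1 h2 h3 h4
  rw [h1, h2, h3, h4]
  by_cases hp : c p.2 = g⁻¹
  · rw [hp]
  · simp [Set.indicator, hp]

/-- Over `{c = g⁻¹}` the operator of a full group element agrees with `u_g`, so that it commutes with
the commutant of `M`. -/
theorem fullOp_mem {c c' : X → Γ} (h : IsFullGroupPair μ c c') :
    fullOp h ∈ crossedProduct Γ μ := by
  have key : ∀ z : GMSSpace Γ μ →L[ℂ] GMSSpace Γ μ,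
      z ∈ StarSubalgebra.centralizer ℂ
        ((mulAlg Γ μ : Set _) ∪ Set.range (canonOp (Γ := Γ) μ)) →
      z * fullOp h = fullOp h * z := by
    intro z hz
    rw [StarSubalgebra.mem_centralizer_iff] at hz
    ext1 ξ
    rw [← sub_eq_zero, mul_apply_eq_comp, mul_apply_eq_comp]
    set η := z (fullOp h ξ) - fullOp h (z ξ) with hη
    have hP : ∀ g : Γ, (fnOp Γ μ _ (bddMeas_indicator (h.measurableSet g⁻¹)) :
        GMSSpace Γ μ →L[ℂ] GMSSpace Γ μ) η = 0 := by
      intro g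
      set P : GMSSpace Γ μ →L[ℂ] GMSSpace Γ μ :=
        (fnOp Γ μ _ (bddMeas_indicator (h.measurableSet g⁻¹)) :
          GMSSpace Γ μ →L[ℂ] GMSSpace Γ μ) with hPdef
      have h1 : P * z = z * P :=
        (hz P (Or.inl (fnOp_mem (bddMeas_indicator (h.measurableSet g⁻¹))))).1
      have h2 : canonOp μ g * z = z * canonOp μ g := (hz _ (Or.inr ⟨g, rfl⟩)).1
      have h3 : ∀ ξ, P (fullOp h ξ) = P (canonOp μ g ξ) := fnOp_apply_fullOp h g
      have h4 : ∀ ξ, P (z ξ) = z (P ξ) := fun ξ => DFunLike.congr_fun h1 ξ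
      have h5 : canonOp μ g (z ξ) = z (canonOp μ g ξ) := DFunLike.congr_fun h2 ξ
      rw [hη, map_sub, h3, h4, h3, h5, h4, sub_self]
    refine Lp.ext ?_
    have h6 : ∀ᵐ p ∂((Measure.count : Measure Γ).prod μ), ∀ g : Γ,
        ({x | c x = g⁻¹}.indicator (fun _ => (1 : ℂ)) p.2) * η p = 0 := by
      refine ae_all_iff.2 fun g => ?_
      filter_upwards [fnOp_isMulBy (bddMeas_indicator (h.measurableSet g⁻¹)) η,
        Lp.coeFn_zero ℂ 2 ((Measure.count : Measure Γ).prod μ)] with p h7 h8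
      rw [← h7, hP g, h8]
      rfl
    filter_upwards [h6, Lp.coeFn_zero ℂ 2 ((Measure.count : Measure Γ).prod μ)] with p h7 h8
    have := h7 (c p.2)⁻¹
    rw [inv_inv, Set.indicator_of_mem (s := {x | c x = c p.2}) rfl, one_mul] at this
    rw [this, h8]
    rfl
  rw [crossedProduct, StarSubalgebra.mem_centralizer_iff]
  exact fun z hz => ⟨key z hz, key _ (star_mem hz)⟩

/-- The unitary of `M` given by a full group element. -/
def fullUnitary {c c' : X → Γ} (h : IsFullGroupPair μ c c') : unitary (crossedProduct Γ μ) :=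
  ⟨⟨fullOp h, fullOp_mem h⟩, by
    rw [Unitary.mem_iff]
    constructor <;> refine Subtype.ext ?_
    · change star (fullOp h) * fullOp h = 1
      rw [star_fullOp]
      exact fullOp_mul_symm h.symm
    · change fullOp h * star (fullOp h) = 1
      rw [star_fullOp, fullOp_mul_symm]⟩

theorem star_fullUnitary {c c' : X → Γ} (h : IsFullGroupPair μ c c') :
    star (fullUnitary h : crossedProduct Γ μ) = (fullUnitary h.symm : crossedProduct Γ μ) :=
  Subtype.ext (star_fullOp h)

theorem fnOp_mul_fullUnitary {c c' : X → Γ} (h : IsFullGroupPair μ c c') (g : Γ) :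
    fnOp Γ μ _ (bddMeas_indicator (h.measurableSet g⁻¹)) * (fullUnitary h : crossedProduct Γ μ) =
    fnOp Γ μ _ (bddMeas_indicator (h.measurableSet g⁻¹)) *
      (canonUnitary μ g : crossedProduct Γ μ) := by
  refine Subtype.ext ?_
  ext1 ξ
  exact fnOp_apply_fullOp h g ξ

theorem fullUnitary_conj_mem {c c' : X → Γ} (h : IsFullGroupPair μ c c')
    {a : crossedProduct Γ μ} (ha : a ∈ cartan Γ μ) :
    (fullUnitary h : crossedProduct Γ μ) * a * star (fullUnitary h : crossedProduct Γ μ) ∈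
      cartan Γ μ := by
  obtain ⟨f, hf, rfl⟩ := exists_eq_fnOp ha
  have hb : BddMeas fun x => f (c x • x) :=
    ⟨hf.1.comp h.mp.measurable, hf.2.imp fun _ hC _ => hC _⟩
  have : (fullUnitary h : crossedProduct Γ μ) * fnOp Γ μ f hf =
      fnOp Γ μ _ hb * (fullUnitary h : crossedProduct Γ μ) := by
    refine Subtype.ext ?_
    ext1 ξ
    refine Lp.ext ?_
    change fullOp h ((fnOp Γ μ f hf : GMSSpace Γ μ →L[ℂ] GMSSpace Γ μ) ξ) =ᵐ[_]
      (fnOp Γ μ _ hb : GMSSpace Γ μ →L[ℂ] GMSSpace Γ μ) (fullOp h ξ)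
    filter_upwards [fullOp_apply h ((fnOp Γ μ f hf : GMSSpace Γ μ →L[ℂ] GMSSpace Γ μ) ξ),
      h.measurePreserving.quasiMeasurePreserving.ae (fnOp_isMulBy hf ξ), fullOp_apply h ξ,
      fnOp_isMulBy hb (fullOp h ξ)] with p h1 h2 h3 h4
    rw [h1, h2, h4, h3]
  have h1 : (fullUnitary h : crossedProduct Γ μ) * star (fullUnitary h : crossedProduct Γ μ) = 1 :=
    Unitary.coe_mul_star_self _
  rw [this, mul_assoc, h1, mul_one]
  exact fnOp_mem hb

theorem fullUnitary_mem_normalizer {c c' : X → Γ} (h : IsFullGroupPair μ c c') :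
    fullUnitary h ∈ normalizer (cartan Γ μ) := by
  intro a
  rw [Unitary.conjStarAlgAut_apply]
  refine ⟨fun h1 => ?_, fullUnitary_conj_mem h⟩
  have h2 := fullUnitary_conj_mem h.symm h1
  rw [← star_fullUnitary h, star_star] at h2
  have h3 : star (fullUnitary h : crossedProduct Γ μ) * (fullUnitary h : crossedProduct Γ μ) = 1 :=
    Unitary.coe_star_mul_self _
  have h4 : star (fullUnitary h : crossedProduct Γ μ) * ((fullUnitary h : crossedProduct Γ μ) * a *
      star (fullUnitary h : crossedProduct Γ μ)) * (fullUnitary h : crossedProduct Γ μ) =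
      (star (fullUnitary h : crossedProduct Γ μ) * (fullUnitary h : crossedProduct Γ μ)) * a *
      (star (fullUnitary h : crossedProduct Γ μ) * (fullUnitary h : crossedProduct Γ μ)) := by
    simp only [mul_assoc]
  rwa [h4, h3, one_mul, mul_one] at h2

end FullGroup

/-! ### Greedy extension of partial maps to full group elements -/

section Greedy

variable {Γ : Type} [Group Γ] [Countable Γ] [MeasurableSpace Γ] [DiscreteMeasurableSpace Γ]
  {X : Type} [MeasurableSpace X] {μ : Measure X} [IsProbabilityMeasure μ]
  [MulAction Γ X] [MeasurableConstSMul Γ X] [SMulInvariantMeasure Γ X μ]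

/-- The pair of the part of `X` already in the range and of the part already in the domain after
`j` steps of the greedy construction of a full group element out of the partial maps
`h_i : h_i⁻¹ Q_i → Q_i`. -/
def greedy (h : ℕ → Γ) (Q : ℕ → Set X) : ℕ → Set X × Set X
  | 0 => (∅, ∅)
  | j + 1 => ((greedy h Q j).1 ∪ ((Q j \ (greedy h Q j).1) \ (fun x => (h j)⁻¹ • x) ⁻¹'
      (greedy h Q j).2), (greedy h Q j).2 ∪ (fun x => h j • x) ⁻¹' ((Q j \ (greedy h Q j).1) \
        (fun x => (h j)⁻¹ • x) ⁻¹' (greedy h Q j).2))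

/-- The range of the restriction of `h_j` which is used in step `j` of the greedy construction. -/
def greedyPiece (h : ℕ → Γ) (Q : ℕ → Set X) (j : ℕ) : Set X :=
  (Q j \ (greedy h Q j).1) \ (fun x => (h j)⁻¹ • x) ⁻¹' (greedy h Q j).2

variable (h : ℕ → Γ) (Q : ℕ → Set X)

theorem greedy_fst (j : ℕ) : (greedy h Q j).1 = ⋃ i < j, greedyPiece h Q i := by
  induction j with
  | zero => simp [greedy]
  | succ j ih =>
    change (greedy h Q j).1 ∪ greedyPiece h Q j = _
    rw [Set.biUnion_lt_succ, ih]

theorem greedy_snd (j : ℕ) : (greedy h Q j).2 =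
    ⋃ i < j, (fun x => h i • x) ⁻¹' greedyPiece h Q i := by
  induction j with
  | zero => simp [greedy]
  | succ j ih =>
    change (greedy h Q j).2 ∪ (fun x => h j • x) ⁻¹' greedyPiece h Q j = _
    rw [Set.biUnion_lt_succ, ih]

/-- A point of `Q_j` is used in step `j` unless the point itself is already in the range or its
preimage under `h_j` is already in the domain. -/
theorem mem_greedyPiece {j : ℕ} {x : X} : x ∈ greedyPiece h Q j ↔ x ∈ Q j ∧
    (∀ i < j, x ∉ greedyPiece h Q i) ∧ ∀ i < j, h i • (h j)⁻¹ • x ∉ greedyPiece h Q i := by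
  have : x ∈ greedyPiece h Q j ↔ (x ∈ Q j ∧ x ∉ (greedy h Q j).1) ∧
    (h j)⁻¹ • x ∉ (greedy h Q j).2 := Iff.rfl
  rw [this, greedy_fst, greedy_snd]
  simp [and_assoc]

theorem measurableSet_greedyPiece (hQ : ∀ j, MeasurableSet (Q j)) (j : ℕ) :
    MeasurableSet (greedyPiece h Q j) := by
  induction j using Nat.strong_induction_on with
  | _ j ih =>
    refine ((hQ j).diff ?_).diff (measurable_const_smul (h j)⁻¹ ?_)
    · rw [greedy_fst]
      exact .iUnion fun i => .iUnion fun hi => ih i hi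
    · rw [greedy_snd]
      exact .iUnion fun i => .iUnion fun hi => measurable_const_smul (h i) (ih i hi)

theorem disjoint_greedyPiece : Pairwise (Function.onFun Disjoint (greedyPiece h Q)) := by
  rw [pairwise_disjoint_on]
  intro i j hij
  rw [Set.disjoint_left]
  exact fun x hi hj => ((mem_greedyPiece h Q).1 hj).2.1 i hij hi

theorem disjoint_greedyPiece' : Pairwise (Function.onFun Disjoint
    fun j => (fun x => h j • x) ⁻¹' greedyPiece h Q j) := by
  rw [pairwise_disjoint_on]
  intro i j hij
  rw [Set.disjoint_left]
  intro x hi hj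
  refine ((mem_greedyPiece h Q).1 hj).2.2 i hij ?_
  rwa [inv_smul_smul]

theorem measure_eq_tsum_inter {T : ℕ → Set X} (hT : ∀ j, MeasurableSet (T j))
    (hd : Pairwise (Function.onFun Disjoint T)) (hc : μ (⋃ j, T j)ᶜ = 0) {S : Set X}
    (hS : MeasurableSet S) : μ S = ∑' j, μ (S ∩ T j) := by
  rw [← measure_iUnion (fun i j hij => (hd hij).mono Set.inter_subset_right Set.inter_subset_right)
    (fun j => hS.inter (hT j)), ← Set.inter_iUnion, measure_inter_conull hc]

/-- A map given by group elements on the pieces of a partition preserves the measure if the images of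
the pieces form a partition too. -/
theorem measurePreserving_of_pieces {h : ℕ → Γ} {T : ℕ → Set X} (hT : ∀ j, MeasurableSet (T j))
    (hd : Pairwise (Function.onFun Disjoint T)) (hc : μ (⋃ j, T j)ᶜ = 0)
    (hd' : Pairwise (Function.onFun Disjoint fun j => (fun x => h j • x) ⁻¹' T j))
    (hc' : μ (⋃ j, (fun x => h j • x) ⁻¹' T j)ᶜ = 0) {c : X → Γ} (hcm : Measurable c)
    (hch : ∀ j, ∀ x ∈ T j, c x = (h j)⁻¹) : MeasurePreserving (fun x => c x • x) μ μ := by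
  have hm : Measurable fun x => c x • x :=
    (measurable_from_prod_countable_right (f := fun q : Γ × X => q.1 • q.2)
      fun g => measurable_const_smul g).comp (hcm.prodMk measurable_id)
  refine ⟨hm, ?_⟩
  ext S hS
  rw [Measure.map_apply hm hS, measure_eq_tsum_inter hT hd hc (hm hS),
    measure_eq_tsum_inter (fun j => measurable_const_smul (h j) (hT j)) hd' hc' hS]
  refine tsum_congr fun j => ?_
  rw [← measure_preimage_smul (h j) _ (μ := μ)]
  congr 1
  ext x
  simp only [Set.mem_preimage, Set.mem_inter_iff]
  refine and_congr_left fun hx => ?_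
  rw [hch j _ hx, inv_smul_smul]

/-- If all of `Γ` is tried, the greedy construction exhausts range and domain up to null sets. The
set `I` of points whose orbit meets the complement of the domain is invariant and contained in the
range, as any point of `I` outside of the range could still be matched. The construction therefore
maps a part of `I` of measure `μ(I ∩ W)`, where `W` is the domain, onto `I`, so that `I` meets
the complement of `W` in a null set. -/
theorem measure_compl_greedy (hQ : ∀ j, MeasurableSet (Q j))
    (hall : ∀ g : Γ, ∃ j, h j = g ∧ Q j = Set.univ) :
    μ (⋃ j, greedyPiece h Q j)ᶜ = 0 ∧
      μ (⋃ j, (fun x => h j • x) ⁻¹' greedyPiece h Q j)ᶜ = 0 := by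
  have hT := measurableSet_greedyPiece h Q hQ
  have hT' : ∀ j, MeasurableSet ((fun x => h j • x) ⁻¹' greedyPiece h Q j) := fun j =>
    measurable_const_smul (h j) (hT j)
  have hd := disjoint_greedyPiece h Q
  have hd' := disjoint_greedyPiece' h Q
  set V := ⋃ j, greedyPiece h Q j with hV
  set W := ⋃ j, (fun x => h j • x) ⁻¹' greedyPiece h Q j with hW
  have hVm : MeasurableSet V := .iUnion hT
  have hWm : MeasurableSet W := .iUnion hT'
  set I : Set X := ⋃ g : Γ, (fun x => g • x) ⁻¹' Wᶜ with hI
  have hIm : MeasurableSet I := .iUnion fun g => measurable_const_smul g hWm.compl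
  have hIinv : ∀ (g : Γ) x, g • x ∈ I ↔ x ∈ I := by
    intro g x
    simp only [hI, Set.mem_iUnion, Set.mem_preimage]
    constructor
    · rintro ⟨k, hk⟩
      exact ⟨k * g, by rwa [mul_smul]⟩
    · rintro ⟨k, hk⟩
      exact ⟨k * g⁻¹, by rwa [mul_smul, inv_smul_smul]⟩
  -- If `g` moves `x` out of the domain, consider the step with `h_j = g⁻¹` and `Q_j = X`: there `x`
  -- is put into the range, unless it is there already.
  have hIV : I ⊆ V := by
    intro x hx
    obtain ⟨g, hg⟩ := Set.mem_iUnion.1 hx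
    by_contra hxV
    obtain ⟨j, hj, hjQ⟩ := hall g⁻¹
    refine hxV (Set.mem_iUnion.2 ⟨j, (mem_greedyPiece h Q).2 ⟨hjQ ▸ Set.mem_univ x, ?_, ?_⟩⟩)
    · exact fun i _ hi => hxV (Set.mem_iUnion.2 ⟨i, hi⟩)
    · intro i _ hi
      rw [hj, inv_inv] at hi
      exact hg (Set.mem_iUnion.2 ⟨i, hi⟩)
  have hWI : Wᶜ ⊆ I := fun x hx => Set.mem_iUnion.2 ⟨1, by simpa using hx⟩
  have hμI : μ I = μ (I ∩ W) := by
    have h1 : μ I = ∑' j, μ (I ∩ greedyPiece h Q j) := by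
      rw [← measure_iUnion (fun i j hij =>
        (hd hij).mono Set.inter_subset_right Set.inter_subset_right)
        (fun j => hIm.inter (hT j)), ← Set.inter_iUnion, Set.inter_eq_left.2 hIV]
    have h2 : μ (I ∩ W) = ∑' j, μ (I ∩ (fun x => h j • x) ⁻¹' greedyPiece h Q j) := by
      rw [← measure_iUnion (fun i j hij =>
        (hd' hij).mono Set.inter_subset_right Set.inter_subset_right)
        (fun j => hIm.inter (hT' j)), ← Set.inter_iUnion]
    rw [h1, h2]
    refine tsum_congr fun j => ?_
    rw [← measure_preimage_smul (h j) _ (μ := μ)]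
    congr 1
    ext x
    simp [hIinv]
  have hW0 : μ Wᶜ = 0 := by
    have h1 := measure_inter_add_sdiff I hWm (μ := μ)
    rw [← hμI] at h1
    have h2 : μ (I \ W) = 0 := by
      have h3 := ENNReal.add_right_inj (measure_ne_top μ I) (b := μ (I \ W)) (c := 0)
      rw [add_zero] at h3
      exact h3.1 h1
    exact measure_mono_null (fun x hx => (⟨hWI hx, hx⟩ : x ∈ I \ W)) h2
  refine ⟨?_, hW0⟩
  have hVW : μ V = μ W := by
    rw [hV, hW, measure_iUnion hd hT, measure_iUnion hd' hT']
    exact tsum_congr fun j => (measure_preimage_smul (μ := μ) (h j) _).symm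
  rw [prob_compl_eq_zero_iff hVm, hVW]
  exact (prob_compl_eq_zero_iff hWm).1 hW0

/-- If every `g ∈ Γ` occurs among the partial maps `h_j : h_j⁻¹ Q_j → Q_j` with `Q_j = X`, then
the greedy construction produces an element of the full group; it coincides with `h_j` over the
part of `Q_j` which does not interfere with the earlier partial maps. -/
theorem exists_isFullGroupPair (hQ : ∀ j, MeasurableSet (Q j))
    (hall : ∀ g : Γ, ∃ j, h j = g ∧ Q j = Set.univ) :
    ∃ c c' : X → Γ, IsFullGroupPair μ c c' ∧ ∀ j, ∀ x ∈ Q j, (∀ i < j, x ∉ Q i) →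
      (∀ i < j, h i • (h j)⁻¹ • x ∉ Q i) → c x = (h j)⁻¹ := by
  have hT := measurableSet_greedyPiece h Q hQ
  have hT' : ∀ j, MeasurableSet ((fun x => h j • x) ⁻¹' greedyPiece h Q j) := fun j =>
    measurable_const_smul (h j) (hT j)
  have hd := disjoint_greedyPiece h Q
  have hd' := disjoint_greedyPiece' h Q
  obtain ⟨hc, hc'⟩ := measure_compl_greedy (μ := μ) h Q hQ hall
  obtain ⟨c, hcm, hch⟩ := exists_measurable_piecewise (greedyPiece h Q) hT
    (fun j _ => (h j)⁻¹) (fun _ => measurable_const)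
    (fun i j hij x hx => absurd hx.2 (Set.disjoint_left.1 (hd hij) hx.1))
  obtain ⟨c', hcm', hch'⟩ := exists_measurable_piecewise _ hT'
    (fun j _ => h j) (fun _ => measurable_const)
    (fun i j hij x hx => absurd hx.2 (Set.disjoint_left.1 (hd' hij) hx.1))
  have hmem : ∀ᵐ x ∂μ, x ∈ ⋃ j, greedyPiece h Q j := by rwa [ae_iff]
  have hmem' : ∀ᵐ x ∂μ, x ∈ ⋃ j, (fun x => h j • x) ⁻¹' greedyPiece h Q j := by rwa [ae_iff]
  have hback : (fun j => (fun x => (h j)⁻¹ • x) ⁻¹' ((fun x => h j • x) ⁻¹' greedyPiece h Q j)) =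
      greedyPiece h Q := by
    funext j
    ext x
    simp
  refine ⟨c, c', ⟨hcm, hcm', ?_, ?_, ?_, ?_⟩, ?_⟩
  · exact measurePreserving_of_pieces hT hd hc hd' hc' hcm fun j x hx => hch j hx
  · refine measurePreserving_of_pieces (h := fun j => (h j)⁻¹) hT' hd' hc' ?_ ?_ hcm'
      fun j x hx => ?_
    · rw [hback]; exact hd
    · rw [hback]; exact hc
    · rw [hch' j hx, inv_inv]
  · filter_upwards [hmem] with x hx
    obtain ⟨j, hj⟩ := Set.mem_iUnion.1 hx
    have h1 : c x = (h j)⁻¹ := hch j hj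
    have h2 : c' ((h j)⁻¹ • x) = h j := hch' j (by
      change h j • (h j)⁻¹ • x ∈ greedyPiece h Q j
      rwa [smul_inv_smul])
    rw [h1, h2, mul_inv_cancel]
  · filter_upwards [hmem'] with x hx
    obtain ⟨j, hj⟩ := Set.mem_iUnion.1 hx
    have h1 : c' x = h j := hch' j hj
    have h2 : c (h j • x) = (h j)⁻¹ := hch j hj
    rw [h1, h2, inv_mul_cancel]
  · intro j x hx h1 h2
    refine hch j ((mem_greedyPiece h Q).2 ⟨hx, fun i hi hxi => h1 i hi ?_,
      fun i hi hxi => h2 i hi ?_⟩)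
    · exact ((mem_greedyPiece h Q).1 hxi).1
    · exact ((mem_greedyPiece h Q).1 hxi).1

end Greedy

/-! ### Sequences of normalizing unitaries -/

section SequencesOfUnitaries

variable {H : Type} [NormedAddCommGroup H] [InnerProductSpace ℂ H] [CompleteSpace H]
  {M : StarSubalgebra ℂ (H →L[ℂ] H)} {Ω : H} [IsTraceVector M Ω] {ω : Ultrafilter ℕ}

theorem norm_unitary_le_one (u : unitary M) : ‖((u : M) : H →L[ℂ] H)‖ ≤ 1 := by
  have h1 : star ((u : M) : H →L[ℂ] H) * ((u : M) : H →L[ℂ] H) = 1 :=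
    congrArg (Subtype.val : M → H →L[ℂ] H) (Unitary.coe_star_mul_self u)
  have h2 := CStarRing.norm_star_mul_self (x := ((u : M) : H →L[ℂ] H))
  rw [h1] at h2
  have h3 : ‖(1 : H →L[ℂ] H)‖ ≤ 1 := ContinuousLinearMap.norm_id_le
  nlinarith [norm_nonneg ((u : M) : H →L[ℂ] H)]

/-- A sequence of unitaries as a bounded sequence. -/
def unitarySeq (u : ℕ → unitary M) : boundedSeq M :=
  ⟨fun n => (u n : M), 1, fun n => norm_unitary_le_one (u n)⟩

variable (Ω ω) in
/-- The unitary of `M^ω` given by a sequence of unitaries of `M`. -/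
def seqUnitary (u : ℕ → unitary M) : unitary (Ultrapower M Ω ω) :=
  ⟨mkU M Ω ω (unitarySeq u), by
    rw [Unitary.mem_iff]
    constructor
    · refine Eq.trans ?_ (map_one (mkHom M Ω ω))
      exact congrArg (mkU M Ω ω) (Subtype.ext (funext fun n => Unitary.coe_star_mul_self (u n)))
    · refine Eq.trans ?_ (map_one (mkHom M Ω ω))
      exact congrArg (mkU M Ω ω) (Subtype.ext (funext fun n => Unitary.coe_mul_star_self (u n)))⟩

theorem star_mem_normalizer {R : Type} [Ring R] [StarRing R] [Algebra ℂ R] [StarModule ℂ R]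
    {A : StarSubalgebra ℂ R} {u : unitary R} (hu : u ∈ normalizer A) : star u ∈ normalizer A := by
  intro a
  rw [← hu, Unitary.conjStarAlgAut_apply, Unitary.conjStarAlgAut_apply]
  have h : (u : R) * star (u : R) = 1 := Unitary.coe_mul_star_self u
  have h1 : (u : R) * ((star u : unitary R) * a * star ((star u : unitary R) : R)) * star (u : R) =
      a := by
    rw [Unitary.coe_star, star_star]
    calc _ = ((u : R) * star (u : R)) * a * ((u : R) * star (u : R)) := by simp only [mul_assoc]
      _ = a := by rw [h, one_mul, mul_one]
  rw [h1]

theorem mul_mem_normalizer {R : Type} [Ring R] [StarRing R] [Algebra ℂ R] [StarModule ℂ R]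
    {A : StarSubalgebra ℂ R} {u v : unitary R} (hu : u ∈ normalizer A) (hv : v ∈ normalizer A) :
    u * v ∈ normalizer A := by
  intro a
  rw [map_mul]
  exact (hu _).trans (hv a)

theorem mem_normalizer_of_conj {R : Type} [Ring R] [StarRing R] [Algebra ℂ R] [StarModule ℂ R]
    {A : StarSubalgebra ℂ R} {u : unitary R} (h1 : ∀ a ∈ A, (u : R) * a * star (u : R) ∈ A)
    (h2 : ∀ a ∈ A, star (u : R) * a * (u : R) ∈ A) : u ∈ normalizer A := by
  intro a
  rw [Unitary.conjStarAlgAut_apply]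
  refine ⟨fun h => ?_, h1 a⟩
  have h3 := h2 _ h
  have h4 : star (u : R) * (u : R) = 1 := Unitary.coe_star_mul_self u
  have h5 : star (u : R) * ((u : R) * a * star (u : R)) * (u : R) =
      (star (u : R) * (u : R)) * a * (star (u : R) * (u : R)) := by simp only [mul_assoc]
  rwa [h5, h4, one_mul, mul_one] at h3

theorem seqUnitary_conj_mem {A : StarSubalgebra ℂ M} {u : ℕ → unitary M}
    (hu : ∀ n, u n ∈ normalizer A) {a : Ultrapower M Ω ω} (ha : a ∈ subUltrapower M Ω ω A) :
    (seqUnitary Ω ω u : Ultrapower M Ω ω) * a * star (seqUnitary Ω ω u : Ultrapower M Ω ω) ∈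
      subUltrapower M Ω ω A := by
  obtain ⟨x, hx, rfl⟩ := ha
  exact ⟨unitarySeq u * x * star (unitarySeq u), fun n => (hu n _).2 (hx n), rfl⟩

theorem seqUnitary_mem_normalizer {A : StarSubalgebra ℂ M} {u : ℕ → unitary M}
    (hu : ∀ n, u n ∈ normalizer A) :
    seqUnitary Ω ω u ∈ normalizer (subUltrapower M Ω ω A) := by
  refine mem_normalizer_of_conj (fun a ha => seqUnitary_conj_mem hu ha) fun a ha => ?_
  have := seqUnitary_conj_mem (fun n => star_mem_normalizer (hu n)) ha
  have hs : (seqUnitary Ω ω (fun n => star (u n)) : Ultrapower M Ω ω) =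
    star (seqUnitary Ω ω u : Ultrapower M Ω ω) := rfl
  rwa [hs, star_star] at this

end SequencesOfUnitaries

/-! ### Lifting projections to sequences of full group elements -/

section Lift

variable {Γ : Type} [Group Γ] [Countable Γ] [MeasurableSpace Γ] [DiscreteMeasurableSpace Γ]
  {X : Type} [MeasurableSpace X] {μ : Measure X} [IsProbabilityMeasure μ]
  [MulAction Γ X] [MeasurableConstSMul Γ X] [SMulInvariantMeasure Γ X μ] {ω : Ultrafilter ℕ}

/-- A family with finite partial sums close to `1` in `‖ ‖₂` is full. -/
theorem full_of_sum {ι : Type} {t : ι → APow Γ μ ω}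
    (hsum : ∀ ε : ℝ, 0 < ε → ∃ F : Finset ι,
      twoNorm _ (traceVec Γ μ) ω ((1 - ∑ i ∈ F, t i : APow Γ μ ω) : MPow Γ μ ω) < ε) : Full t := by
  intro x hx
  obtain ⟨C, hC, h⟩ := exists_twoNorm_mul_le (x : MPow Γ μ ω)
  have key : ∀ ε : ℝ, 0 < ε → twoNorm _ (traceVec Γ μ) ω (x : MPow Γ μ ω) ≤ 0 + ε := by
    intro ε hε
    obtain ⟨F, hF⟩ := hsum (ε / (C + 1)) (by positivity)
    have h1 : x * (1 - ∑ i ∈ F, t i) = x := by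
      rw [mul_sub, mul_one, Finset.mul_sum, Finset.sum_eq_zero fun i _ => hx i, sub_zero]
    have h2 := h ((1 - ∑ i ∈ F, t i : APow Γ μ ω) : MPow Γ μ ω)
    rw [← MulMemClass.coe_mul, h1] at h2
    rw [lt_div_iff₀ (by positivity)] at hF
    have h3 := twoNorm_nonneg ((1 - ∑ i ∈ F, t i : APow Γ μ ω) : MPow Γ μ ω)
    nlinarith
  have h0 := le_of_forall_pos_le_add key
  exact Subtype.ext (twoNorm_eq_zero.1 (h0.antisymm (twoNorm_nonneg _)))

/-- Projections of `A^ω` which behave like the graph decomposition of a full group element can be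
lifted to a sequence of full group elements. -/
theorem exists_fullGroup_lift (hω : (ω : Filter ℕ) ≤ cofinite) {t : Γ → APow Γ μ ω}
    (ht : ∀ g, t g * t g = t g) (hd : ∀ g k, g ≠ k → t g * t k = 0)
    (hd' : ∀ g k, g ≠ k → ultraAction μ ω g⁻¹ (t g) * ultraAction μ ω k⁻¹ (t k) = 0)
    (hfull : Full t) :
    ∃ (c c' : ℕ → X → Γ) (h : ∀ n, IsFullGroupPair μ (c n) (c' n)), ∀ g,
      t g = setU Γ μ ω (fun n => {x | c n x = g⁻¹}) (fun n => (h n).measurableSet g⁻¹) := by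
  classical
  choose E hE htE using fun g => exists_setU_of_mul_self (ht g)
  have hne : Nonempty Γ := ⟨1⟩
  obtain ⟨e, he⟩ := exists_surjective_nat Γ
  -- For the `n`-th full group element, `n` greedy steps use the sets lifting `t (e 0), …,
  -- t (e (n - 1))`; all of `Γ` is then tried on all of `X`, to fill what is left.
  set hh : ℕ → ℕ → Γ := fun n j => if j < n then e j else e (j - n) with hhh
  set Q : ℕ → ℕ → Set X := fun n j => if j < n then E (e j) n else Set.univ with hQdef
  have hQ : ∀ n j, MeasurableSet (Q n j) := by
    intro n j
    simp only [hQdef]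
    split_ifs
    · exact hE _ _
    · exact .univ
  have hall : ∀ n g, ∃ j, hh n j = g ∧ Q n j = Set.univ := by
    intro n g
    obtain ⟨k, rfl⟩ := he g
    exact ⟨n + k, by simp [hhh], by simp [hQdef]⟩
  choose c c' hc hcQ using fun n => exists_isFullGroupPair (μ := μ) (hh n) (Q n) (hQ n) (hall n)
  refine ⟨c, c', hc, ?_⟩
  set p : Γ → APow Γ μ ω := fun g =>
    setU Γ μ ω (fun n => {x | c n x = g⁻¹}) (fun n => (hc n).measurableSet g⁻¹) with hp
  have htp : ∀ g, t g * (1 - p g) = 0 := by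
    intro g
    have hex : ∃ j, e j = g := he g
    set j := Nat.find hex with hj
    have hjg : e j = g := Nat.find_spec hex
    have hji : ∀ i < j, e i ≠ g := fun i hi => Nat.find_min hex hi
    -- The part of `E g n` on which the earlier steps interfere is asymptotically null: `h1` for the
    -- overlap of ranges, `h2` for the overlap of domains.
    have h1 : ∀ i < j, Tendsto (fun n => μ (E g n ∩ E (e i) n)) ω (𝓝 0) := by
      intro i hi
      have := hd g (e i) (hji i hi).symm
      rwa [htE g, htE (e i), setU_mul, setU_eq_zero_iff] at this
    have h2 : ∀ i < j, Tendsto (fun n => μ (E g n ∩ (fun x => (e i * g⁻¹) • x) ⁻¹' E (e i) n))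
        ω (𝓝 0) := by
      intro i hi
      have := hd' g (e i) (hji i hi).symm
      rw [htE g, htE (e i), ultraAction_setU, ultraAction_setU, setU_mul,
        setU_eq_zero_iff] at this
      simp only [inv_inv] at this
      refine this.congr fun n => ?_
      rw [← measure_preimage_smul (μ := μ) g (E g n ∩ _)]
      congr 1
      ext x
      simp [mul_smul]
    rw [htE g, hp]
    simp only
    rw [one_sub_setU, setU_mul, setU_eq_zero_iff]
    have hsum : Tendsto (fun n => ∑ i ∈ Finset.range j, (μ (E g n ∩ E (e i) n) +
        μ (E g n ∩ (fun x => (e i * g⁻¹) • x) ⁻¹' E (e i) n))) ω (𝓝 0) := by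
      have := tendsto_finsetSum (Finset.range j) fun i hi =>
        (h1 i (Finset.mem_range.1 hi)).add (h2 i (Finset.mem_range.1 hi))
      simpa using this
    refine tendsto_of_tendsto_of_tendsto_of_le_of_le' tendsto_const_nhds hsum
      (.of_forall fun _ => bot_le) ?_
    have hev : ∀ᶠ n in (ω : Filter ℕ), j < n := by
      have : ∀ᶠ n in atTop, j < n := eventually_gt_atTop j
      rw [← Nat.cofinite_eq_atTop] at this
      exact hω this
    filter_upwards [hev] with n hn
    have hsub : E g n ∩ {x | c n x = g⁻¹}ᶜ ⊆ ⋃ i ∈ Finset.range j,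
        ((E g n ∩ E (e i) n) ∪ (E g n ∩ (fun x => (e i * g⁻¹) • x) ⁻¹' E (e i) n)) := by
      rintro x ⟨hxE, hxc⟩
      by_contra hnot
      simp only [Set.mem_iUnion, Finset.mem_range, Set.mem_union, Set.mem_inter_iff,
        Set.mem_preimage, not_exists, not_or, not_and] at hnot
      refine hxc ?_
      have hQj : Q n j = E g n := by simp [hQdef, hn, hjg]
      have hhj : hh n j = g := by simp [hhh, hn, hjg]
      have := hcQ n j x (hQj ▸ hxE) ?_ ?_
      · rwa [hhj] at this
      · intro i hi
        have hQi : Q n i = E (e i) n := by simp [hQdef, hi.trans hn]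
        rw [hQi]
        exact (hnot i hi).1 hxE
      · intro i hi
        have hQi : Q n i = E (e i) n := by simp [hQdef, hi.trans hn]
        have hhi : hh n i = e i := by simp [hhh, hi.trans hn]
        rw [hQi, hhi, hhj, ← mul_smul]
        exact (hnot i hi).2 hxE
    refine (measure_mono hsub).trans ((measure_biUnion_finset_le _ _).trans ?_)
    exact Finset.sum_le_sum fun i _ => measure_union_le _ _
  have hpp : ∀ g k, g ≠ k → p g * p k = 0 := by
    intro g k hgk
    simp only [hp]
    rw [setU_mul, ← setU_empty]
    refine setU_congr _ (funext fun n => ?_)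
    ext x
    simp only [Set.mem_inter_iff, Set.mem_ofPred_eq, Set.mem_empty_iff_false, iff_false, not_and]
    intro h1 h2
    exact hgk (inv_injective (h1.symm.trans h2))
  intro g
  have h1 : t g * p g = t g := by
    have := htp g
    rw [mul_sub, mul_one, sub_eq_zero] at this
    exact this.symm
  -- The `p k` are disjoint and contain the `t k`; as the `t k` are full, `p g` cannot be larger
  -- than `t g`.
  have h2 : p g * (1 - t g) = 0 := by
    refine hfull _ fun k => ?_
    by_cases hk : g = k
    · subst hk
      rw [mul_assoc, sub_mul, one_mul, ht, sub_self, mul_zero]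
    · have h3 : t k = t k * p k := by
        have := htp k
        rw [mul_sub, mul_one, sub_eq_zero] at this
        exact this
      calc p g * (1 - t g) * t k = p g * (t k - t g * t k) := by rw [mul_assoc, sub_mul, one_mul]
        _ = p g * (t k * p k) := by rw [hd g k hk, sub_zero, ← h3]
        _ = p g * p k * t k := by rw [APow_mul_comm (t k), mul_assoc]
        _ = 0 := by rw [hpp g k hk, zero_mul]
  rw [mul_sub, mul_one, sub_eq_zero] at h2
  rw [← h1, APow_mul_comm, ← h2]

/-- Projections of `A^ω` which behave like the graph decomposition of a full group element come from a
unitary of `M(ω)` given by a sequence in the normalizer of `A`. -/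
theorem exists_unitary_lift (hω : (ω : Filter ℕ) ≤ cofinite) {t : Γ → APow Γ μ ω}
    (ht : ∀ g, t g * t g = t g) (hd : ∀ g k, g ≠ k → t g * t k = 0)
    (hd' : ∀ g k, g ≠ k → ultraAction μ ω g⁻¹ (t g) * ultraAction μ ω k⁻¹ (t k) = 0)
    (hsum : ∀ ε : ℝ, 0 < ε → ∃ F : Finset Γ,
      twoNorm _ (traceVec Γ μ) ω ((1 - ∑ g ∈ F, t g : APow Γ μ ω) : MPow Γ μ ω) < ε) :
    ∃ u : ℕ → unitary (crossedProduct Γ μ), (∀ n, u n ∈ normalizer (cartan Γ μ)) ∧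
      (seqUnitary (traceVec Γ μ) ω u : MPow Γ μ ω) ∈ MOmega Γ μ ω ∧
      ∀ g, (t g : MPow Γ μ ω) * (seqUnitary (traceVec Γ μ) ω u : MPow Γ μ ω) =
        (t g : MPow Γ μ ω) * (uU μ ω g : MPow Γ μ ω) := by
  obtain ⟨c, c', hc, htc⟩ := exists_fullGroup_lift hω ht hd hd' (full_of_sum hsum)
  set u : ℕ → unitary (crossedProduct Γ μ) := fun n => fullUnitary (hc n) with hu
  have htu : ∀ g, (t g : MPow Γ μ ω) * (seqUnitary (traceVec Γ μ) ω u : MPow Γ μ ω) =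
      (t g : MPow Γ μ ω) * (uU μ ω g : MPow Γ μ ω) := by
    intro g
    rw [htc g]
    change mkU (crossedProduct Γ μ) (traceVec Γ μ) ω
        (fnSeq Γ μ _ (bddSeq_indicator fun n => (hc n).measurableSet g⁻¹) * unitarySeq u) =
      mkU (crossedProduct Γ μ) (traceVec Γ μ) ω
        (fnSeq Γ μ _ (bddSeq_indicator fun n => (hc n).measurableSet g⁻¹) *
          constSeq _ (canonUnitary μ g : crossedProduct Γ μ))
    exact mkU_congr fun n => fnOp_mul_fullUnitary (hc n) g
  refine ⟨u, fun n => fullUnitary_mem_normalizer (hc n), ?_, htu⟩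
  refine isVNSubalgebra_cartanUltrapower _ _ fun ε hε => ?_
  obtain ⟨F, hF⟩ := hsum ε hε
  refine ⟨∑ g ∈ F, (t g : MPow Γ μ ω) * (uU μ ω g : MPow Γ μ ω), sum_mem fun g _ =>
    mul_mem (subUltrapower_le_cartanUltrapower _ _ ω _ (t g).2) (uU_mem_MOmega g), ?_⟩
  have h1 : (seqUnitary (traceVec Γ μ) ω u : MPow Γ μ ω) -
      ∑ g ∈ F, (t g : MPow Γ μ ω) * (uU μ ω g : MPow Γ μ ω) =
      ((1 - ∑ g ∈ F, t g : APow Γ μ ω) : MPow Γ μ ω) *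
        (seqUnitary (traceVec Γ μ) ω u : MPow Γ μ ω) := by
    rw [Finset.sum_congr rfl fun g _ => (htu g).symm, ← Finset.sum_mul]
    simp only [AddSubgroupClass.coe_sub, OneMemClass.coe_one, AddSubmonoidClass.coe_finsetSum,
      sub_mul, one_mul]
  rw [h1, twoNorm_mul_unitary]
  exact hF

end Lift

/-! ### Sequences of sets represented by sets of a limit space -/

section Represent

variable {X : Type} [MeasurableSpace X] {μ : Measure X} [IsProbabilityMeasure μ]
  {K : Type} [MeasurableSpace K] [TopologicalSpace K] [OpensMeasurableSpace K]
  {m : Measure K} [IsProbabilityMeasure m] {ω : Ultrafilter ℕ} {p : ℕ → X → K}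

variable (μ m ω p) in
/-- The measure `m` is the limit along `ω` of the images of `μ` under the maps `p_n`, on clopen
sets. -/
def ClopenLimit : Prop := (∀ n, Measurable (p n)) ∧ ∀ C, IsClopen C →
  Tendsto (fun n => μ.real (p n ⁻¹' C)) ω (𝓝 (m.real C))

variable (μ m ω p) in
/-- The sequence of sets `E_n ⊆ X` represents `S ⊆ K`: it is approximated by the preimages
`p_n⁻¹(C)` of clopen sets `C` which approximate `S`. -/
def Represents (S : Set K) (E : ℕ → Set X) : Prop :=
  ∀ ε : ℝ, 0 < ε → ∃ C, IsClopen C ∧ m.real (symmDiff S C) < ε ∧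
    ∀ᶠ n in (ω : Filter ℕ), μ.real (symmDiff (E n) (p n ⁻¹' C)) < ε

theorem represents_clopen {C : Set K} (hC : IsClopen C) :
    Represents μ m ω p C fun n => p n ⁻¹' C := by
  intro ε hε
  refine ⟨C, hC, ?_, .of_forall fun n => ?_⟩ <;> simpa using hε

theorem Represents.compl {S : Set K} {E : ℕ → Set X} (h : Represents μ m ω p S E) :
    Represents μ m ω p Sᶜ fun n => (E n)ᶜ := by
  intro ε hε
  obtain ⟨C, hC, h1, h2⟩ := h ε hε
  refine ⟨Cᶜ, hC.compl, ?_, ?_⟩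
  · rwa [compl_symmDiff_compl]
  · filter_upwards [h2] with n hn
    rwa [Set.preimage_compl, compl_symmDiff_compl]

theorem inter_symmDiff_inter_subset {α : Type} (A B C D : Set α) :
    symmDiff (A ∩ B) (C ∩ D) ⊆ symmDiff A C ∪ symmDiff B D := by
  intro x
  simp only [Set.mem_symmDiff, Set.mem_union, Set.mem_inter_iff]
  tauto

theorem Represents.inter {S T : Set K} {E F : ℕ → Set X} (h : Represents μ m ω p S E)
    (h' : Represents μ m ω p T F) : Represents μ m ω p (S ∩ T) fun n => E n ∩ F n := by
  intro ε hε
  obtain ⟨C, hC, h1, h2⟩ := h (ε / 2) (by positivity)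
  obtain ⟨D, hD, h3, h4⟩ := h' (ε / 2) (by positivity)
  refine ⟨C ∩ D, hC.inter hD, ?_, ?_⟩
  · refine (measureReal_mono (inter_symmDiff_inter_subset _ _ _ _)).trans_lt ?_
    refine (measureReal_union_le _ _).trans_lt ?_
    linarith
  · filter_upwards [h2, h4] with n h5 h6
    rw [Set.preimage_inter]
    refine (measureReal_mono (inter_symmDiff_inter_subset _ _ _ _)).trans_lt ?_
    refine (measureReal_union_le _ _).trans_lt ?_
    linarith

theorem Represents.union {S T : Set K} {E F : ℕ → Set X} (h : Represents μ m ω p S E)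
    (h' : Represents μ m ω p T F) : Represents μ m ω p (S ∪ T) fun n => E n ∪ F n := by
  have := (h.compl.inter h'.compl).compl
  simpa only [← Set.compl_union, compl_compl] using this

theorem Represents.symmDiff {S T : Set K} {E F : ℕ → Set X} (h : Represents μ m ω p S E)
    (h' : Represents μ m ω p T F) :
    Represents μ m ω p (symmDiff S T) fun n => symmDiff (E n) (F n) := by
  have := (h.inter h'.compl).union (h'.inter h.compl)
  simpa only [Set.symmDiff_def, Set.sdiff_eq] using this

theorem Represents.biUnion {ι : Type} {S : ι → Set K} {E : ι → ℕ → Set X}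
    (h : ∀ i, Represents μ m ω p (S i) (E i)) (J : Finset ι) :
    Represents μ m ω p (⋃ i ∈ J, S i) fun n => ⋃ i ∈ J, E i n := by
  classical
  induction J using Finset.induction_on with
  | empty => simpa using represents_clopen (μ := μ) (m := m) (ω := ω) (p := p) isClopen_empty
  | insert a J _ ih =>
    simp only [Finset.set_biUnion_insert]
    exact (h a).union ih

/-- If `E_n` represents `S`, the measures of the `E_n` converge to the measure of `S`. In particular
the projection of `A^ω` given by `E_n` depends only on `S`. -/
theorem Represents.tendsto (hp : ClopenLimit μ m ω p) {S : Set K} (hS : MeasurableSet S)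
    {E : ℕ → Set X} (hE : ∀ n, MeasurableSet (E n)) (h : Represents μ m ω p S E) :
    Tendsto (fun n => μ.real (E n)) ω (𝓝 (m.real S)) := by
  rw [Metric.tendsto_nhds]
  intro ε hε
  obtain ⟨C, hC, h1, h2⟩ := h (ε / 3) (by positivity)
  have h3 := Metric.tendsto_nhds.1 (hp.2 C hC) (ε / 3) (by positivity)
  filter_upwards [h2, h3] with n h4 h5
  have hCm : MeasurableSet C := hC.isOpen.measurableSet
  have h6 := abs_measureReal_sub_le_measureReal_symmDiff (μ := μ) (hE n).nullMeasurableSet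
    (hp.1 n hCm).nullMeasurableSet
  have h7 := abs_measureReal_sub_le_measureReal_symmDiff (μ := m) hS.nullMeasurableSet
    hCm.nullMeasurableSet
  rw [Real.dist_eq] at h5 ⊢
  have h8 := abs_sub_le (μ.real (E n)) (μ.real (p n ⁻¹' C)) (m.real S)
  have h9 := abs_sub_le (μ.real (p n ⁻¹' C)) (m.real C) (m.real S)
  rw [abs_sub_comm (m.real C)] at h9
  linarith

theorem measureReal_symmDiff_triangle (A B C : Set K) :
    m.real (_root_.symmDiff A C) ≤ m.real (_root_.symmDiff A B) + m.real (_root_.symmDiff B C) :=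
  (measureReal_mono (symmDiff_triangle A B C)).trans (measureReal_union_le _ _)

/-- Every measurable subset of `K` is represented by some sequence of sets, by a diagonal
argument. -/
theorem exists_represents (hω : (ω : Filter ℕ) ≤ cofinite) (hp : ClopenLimit μ m ω p)
    (hgen : ∀ S : Set K, MeasurableSet S → ∀ ε : ℝ, 0 < ε →
      ∃ C, IsClopen C ∧ m.real (symmDiff S C) < ε) {S : Set K} (hS : MeasurableSet S) :
    ∃ E : ℕ → Set X, (∀ n, MeasurableSet (E n)) ∧ Represents μ m ω p S E := by
  classical
  choose C hC hSC using fun k : ℕ => hgen S hS ((1 / 2 : ℝ) ^ k) (by positivity)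
  -- `G n k` says that the map `p_n` sees the distances of `C k` from the earlier `C i` up to an
  -- error `2⁻ᵏ`. Each `G n k` holds for `ω`-almost all `n`, so `κ n`, the largest `k ≤ n` with
  -- `G n k`, tends to infinity along `ω`.
  set G : ℕ → ℕ → Prop := fun n k => k ≤ n ∧ ∀ i ≤ k,
    μ.real (_root_.symmDiff (p n ⁻¹' C k) (p n ⁻¹' C i)) <
      m.real (_root_.symmDiff (C k) (C i)) + (1 / 2 : ℝ) ^ k with hG
  have hGω : ∀ k, ∀ᶠ n in (ω : Filter ℕ), G n k := by
    intro k
    have h1 : ∀ᶠ n in (ω : Filter ℕ), k ≤ n := by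
      have : ∀ᶠ n in atTop, k ≤ n := eventually_ge_atTop k
      rw [← Nat.cofinite_eq_atTop] at this
      exact hω this
    have h2 : ∀ᶠ n in (ω : Filter ℕ), ∀ i ∈ Finset.range (k + 1),
        μ.real (_root_.symmDiff (p n ⁻¹' C k) (p n ⁻¹' C i)) <
          m.real (_root_.symmDiff (C k) (C i)) + (1 / 2 : ℝ) ^ k := by
      refine (eventually_all_finset _).2 fun i _ => ?_
      have hclopen : IsClopen (_root_.symmDiff (C k) (C i)) := by
        rw [Set.symmDiff_def]
        exact ((hC k).diff (hC i)).union ((hC i).diff (hC k))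
      exact (hp.2 _ hclopen).eventually (gt_mem_nhds (by simp))
    filter_upwards [h1, h2] with n h3 h4
    exact ⟨h3, fun i hi => h4 i (by simpa using Nat.lt_succ_of_le hi)⟩
  set κ : ℕ → ℕ := fun n => Nat.findGreatest (G n) n with hκ
  refine ⟨fun n => p n ⁻¹' C (κ n), fun n => hp.1 n (hC _).isOpen.measurableSet, ?_⟩
  intro ε hε
  obtain ⟨i, hi⟩ := exists_pow_lt_of_lt_one (show (0 : ℝ) < ε / 3 by positivity)
    (show (1 / 2 : ℝ) < 1 by norm_num)
  refine ⟨C i, hC i, (hSC i).trans (by linarith), ?_⟩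
  filter_upwards [hGω i] with n hn
  have h1 : i ≤ κ n := Nat.le_findGreatest hn.1 hn
  have h2 : G n (κ n) := Nat.findGreatest_spec hn.1 hn
  have h3 := h2.2 i h1
  have h4 : ((1 / 2 : ℝ)) ^ (κ n) ≤ (1 / 2) ^ i :=
    pow_le_pow_of_le_one (by norm_num) (by norm_num) h1
  have h5 := measureReal_symmDiff_triangle (m := m) (C (κ n)) S (C i)
  have h6 := hSC (κ n)
  rw [symmDiff_comm] at h6
  have h7 := hSC i
  linarith

end Represent

/-! ### Measures on `{0,1}^I` -/

section Cantor

variable {I : Type} [Countable I]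

theorem isClopen_coord (i : I) : IsClopen {x : I → Bool | x i = true} :=
  (isClopen_discrete {true}).preimage (continuous_apply i)

theorem measurableSet_coord (i : I) : MeasurableSet {x : I → Bool | x i = true} :=
  (isClopen_coord i).isOpen.measurableSet

theorem generateFrom_coord : (MeasurableSpace.pi : MeasurableSpace (I → Bool)) =
    MeasurableSpace.generateFrom (Set.range fun i => {x : I → Bool | x i = true}) := by
  refine le_antisymm (iSup_le fun i => ?_) (MeasurableSpace.generateFrom_le ?_)
  · rw [← measurable_iff_comap_le]
    refine measurable_to_bool ?_
    exact MeasurableSpace.measurableSet_generateFrom ⟨i, rfl⟩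
  · rintro _ ⟨i, rfl⟩
    exact measurableSet_coord i

/-- Clopen sets are dense in the measure algebra of any probability measure on `{0,1}^I`, because they
form a ring which generates the measurable sets. -/
theorem exists_clopen_symmDiff_lt (m : Measure (I → Bool)) [IsProbabilityMeasure m]
    {S : Set (I → Bool)} (hS : MeasurableSet S) {ε : ℝ} (hε : 0 < ε) :
    ∃ C, IsClopen C ∧ m.real (symmDiff S C) < ε := by
  have hring : IsSetRing {C : Set (I → Bool) | IsClopen C} :=
    ⟨isClopen_empty, fun _ _ => IsClopen.union, fun _ _ => IsClopen.diff⟩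
  have hgen : (MeasurableSpace.pi : MeasurableSpace (I → Bool)) =
      MeasurableSpace.generateFrom {C : Set (I → Bool) | IsClopen C} := by
    refine le_antisymm ?_ (MeasurableSpace.generateFrom_le fun C hC => hC.isOpen.measurableSet)
    rw [generateFrom_coord]
    refine MeasurableSpace.generateFrom_mono ?_
    rintro _ ⟨i, rfl⟩
    exact isClopen_coord i
  obtain ⟨C, hC, h⟩ := exists_measure_symmDiff_lt_of_generateFrom_isSetRing (μ := m) hring
    ⟨{Set.univ}, Set.countable_singleton _, by simpa using isClopen_univ, by simp⟩ hgen hS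
    (ENNReal.ofReal_pos.2 hε)
  refine ⟨C, hC, ?_⟩
  rw [symmDiff_comm, measureReal_def]
  exact (ENNReal.lt_ofReal_iff_toReal_lt (measure_ne_top _ _)).1 h

/-- The limit along `ω` of the image measures exists since the space of probability measures on
`{0,1}^I` is compact; clopen sets have empty frontier. -/
theorem exists_clopenLimit {X : Type} [MeasurableSpace X] (μ : Measure X)
    [IsProbabilityMeasure μ] (ω : Ultrafilter ℕ) {p : ℕ → X → I → Bool}
    (hp : ∀ n, Measurable (p n)) :
    ∃ m : Measure (I → Bool), IsProbabilityMeasure m ∧ ClopenLimit μ m ω p := by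
  set P : ℕ → ProbabilityMeasure (I → Bool) := fun n =>
    ⟨μ.map (p n), Measure.isProbabilityMeasure_map (hp n).aemeasurable⟩ with hP
  have hlim : Tendsto P ω (𝓝 (ω.map P).lim) := (ω.map P).le_nhds_lim
  refine ⟨((ω.map P).lim : ProbabilityMeasure (I → Bool)), inferInstance, hp, fun C hC => ?_⟩
  have h := ProbabilityMeasure.tendsto_measure_of_null_frontier_of_tendsto' hlim (E := C)
    (by rw [hC.frontier_eq, measure_empty])
  refine ((ENNReal.tendsto_toReal (measure_ne_top _ _)).comp h).congr fun n => ?_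
  change ((μ.map (p n)) C).toReal = _
  rw [Measure.map_apply (hp n) hC.isOpen.measurableSet]
  rfl

end Cantor

/-! ### Point realizations of countable families of projections -/

section Model

variable {Γ : Type} [Group Γ] [Countable Γ] [MeasurableSpace Γ] [DiscreteMeasurableSpace Γ]
  {X : Type} [MeasurableSpace X] {μ : Measure X} [IsProbabilityMeasure μ]
  [MulAction Γ X] [MeasurableConstSMul Γ X] [SMulInvariantMeasure Γ X μ] {ω : Ultrafilter ℕ}

/-- A point realization of the projections `d_i ∈ A^ω`, `i ∈ I`: a probability measure on
`{0,1}^I` and a `σ`-homomorphism `Φ` from its measurable sets to the projections of `A^ω` which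
preserves the measure and maps the `i`-th coordinate set to `d_i`. -/
structure IsModel {I : Type} (d : I → APow Γ μ ω) (m : Measure (I → Bool))
    (Φ : Set (I → Bool) → APow Γ μ ω) : Prop where
  inter : ∀ S T, MeasurableSet S → MeasurableSet T → Φ (S ∩ T) = Φ S * Φ T
  compl : ∀ S, MeasurableSet S → Φ Sᶜ = 1 - Φ S
  coord : ∀ i, Φ {x | x i = true} = d i
  norm : ∀ S, MeasurableSet S → twoNorm _ (traceVec Γ μ) ω (Φ S : MPow Γ μ ω) ^ 2 = m.real S
  full : ∀ {ι : Type} [Countable ι] (S : ι → Set (I → Bool)), (∀ k, MeasurableSet (S k)) →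
    m (⋃ k, S k)ᶜ = 0 → Full fun k => Φ (S k)

theorem exists_finset_measure_compl_lt {α : Type} [MeasurableSpace α] {m : Measure α}
    [IsFiniteMeasure m] {ι : Type} [Countable ι] {S : ι → Set α} (hS : ∀ k, MeasurableSet (S k))
    (hc : m (⋃ k, S k)ᶜ = 0) {ε : ℝ≥0∞} (hε : 0 < ε) :
    ∃ F : Finset ι, m (⋃ k ∈ F, S k)ᶜ < ε := by
  have hanti : Antitone fun F : Finset ι => (⋃ k ∈ F, S k)ᶜ := fun F F' hF =>
    Set.compl_subset_compl.2 (Set.biUnion_subset_biUnion_left hF)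
  have hl := tendsto_measure_iInter_atTop (μ := m) (fun F : Finset ι =>
    (F.measurableSet_biUnion fun k _ => hS k).compl.nullMeasurableSet) hanti
    ⟨∅, measure_ne_top _ _⟩
  have hI : (⋂ F : Finset ι, (⋃ k ∈ F, S k)ᶜ) = (⋃ k, S k)ᶜ := by
    rw [← Set.compl_iUnion, ← Set.iUnion_eq_iUnion_finset]
  rw [hI, hc] at hl
  exact (hl.eventually (gt_mem_nhds hε)).exists

/-- Countably many projections of `A^ω` have a point realization: lift them to sequences of sets, and
take the limit of the images of `μ` under the maps `X → {0,1}^I` coding these sets. -/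
theorem exists_isModel (hω : (ω : Filter ℕ) ≤ cofinite) {I : Type} [Countable I]
    {d : I → APow Γ μ ω} (hd : ∀ i, d i * d i = d i) :
    ∃ (m : Measure (I → Bool)) (Φ : Set (I → Bool) → APow Γ μ ω),
      IsProbabilityMeasure m ∧ IsModel d m Φ := by
  classical
  choose D hD hdD using fun i => exists_setU_of_mul_self (hd i)
  set p : ℕ → X → I → Bool := fun n x i => decide (x ∈ D i n) with hp
  have hpm : ∀ n, Measurable (p n) := by
    intro n
    refine measurable_pi_iff.2 fun i => measurable_to_bool ?_
    have : (fun x => p n x i) ⁻¹' {true} = D i n := by ext x; simp [hp]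
    rw [this]
    exact hD i n
  obtain ⟨m, hm, hlim⟩ := exists_clopenLimit μ ω hpm
  choose E hE hrep using fun S : {S : Set (I → Bool) // MeasurableSet S} =>
    exists_represents hω hlim (fun S hS ε hε => exists_clopen_symmDiff_lt m hS hε) S.2
  -- The value `0` on nonmeasurable sets is irrelevant.
  set Φ : Set (I → Bool) → APow Γ μ ω := fun S =>
    if h : MeasurableSet S then setU Γ μ ω (E ⟨S, h⟩) (hE ⟨S, h⟩) else 0 with hΦ
  have hΦE : ∀ (S) (hS : MeasurableSet S), Φ S = setU Γ μ ω (E ⟨S, hS⟩) (hE ⟨S, hS⟩) :=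
    fun S hS => dif_pos hS
  -- The chosen sequence may be replaced by any other one representing `S`.
  have huniq : ∀ (S) (hS : MeasurableSet S) (F : ℕ → Set X) (hF : ∀ n, MeasurableSet (F n)),
      Represents μ m ω p S F → Φ S = setU Γ μ ω F hF := by
    intro S hS F hF h
    rw [hΦE S hS, setU_eq_iff]
    have h1 := (hrep ⟨S, hS⟩).symmDiff h
    have h2 := h1.tendsto hlim (hS.symmDiff hS) fun n => (hE ⟨S, hS⟩ n).symmDiff (hF n)
    simp only [symmDiff_self, Set.bot_eq_empty, measureReal_empty] at h2
    rw [← ENNReal.tendsto_toReal_iff (fun _ => measure_ne_top _ _) ENNReal.zero_ne_top]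
    exact h2
  refine ⟨m, Φ, hm, ?_, ?_, ?_, ?_, ?_⟩
  · intro S T hS hT
    rw [hΦE S hS, hΦE T hT, setU_mul]
    exact huniq _ (hS.inter hT) _ _ ((hrep ⟨S, hS⟩).inter (hrep ⟨T, hT⟩))
  · intro S hS
    rw [hΦE S hS, one_sub_setU]
    exact huniq _ hS.compl _ _ (hrep ⟨S, hS⟩).compl
  · intro i
    rw [hdD i]
    refine (huniq _ (measurableSet_coord i) _ (fun n => hpm n (measurableSet_coord i))
      (represents_clopen (isClopen_coord i))).trans (setU_congr _ (funext fun n => ?_))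
    ext x
    simp [hp]
  · intro S hS
    rw [hΦE S hS]
    have h1 := tendsto_measure_setU (Γ := Γ) (μ := μ) (ω := ω) (hE ⟨S, hS⟩)
    have h2 := (hrep ⟨S, hS⟩).tendsto hlim hS (hE ⟨S, hS⟩)
    have h3 := (ENNReal.tendsto_toReal (by finiteness)).comp h1
    have h4 := tendsto_nhds_unique h3 h2
    rwa [ENNReal.toReal_pow, ENNReal.toReal_ofReal (twoNorm_nonneg _)] at h4
  · intro ι _ S hS hcov
    have hf : (fun k => Φ (S k)) = fun k => setU Γ μ ω (E ⟨S k, hS k⟩) (hE ⟨S k, hS k⟩) :=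
      funext fun k => hΦE _ (hS k)
    rw [hf]
    refine full_of_cover (fun k => hE ⟨S k, hS k⟩) fun ε hε => ?_
    obtain ⟨F, hF⟩ := exists_finset_measure_compl_lt hS hcov hε
    refine ⟨F, ?_⟩
    have ht := (Represents.biUnion (fun k => hrep ⟨S k, hS k⟩) F).compl.tendsto hlim
      (F.measurableSet_biUnion fun k _ => hS k).compl fun n =>
      (F.measurableSet_biUnion fun k _ => hE ⟨S k, hS k⟩ n).compl
    have ht' := (ENNReal.tendsto_toReal_iff (fun _ => measure_ne_top _ _)
      (measure_ne_top _ _)).1 ht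
    exact ht'.eventually (gt_mem_nhds hF)

end Model

/-! ### Calculus of sets in a point realization -/

section ModelSets

variable {Γ : Type} [Group Γ] [Countable Γ] [MeasurableSpace Γ] [DiscreteMeasurableSpace Γ]
  {X : Type} [MeasurableSpace X] {μ : Measure X} [IsProbabilityMeasure μ]
  [MulAction Γ X] [MeasurableConstSMul Γ X] [SMulInvariantMeasure Γ X μ] {ω : Ultrafilter ℕ}
  {I : Type} {d : I → APow Γ μ ω} {m : Measure (I → Bool)} [IsProbabilityMeasure m]
  {Φ : Set (I → Bool) → APow Γ μ ω} {S T : Set (I → Bool)}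

namespace IsModel

theorem eq_zero_iff (h : IsModel d m Φ) (hS : MeasurableSet S) : Φ S = 0 ↔ m S = 0 := by
  rw [← measureReal_eq_zero_iff, ← h.norm S hS, sq_eq_zero_iff, twoNorm_eq_zero,
    ZeroMemClass.coe_eq_zero]

theorem mul_self (h : IsModel d m Φ) (hS : MeasurableSet S) : Φ S * Φ S = Φ S := by
  rw [← h.inter S S hS hS, Set.inter_self]

theorem empty (h : IsModel d m Φ) : Φ ∅ = 0 :=
  (h.eq_zero_iff .empty).2 measure_empty

theorem diff (h : IsModel d m Φ) (hS : MeasurableSet S) (hT : MeasurableSet T) :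
    Φ (S \ T) = Φ S * (1 - Φ T) := by
  rw [Set.sdiff_eq, h.inter _ _ hS hT.compl, h.compl _ hT]

theorem eq_iff (h : IsModel d m Φ) (hS : MeasurableSet S) (hT : MeasurableSet T) :
    Φ S = Φ T ↔ m (symmDiff S T) = 0 := by
  rw [Set.symmDiff_def, measure_union_null_iff, ← h.eq_zero_iff (hS.diff hT),
    ← h.eq_zero_iff (hT.diff hS), h.diff hS hT, h.diff hT hS, mul_sub, mul_sub, mul_one, mul_one,
    sub_eq_zero, sub_eq_zero]
  constructor
  · intro h1
    rw [h1, h.mul_self hT]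
    exact ⟨rfl, rfl⟩
  · rintro ⟨h1, h2⟩
    rw [h1, APow_mul_comm, ← h2]

theorem congr_ae (h : IsModel d m Φ) (hS : MeasurableSet S) (hT : MeasurableSet T)
    (hae : ∀ᵐ x ∂m, x ∈ S ↔ x ∈ T) : Φ S = Φ T := by
  rw [h.eq_iff hS hT, measure_symmDiff_eq_zero_iff]
  exact hae.mono fun x hx => propext hx

/-- The symmetric difference in terms of products and complements only; `setU_symmDiff` is the same
formula for sequences of sets. -/
theorem map_symmDiff (h : IsModel d m Φ) (hS : MeasurableSet S) (hT : MeasurableSet T) :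
    Φ (symmDiff S T) = 1 - (1 - Φ S * (1 - Φ T)) * (1 - Φ T * (1 - Φ S)) := by
  have : symmDiff S T = ((S \ T)ᶜ ∩ (T \ S)ᶜ)ᶜ := by
    rw [Set.symmDiff_def, Set.compl_inter, compl_compl, compl_compl]
  have h1 := hS.diff hT
  have h2 := hT.diff hS
  rw [this, h.compl _ (h1.compl.inter h2.compl), h.inter _ _ h1.compl h2.compl, h.compl _ h1,
    h.compl _ h2, h.diff hS hT, h.diff hT hS]

theorem biUnion (h : IsModel d m Φ) {ι : Type} {S : ι → Set (I → Bool)}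
    (hS : ∀ k, MeasurableSet (S k)) (hd : ∀ k l, k ≠ l → m (S k ∩ S l) = 0) (F : Finset ι) :
    Φ (⋃ k ∈ F, S k) = ∑ k ∈ F, Φ (S k) := by
  classical
  induction F using Finset.induction_on with
  | empty => simpa using h.empty
  | insert a F ha ih =>
    rw [Finset.set_biUnion_insert, Finset.sum_insert ha, ← ih]
    have hF : MeasurableSet (⋃ k ∈ F, S k) := F.measurableSet_biUnion fun k _ => hS k
    have h0 : Φ (S a) * Φ (⋃ k ∈ F, S k) = 0 := by
      rw [← h.inter _ _ (hS a) hF, h.eq_zero_iff ((hS a).inter hF), Set.inter_iUnion₂]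
      refine (measure_biUnion_null_iff F.countable_toSet).2 fun k hk => ?_
      exact hd a k (by rintro rfl; exact ha hk)
    have h1 : S a ∪ ⋃ k ∈ F, S k = ((S a)ᶜ ∩ (⋃ k ∈ F, S k)ᶜ)ᶜ := by
      rw [Set.compl_inter, compl_compl, compl_compl]
    rw [h1, h.compl _ ((hS a).compl.inter hF.compl), h.inter _ _ (hS a).compl hF.compl,
      h.compl _ (hS a), h.compl _ hF, mul_sub, mul_one, sub_mul, one_mul, h0]
    abel

/-- A countable partition of the model gives projections with finite partial sums close to `1`. -/
theorem exists_sum_lt (h : IsModel d m Φ) {ι : Type} [Countable ι] {S : ι → Set (I → Bool)}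
    (hS : ∀ k, MeasurableSet (S k)) (hd : ∀ k l, k ≠ l → m (S k ∩ S l) = 0)
    (hc : m (⋃ k, S k)ᶜ = 0) {ε : ℝ} (hε : 0 < ε) :
    ∃ F : Finset ι, twoNorm _ (traceVec Γ μ) ω
      ((1 - ∑ k ∈ F, Φ (S k) : APow Γ μ ω) : MPow Γ μ ω) < ε := by
  obtain ⟨F, hF⟩ := exists_finset_measure_compl_lt hS hc
    (ENNReal.ofReal_pos.2 (show 0 < ε ^ 2 by positivity))
  refine ⟨F, ?_⟩
  have hm : MeasurableSet (⋃ k ∈ F, S k) := F.measurableSet_biUnion fun k _ => hS k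
  rw [← h.biUnion hS hd, ← h.compl _ hm]
  refine lt_of_pow_lt_pow_left₀ 2 hε.le ?_
  rw [h.norm _ hm.compl]
  exact (ENNReal.lt_ofReal_iff_toReal_lt (measure_ne_top _ _)).1 hF

variable [Countable I]

/-- A measurable map `f` which realizes an automorphism `α` on the coordinate sets does so on all
measurable sets. The point is the passage to countable unions: by `IsModel.full`, `Φ(⋃ S_k)` is the
least upper bound of the `Φ(S_k)`, and `α` preserves least upper bounds. -/
theorem map_preimage (h : IsModel d m Φ) {α : APow Γ μ ω ≃⋆ₐ[ℂ] APow Γ μ ω}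
    {f : (I → Bool) → I → Bool} (hf : Measurable f)
    (hα : ∀ i, Φ (f ⁻¹' {x | x i = true}) = α (d i)) (hS : MeasurableSet S) :
    Φ (f ⁻¹' S) = α (Φ S) := by
  suffices H : ∀ S : Set (I → Bool), MeasurableSet[MeasurableSpace.generateFrom
      (Set.range fun i => {x : I → Bool | x i = true})] S →
      MeasurableSet S ∧ Φ (f ⁻¹' S) = α (Φ S) by
    refine (H S ?_).2
    rw [← generateFrom_coord]
    exact hS
  intro S hS
  induction S, hS using MeasurableSpace.generateFrom_induction with
  | hC S hS _ =>
    obtain ⟨i, rfl⟩ := hS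
    exact ⟨measurableSet_coord i, (hα i).trans (congrArg α (h.coord i).symm)⟩
  | empty => exact ⟨.empty, by rw [Set.preimage_empty, h.empty, map_zero]⟩
  | compl S _ hS =>
    refine ⟨hS.1.compl, ?_⟩
    rw [Set.preimage_compl, h.compl _ (hf hS.1), h.compl _ hS.1, hS.2, map_sub, map_one]
  | iUnion S _ hS =>
    have hU : MeasurableSet (⋃ k, S k) := .iUnion fun k => (hS k).1
    refine ⟨hU, ?_⟩
    have hle : ∀ k, Φ (S k) * Φ (⋃ k, S k) = Φ (S k) := fun k => by
      rw [← h.inter _ _ (hS k).1 hU, Set.inter_eq_left.2 (Set.subset_iUnion _ k)]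
    have hle' : ∀ k, Φ (f ⁻¹' S k) * Φ (f ⁻¹' ⋃ k, S k) = Φ (f ⁻¹' S k) := fun k => by
      rw [← h.inter _ _ (hf (hS k).1) (hf hU),
        Set.inter_eq_left.2 (Set.preimage_mono (Set.subset_iUnion _ k))]
    have hfull : ∀ T : ℕ → Set (I → Bool), (∀ k, MeasurableSet (T k)) →
        ∀ x, (∀ k, x * Φ (T k) = 0) → x * (1 - Φ (⋃ k, T k)) = 0 → x = 0 := by
      intro T hT x h1 h2
      refine h.full (fun o : Option ℕ => o.elim (⋃ k, T k)ᶜ T) ?_ ?_ x ?_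
      · rintro (_ | k)
        · exact (MeasurableSet.iUnion hT).compl
        · exact hT k
      · rw [Set.iUnion_option]
        simp only [Option.elim_none, Option.elim_some, Set.compl_union_self, Set.compl_univ,
          measure_empty]
      · rintro (_ | k)
        · exact (congrArg (x * ·) (h.compl _ (MeasurableSet.iUnion hT))).trans h2
        · exact h1 k
    -- `p = Φ(f⁻¹ ⋃ S_k)` and `q = α(Φ(⋃ S_k))` are both the least upper bound of the same family;
    -- `hpq` gives `p ≤ q`, and `hqp` gives `q ≤ p` after applying `α`.
    have hpq : Φ (f ⁻¹' ⋃ k, S k) * (1 - α (Φ (⋃ k, S k))) = 0 := by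
      refine hfull (fun k => f ⁻¹' S k) (fun k => hf (hS k).1) _ (fun k => ?_) ?_
      · rw [mul_assoc, sub_mul, one_mul, (hS k).2, ← map_mul, APow_mul_comm _ (Φ (S k)), hle,
          sub_self, mul_zero]
      · rw [← Set.preimage_iUnion, APow_mul_comm, ← mul_assoc, sub_mul, one_mul,
          h.mul_self (hf hU), sub_self, zero_mul]
    have hqp : Φ (⋃ k, S k) * (1 - α.symm (Φ (f ⁻¹' ⋃ k, S k))) = 0 := by
      refine hfull S (fun k => (hS k).1) _ (fun k => ?_) ?_
      · have : Φ (S k) = α.symm (Φ (f ⁻¹' S k)) := by rw [(hS k).2, α.symm_apply_apply]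
        rw [mul_assoc, sub_mul, one_mul, this, ← map_mul, APow_mul_comm _ (Φ (f ⁻¹' S k)), hle',
          sub_self, mul_zero]
      · rw [APow_mul_comm, ← mul_assoc, sub_mul, one_mul, h.mul_self hU, sub_self, zero_mul]
    have h3 := congrArg α hqp
    rw [map_mul, map_sub, map_one, α.apply_symm_apply, map_zero, mul_sub, mul_one,
      sub_eq_zero] at h3
    rw [mul_sub, mul_one, sub_eq_zero] at hpq
    rw [hpq, APow_mul_comm, ← h3]

end IsModel

end ModelSets

/-! ### Point maps realizing automorphisms of `A^ω` -/

section Realizes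

variable {Γ : Type} [Group Γ] [Countable Γ] [MeasurableSpace Γ] [DiscreteMeasurableSpace Γ]
  {X : Type} [MeasurableSpace X] {μ : Measure X} [IsProbabilityMeasure μ]
  [MulAction Γ X] [MeasurableConstSMul Γ X] [SMulInvariantMeasure Γ X μ] {ω : Ultrafilter ℕ}
  {I : Type} [Countable I] {d : I → APow Γ μ ω} {m : Measure (I → Bool)} [IsProbabilityMeasure m]
  {Φ : Set (I → Bool) → APow Γ μ ω}

/-- The point map `f` realizes the automorphism `α` of `A^ω` on the sets of the model. -/
def Realizes (Φ : Set (I → Bool) → APow Γ μ ω) (f : (I → Bool) → I → Bool)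
    (α : APow Γ μ ω ≃⋆ₐ[ℂ] APow Γ μ ω) : Prop :=
  Measurable f ∧ ∀ S, MeasurableSet S → Φ (f ⁻¹' S) = α (Φ S)

namespace IsModel

/-- An automorphism which permutes the projections `d_i` is realized by a permutation of coordinates. -/
theorem realizes_coord (h : IsModel d m Φ) {α : APow Γ μ ω ≃⋆ₐ[ℂ] APow Γ μ ω} {e : I → I}
    (he : ∀ i, α (d i) = d (e i)) : Realizes Φ (fun x i => x (e i)) α := by
  have hm : Measurable fun (x : I → Bool) i => x (e i) :=
    measurable_pi_iff.2 fun i => measurable_pi_apply _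
  exact ⟨hm, fun S hS => h.map_preimage hm (fun i => (h.coord (e i)).trans (he i).symm) hS⟩

theorem measurePreserving (h : IsModel d m Φ) {f : (I → Bool) → I → Bool}
    {α : APow Γ μ ω ≃⋆ₐ[ℂ] APow Γ μ ω} (hf : Realizes Φ f α)
    (hα : ∀ a, twoNorm _ (traceVec Γ μ) ω (α a : MPow Γ μ ω) =
      twoNorm _ (traceVec Γ μ) ω (a : MPow Γ μ ω)) : MeasurePreserving f m m := by
  refine ⟨hf.1, Measure.ext fun S hS => ?_⟩
  rw [Measure.map_apply hf.1 hS, ← measureReal_eq_measureReal_iff, ← h.norm _ (hf.1 hS),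
    hf.2 S hS, hα, h.norm S hS]

/-- If a full family of the projections `d_k` cuts `γ` into pieces which agree with `γ_i`, then
the realization of `γ` agrees almost everywhere with the realization of some `γ_i`. -/
theorem ae_exists_eq (h : IsModel d m Φ) {ι : Type} [Countable ι] {k : ι → I}
    (hk : Full fun i => d (k i)) {γ : APow Γ μ ω ≃⋆ₐ[ℂ] APow Γ μ ω}
    {γ' : ι → APow Γ μ ω ≃⋆ₐ[ℂ] APow Γ μ ω}
    (hγ : ∀ i y, γ y * d (k i) = γ' i y * d (k i)) {f : (I → Bool) → I → Bool}
    {f' : ι → (I → Bool) → I → Bool} (hf : Realizes Φ f γ) (hf' : ∀ i, Realizes Φ (f' i) (γ' i)) :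
    ∀ᵐ x ∂m, ∃ i, f x = f' i x := by
  have hc := fun i => measurableSet_coord (k i)
  have h1 : ∀ i j, ∀ᵐ x ∂m, x (k i) = true → f x j = f' i x j := by
    intro i j
    have hm := hf.1 (measurableSet_coord j)
    have hm' := (hf' i).1 (measurableSet_coord j)
    have h2 : Φ (f ⁻¹' {x | x j = true} ∩ {x | x (k i) = true}) =
        Φ (f' i ⁻¹' {x | x j = true} ∩ {x | x (k i) = true}) := by
      rw [h.inter _ _ hm (hc i), h.inter _ _ hm' (hc i), hf.2 _ (measurableSet_coord j),
        (hf' i).2 _ (measurableSet_coord j), h.coord, h.coord, hγ]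
    rw [h.eq_iff (hm.inter (hc i)) (hm'.inter (hc i)), measure_symmDiff_eq_zero_iff] at h2
    filter_upwards [h2] with x hx hxk
    have h3 : (f x j = true ∧ x (k i) = true) = (f' i x j = true ∧ x (k i) = true) := hx
    rw [hxk, eq_self, and_true, and_true] at h3
    exact Bool.eq_iff_iff.2 (iff_of_eq h3)
  have h2 : ∀ᵐ x ∂m, ∃ i, x (k i) = true := by
    have hU : MeasurableSet (⋃ i, {x : I → Bool | x (k i) = true}) := .iUnion hc
    have h3 : m (⋃ i, {x : I → Bool | x (k i) = true})ᶜ = 0 := by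
      rw [← h.eq_zero_iff hU.compl]
      refine hk _ fun i => ?_
      beta_reduce
      rw [← h.coord, ← h.inter _ _ hU.compl (hc i)]
      refine Eq.trans (congrArg Φ ?_) h.empty
      exact Set.disjoint_iff_inter_eq_empty.1 (Set.disjoint_compl_left_iff_subset.2
        (Set.subset_iUnion (fun i => {x : I → Bool | x (k i) = true}) i))
    refine (measure_eq_zero_iff_ae_notMem.1 h3).mono fun x hx => ?_
    simpa using hx
  filter_upwards [h2, ae_all_iff.2 fun i => ae_all_iff.2 (h1 i)] with x ⟨i, hi⟩ hx
  exact ⟨i, funext fun j => hx i j hi⟩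

/-- If the projections `d_k (1 - γ(d_k))` form a full family then the realization of `γ` has
no fixed points. -/
theorem ae_ne (h : IsModel d m Φ) {ι : Type} {k : ι → I} {γ : APow Γ μ ω ≃⋆ₐ[ℂ] APow Γ μ ω}
    (hk : Full fun i => d (k i) * (1 - γ (d (k i)))) {f : (I → Bool) → I → Bool}
    (hf : Realizes Φ f γ) : ∀ᵐ x ∂m, f x ≠ x := by
  have hN : MeasurableSet {x | f x = x} := measurableSet_eq_fun hf.1 measurable_id
  refine measure_eq_zero_iff_ae_notMem.1 ((h.eq_zero_iff hN).1 (hk _ fun i => ?_))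
  have hc := measurableSet_coord (k i)
  beta_reduce
  rw [← h.coord, ← hf.2 _ hc, ← h.diff hc (hf.1 hc), ← h.inter _ _ hN (hc.diff (hf.1 hc))]
  refine Eq.trans (congrArg Φ (Set.eq_empty_of_forall_notMem ?_)) h.empty
  rintro x ⟨hx, hx1, hx2⟩
  refine hx2 ?_
  have hx : f x = x := hx
  rw [Set.mem_preimage, hx]
  exact hx1

end IsModel

end Realizes

/-! ### Detecting freeness by countably many projections -/

section FreeFamily

variable {Γ : Type} [Group Γ] [Countable Γ] [MeasurableSpace Γ] [DiscreteMeasurableSpace Γ]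
  {X : Type} [MeasurableSpace X] {μ : Measure X} [IsProbabilityMeasure μ]
  [MulAction Γ X] [MeasurableConstSMul Γ X] [SMulInvariantMeasure Γ X μ] {ω : Ultrafilter ℕ}

/-- A free action on a standard Borel space is detected by countably many projections `a` of
`A ⊂ A^ω`: for every `g ≠ 1` the projections `a (1 - σ_g(a))` form a full family. -/
theorem exists_full_of_isFree [StandardBorelSpace X] (hfree : IsFree Γ μ) (ω : Ultrafilter ℕ) :
    ∃ a : ℕ × Bool → APow Γ μ ω, (∀ i, a i * a i = a i) ∧
      ∀ g : Γ, g ≠ 1 → Full fun i => a i * (1 - ultraAction μ ω g (a i)) := by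
  obtain ⟨e, he, hsep⟩ := exists_seq_separating X (p := MeasurableSet) .empty Set.univ
  -- As complements are included, any `x ≠ y` have `x ∈ A i` and `y ∉ A i` for some `i`.
  set A : ℕ × Bool → Set X := fun i => bif i.2 then e i.1 else (e i.1)ᶜ with hA
  have hAm : ∀ i, MeasurableSet (A i) := by
    rintro ⟨n, _ | _⟩
    · exact (he n).compl
    · exact he n
  refine ⟨fun i => setU Γ μ ω (fun _ => A i) fun _ => hAm i, fun i => setU_mul_self _,
    fun g hg => ?_⟩
  have hgm : ∀ i, MeasurableSet ((fun x => g⁻¹ • x) ⁻¹' A i) := fun i =>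
    measurable_const_smul g⁻¹ (hAm i)
  have hf : (fun i => setU Γ μ ω (fun _ => A i) (fun _ => hAm i) *
      (1 - ultraAction μ ω g (setU Γ μ ω (fun _ => A i) fun _ => hAm i))) =
      fun i => setU Γ μ ω (fun _ => A i \ (fun x => g⁻¹ • x) ⁻¹' A i)
        (fun _ => (hAm i).diff (hgm i)) := by
    funext i
    rw [ultraAction_setU, one_sub_setU, setU_mul]
    rfl
  rw [hf]
  refine full_of_cover (fun i _ => (hAm i).diff (hgm i)) fun ε hε => ?_
  have h0 : μ (⋃ i, A i \ (fun x => g⁻¹ • x) ⁻¹' A i)ᶜ = 0 := by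
    refine measure_eq_zero_iff_ae_notMem.2 (hfree.mono fun x hx => ?_)
    rw [Set.notMem_compl_iff, Set.mem_iUnion]
    by_contra! hcon
    refine hx g⁻¹ (by simpa using hg) (hsep _ trivial _ trivial fun n => ?_)
    have h1 := hcon (n, true)
    have h2 := hcon (n, false)
    simp only [hA, cond_true, cond_false, Set.mem_sdiff, Set.mem_preimage, Set.mem_compl_iff]
      at h1 h2
    tauto
  obtain ⟨F, hF⟩ := exists_finset_measure_compl_lt (fun i => (hAm i).diff (hgm i)) h0 hε
  exact ⟨F, .of_forall fun _ => hF⟩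

end FreeFamily

/-! ### Actions with the same orbits -/

section OrbitEquivalence

variable {Γ : Type} [Group Γ] [Countable Γ] {Λ : Type} [Group Λ] [Countable Λ]
  {K : Type} [MeasurableSpace K] [StandardBorelSpace K] [MulAction Γ K] [MulAction Λ K]
  [MeasurableConstSMul Γ K] [MeasurableConstSMul Λ K] {m : Measure K} [IsProbabilityMeasure m]
  [SMulInvariantMeasure Γ K m] [SMulInvariantMeasure Λ K m]

/-- For an OE-superrigid action of `Γ` which has the same orbits as a free action of `Λ`, there
is `ψ` in the full group of the latter which conjugates the action of `Λ` to that of `Γ`. -/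
theorem OESuperrigid.exists_conjugacy (h : OESuperrigid Γ m) (hΛ : IsFree Λ m)
    (h1 : ∀ g : Γ, ∀ᵐ x ∂m, ∃ k : Λ, g • x = k • x)
    (h2 : ∀ k : Λ, ∀ᵐ x ∂m, ∃ g : Γ, k • x = g • x) :
    ∃ (φ ψ : K → K) (δ : Γ ≃* Λ), MeasurePreserving ψ m m ∧ (∀ᵐ x ∂m, φ (ψ x) = x) ∧
      (∀ᵐ x ∂m, ∃ k : Λ, ψ x = k⁻¹ • x) ∧ ∀ g : Γ, ∀ᵐ x ∂m, ψ (δ g • x) = g • ψ x := by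
  -- Superrigidity, applied to the identity map, gives `φ`; the map `ψ` is its inverse.
  have hOE : IsOE Γ Λ m m (id : K → K) := by
    refine ⟨⟨.id m, id, .id m, .of_forall fun _ => rfl, .of_forall fun _ => rfl⟩, ?_⟩
    filter_upwards [ae_all_iff.2 h1, ae_all_iff.2 h2] with x hx1 hx2
    rw [Set.image_id]
    refine Set.Subset.antisymm ?_ ?_
    · rintro _ ⟨g, rfl⟩
      obtain ⟨k, hk⟩ := hx1 g
      exact ⟨k, hk.symm⟩
    · rintro _ ⟨k, rfl⟩
      obtain ⟨g, hg⟩ := hx2 k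
      exact ⟨g, hg.symm⟩
  obtain ⟨φ, ⟨⟨hφ, ψ, hψ, hψφ, hφψ⟩, horb⟩, δ, hδ⟩ := h Λ K m hΛ id hOE
  refine ⟨φ, ψ, δ, hψ, hφψ, ?_, fun g => ?_⟩
  · filter_upwards [hφψ, hψ.quasiMeasurePreserving.ae horb] with x hx ⟨k, hk⟩
    refine ⟨k, ?_⟩
    rw [hx] at hk
    rw [← inv_smul_eq_iff.2 hk.symm]
  · have hg := ((measurePreserving_smul g m).comp hψ).quasiMeasurePreserving
    filter_upwards [hφψ, hψ.quasiMeasurePreserving.ae (hδ g), hg.ae hψφ] with x hx1 hx2 hx3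
    have hx2 : φ (g • ψ x) = δ g • φ (ψ x) := hx2
    have hx3 : ψ (φ (g • ψ x)) = g • ψ x := hx3
    rwa [hx2, hx1] at hx3

end OrbitEquivalence

/-! ### `ω`-orbit equivalences and their point realizations -/

section Theta

variable {Γ : Type} [Group Γ] [Countable Γ] [MeasurableSpace Γ] [DiscreteMeasurableSpace Γ]
  {X : Type} [MeasurableSpace X] {μ : Measure X} [IsProbabilityMeasure μ]
  [MulAction Γ X] [MeasurableConstSMul Γ X] [SMulInvariantMeasure Γ X μ]
  {Λ : Type} [Group Λ] [Countable Λ] [MeasurableSpace Λ] [DiscreteMeasurableSpace Λ]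
  {Y : Type} [MeasurableSpace Y] {ν : Measure Y} [IsProbabilityMeasure ν]
  [MulAction Λ Y] [MeasurableConstSMul Λ Y] [SMulInvariantMeasure Λ Y ν] {ω : Ultrafilter ℕ}
  {θ : APow Γ μ ω ≃⋆ₐ[ℂ] APow Λ ν ω}

theorem tendsto_measureReal_setU {E : ℕ → Set X} (hE : ∀ n, MeasurableSet (E n)) :
    Tendsto (fun n => μ.real (E n)) ω
      (𝓝 (twoNorm _ (traceVec Γ μ) ω (setU Γ μ ω E hE : MPow Γ μ ω) ^ 2)) := by
  have h := (ENNReal.tendsto_toReal (by finiteness)).comp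
    (tendsto_measure_setU (Γ := Γ) (μ := μ) (ω := ω) hE)
  rwa [ENNReal.toReal_pow, ENNReal.toReal_ofReal (twoNorm_nonneg _)] at h

theorem setU_symmDiff {E F : ℕ → Set X} (hE : ∀ n, MeasurableSet (E n))
    (hF : ∀ n, MeasurableSet (F n)) :
    setU Γ μ ω (fun n => symmDiff (E n) (F n)) (fun n => (hE n).symmDiff (hF n)) =
      1 - (1 - setU Γ μ ω E hE * (1 - setU Γ μ ω F hF)) *
        (1 - setU Γ μ ω F hF * (1 - setU Γ μ ω E hE)) := by
  simp only [one_sub_setU, setU_mul]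
  refine setU_congr _ (funext fun n => ?_)
  rw [Set.symmDiff_def, Set.compl_inter, compl_compl, compl_compl, Set.sdiff_eq, Set.sdiff_eq]

theorem ImplementsOmegaOE.symm (h : ImplementsOmegaOE μ ν θ) : ImplementsOmegaOE ν μ θ.symm := by
  obtain ⟨Θ, hΘ, hΘθ⟩ := h
  refine ⟨Θ.symm, fun x => ?_, fun b => ?_⟩
  · rw [← hΘ, StarAlgEquiv.apply_symm_apply]
  · have h1 := hΘθ (θ.symm b)
    rw [StarAlgEquiv.apply_symm_apply] at h1
    have h2 : Θ ⟨θ.symm b, subUltrapower_le_cartanUltrapower _ _ ω _ (θ.symm b).2⟩ =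
        ⟨b, subUltrapower_le_cartanUltrapower _ _ ω _ b.2⟩ := Subtype.ext h1
    rw [← h2, StarAlgEquiv.symm_apply_apply]

theorem ImplementsOmegaOE.utrace_eq (h : ImplementsOmegaOE μ ν θ) (a : APow Γ μ ω) :
    utrace _ (traceVec Λ ν) ω (θ a : MPow Λ ν ω) =
      utrace _ (traceVec Γ μ) ω (a : MPow Γ μ ω) := by
  obtain ⟨Θ, hΘ, hΘθ⟩ := h
  rw [← hΘθ, hΘ]

theorem ImplementsOmegaOE.twoNorm_eq (h : ImplementsOmegaOE μ ν θ) (a : APow Γ μ ω) :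
    twoNorm _ (traceVec Λ ν) ω (θ a : MPow Λ ν ω) =
      twoNorm _ (traceVec Γ μ) ω (a : MPow Γ μ ω) := by
  have h1 := h.utrace_eq (star a * a)
  rw [map_mul, map_star] at h1
  exact congrArg (fun z : ℂ => Real.sqrt z.re) h1

variable (θ) in
/-- The automorphisms `θ σ^ω_g θ⁻¹` of `B^ω`. -/
def conjAction (g : Γ) : APow Λ ν ω ≃⋆ₐ[ℂ] APow Λ ν ω :=
  (θ.symm.trans (ultraAction μ ω g)).trans θ

theorem conjAction_apply (g : Γ) (b : APow Λ ν ω) :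
    conjAction θ g b = θ (ultraAction μ ω g (θ.symm b)) := rfl

/-- The image of `u_g` under the extension of `θ` to `M(ω) ≃ N(ω)`. -/
theorem ImplementsOmegaOE.exists_normalizer (h : ImplementsOmegaOE μ ν θ) (g : Γ) :
    ∃ (w : unitary (MPow Λ ν ω)) (hw : w ∈ normalizer (APow Λ ν ω)),
      (w : MPow Λ ν ω) ∈ MOmega Λ ν ω ∧ ∀ b, Ad w hw b = conjAction θ g b := by
  obtain ⟨Θ, hΘ, hΘθ⟩ := h
  set U : Γ → MOmega Γ μ ω := fun k => ⟨uU μ ω k, uU_mem_MOmega k⟩ with hU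
  have hUs : ∀ k, star (U k) = U k⁻¹ := fun k => Subtype.ext
    (congrArg (Subtype.val : unitary (MPow Γ μ ω) → MPow Γ μ ω) (uU_inv k).symm)
  have hUm : ∀ k, U k⁻¹ * U k = 1 := fun k => by
    rw [← hUs]
    exact Subtype.ext (Unitary.coe_star_mul_self (uU μ ω k))
  have hconj : ∀ (k : Γ) (b : APow Λ ν ω), (Θ (U k) : MPow Λ ν ω) * b * (Θ (U k⁻¹) : MPow Λ ν ω) =
      conjAction θ k b := by
    intro k b
    have h1 : (b : MPow Λ ν ω) = Θ ⟨θ.symm b, subUltrapower_le_cartanUltrapower _ _ ω _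
        (θ.symm b).2⟩ := by rw [hΘθ, StarAlgEquiv.apply_symm_apply]
    have h2 : U k * ⟨θ.symm b, subUltrapower_le_cartanUltrapower _ _ ω _ (θ.symm b).2⟩ * U k⁻¹ =
        ⟨ultraAction μ ω k (θ.symm b), subUltrapower_le_cartanUltrapower _ _ ω _
          (ultraAction μ ω k (θ.symm b)).2⟩ := by
      rw [← hUs]
      exact Subtype.ext (coe_ultraAction k (θ.symm b)).symm
    rw [conjAction_apply, ← hΘθ, ← h2, map_mul, map_mul, h1]
    rfl
  have hs : ∀ k, star (Θ (U k) : MPow Λ ν ω) = (Θ (U k⁻¹) : MPow Λ ν ω) := fun k => by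
    rw [← hUs, map_star]
    rfl
  have hm : ∀ k, (Θ (U k⁻¹) : MPow Λ ν ω) * (Θ (U k) : MPow Λ ν ω) = 1 := fun k => by
    have h1 : Θ (U k⁻¹) * Θ (U k) = 1 := by rw [← map_mul, hUm, map_one]
    exact congrArg Subtype.val h1
  set w : unitary (MPow Λ ν ω) := ⟨Θ (U g), by
    rw [Unitary.mem_iff, hs]
    refine ⟨hm g, ?_⟩
    have := hm g⁻¹
    rwa [inv_inv] at this⟩ with hwdef
  have hw : w ∈ normalizer (APow Λ ν ω) := by
    refine mem_normalizer_of_conj (fun b hb => ?_) fun b hb => ?_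
    · have := hconj g ⟨b, hb⟩
      rw [← hs] at this
      exact this ▸ (conjAction θ g ⟨b, hb⟩).2
    · have := hconj g⁻¹ ⟨b, hb⟩
      rw [inv_inv, ← hs] at this
      exact this ▸ (conjAction θ g⁻¹ ⟨b, hb⟩).2
  refine ⟨w, hw, (Θ (U g)).2, fun b => Subtype.ext ?_⟩
  rw [coe_Ad, ← hconj, ← hs]

/-- Strong ergodicity of `Γ ↷ X` passes to the models of countable families of projections of
`B^ω`, by lifting asymptotically invariant sequences. -/
theorem IsModel.stronglyErgodic {I : Type} {d : I → APow Λ ν ω}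
    {m : Measure (I → Bool)} [IsProbabilityMeasure m] {Φ : Set (I → Bool) → APow Λ ν ω}
    (hM : IsModel d m Φ) (hθ : ImplementsOmegaOE μ ν θ) (hse : StronglyErgodic Γ μ)
    [MulAction Γ (I → Bool)] [MeasurableConstSMul Γ (I → Bool)]
    (hact : ∀ (g : Γ) S, MeasurableSet S → Φ ((fun x => g • x) ⁻¹' S) = conjAction θ g⁻¹ (Φ S)) :
    StronglyErgodic Γ m := by
  intro S hS hinv
  have hlift : ∀ j, ∃ (E : ℕ → Set X) (hE : ∀ n, MeasurableSet (E n)),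
      θ.symm (Φ (S j)) = setU Γ μ ω E hE := fun j =>
    exists_setU_of_mul_self (by rw [← map_mul, hM.mul_self (hS j)])
  choose E hE hES using hlift
  have hgS : ∀ (g : Γ) j, MeasurableSet ((fun x => g • x) ⁻¹' S j) := fun g j =>
    measurable_const_smul g (hS j)
  have hgE : ∀ (g : Γ) j n, MeasurableSet ((fun x => g • x) ⁻¹' E j n) := fun g j n =>
    measurable_const_smul g (hE j n)
  have hlim1 : ∀ j, Tendsto (fun n => μ.real (E j n)) ω (𝓝 (m.real (S j))) := by
    intro j
    have := tendsto_measureReal_setU (Γ := Γ) (μ := μ) (ω := ω) (hE j)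
    rwa [← hES, hθ.symm.twoNorm_eq, hM.norm _ (hS j)] at this
  have hlim2 : ∀ (g : Γ) j, Tendsto (fun n => μ.real (symmDiff ((fun x => g • x) ⁻¹' E j n) (E j n)))
      ω (𝓝 (m.real (symmDiff ((fun x => g • x) ⁻¹' S j) (S j)))) := by
    intro g j
    have h1 := tendsto_measureReal_setU (Γ := Γ) (μ := μ) (ω := ω)
      fun n => (hgE g j n).symmDiff (hE j n)
    have h2 : setU Γ μ ω (fun n => (fun x => g • x) ⁻¹' E j n) (fun n => hgE g j n) =
        θ.symm (Φ ((fun x => g • x) ⁻¹' S j)) := by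
      rw [hact g _ (hS j), conjAction_apply, StarAlgEquiv.symm_apply_apply, hES, ultraAction_setU]
      exact setU_congr _ (funext fun n => by rw [inv_inv])
    rw [setU_symmDiff (fun n => hgE g j n) (hE j), h2, ← hES, ← map_one θ.symm] at h1
    simp only [← map_sub, ← map_mul] at h1
    rwa [← hM.map_symmDiff (hgS g j) (hS j), hθ.symm.twoNorm_eq,
      hM.norm _ ((hgS g j).symmDiff (hS j))] at h1
  obtain ⟨e, he⟩ := exists_surjective_nat Γ
  -- Diagonal choice: the set `E j (n j)` has nearly the measure of `S j` and is moved by the first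
  -- `j + 1` group elements nearly as much as `S j`.
  have hpick : ∀ j : ℕ, ∃ n, |μ.real (E j n) - m.real (S j)| < 1 / ((j : ℝ) + 1) ∧
      ∀ k ∈ Finset.range (j + 1), |μ.real (symmDiff ((fun x => e k • x) ⁻¹' E j n) (E j n)) -
        m.real (symmDiff ((fun x => e k • x) ⁻¹' S j) (S j))| < 1 / ((j : ℝ) + 1) := by
    intro j
    have hpos : (0 : ℝ) < 1 / ((j : ℝ) + 1) := by positivity
    have h1 := Metric.tendsto_nhds.1 (hlim1 j) _ hpos
    have h2 := (eventually_all_finset (Finset.range (j + 1))).2 fun k _ =>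
      Metric.tendsto_nhds.1 (hlim2 (e k) j) _ hpos
    exact (h1.and h2).exists
  choose n hn1 hn2 using hpick
  have hz := tendsto_one_div_add_atTop_nhds_zero_nat (𝕜 := ℝ)
  have hFinv : ∀ g : Γ, Tendsto (fun j => μ (symmDiff ((fun x => g • x) ⁻¹' E j (n j)) (E j (n j))))
      atTop (𝓝 0) := by
    intro g
    obtain ⟨k, rfl⟩ := he g
    rw [← ENNReal.tendsto_toReal_iff (fun _ => measure_ne_top _ _) ENNReal.zero_ne_top]
    have h1 := (ENNReal.tendsto_toReal ENNReal.zero_ne_top).comp (hinv (e k))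
    have h2 := h1.add hz
    rw [ENNReal.toReal_zero, add_zero] at h2
    refine tendsto_of_tendsto_of_tendsto_of_le_of_le' tendsto_const_nhds h2
      (.of_forall fun _ => ENNReal.toReal_nonneg) ?_
    filter_upwards [eventually_ge_atTop k] with j hj
    have h3 := (abs_lt.1 (hn2 j k (Finset.mem_range.2 (Nat.lt_succ_of_le hj)))).2
    simp only [measureReal_def] at h3
    simp only [Function.comp_apply]
    linarith
  have hprod := hse (fun j => E j (n j)) (fun j => hE j (n j)) hFinv
  rw [← ENNReal.tendsto_toReal_iff (fun _ => by finiteness) ENNReal.zero_ne_top] at hprod ⊢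
  rw [ENNReal.toReal_zero] at hprod ⊢
  have h2 := hprod.add hz
  rw [add_zero] at h2
  refine squeeze_zero (fun _ => ENNReal.toReal_nonneg) (fun j => ?_) h2
  have hc1 : μ.real (E j (n j))ᶜ = 1 - μ.real (E j (n j)) := probReal_compl_eq_one_sub (hE j (n j))
  have hc2 : m.real (S j)ᶜ = 1 - m.real (S j) := probReal_compl_eq_one_sub (hS j)
  rw [ENNReal.toReal_mul, ENNReal.toReal_mul]
  change m.real (S j) * m.real (S j)ᶜ ≤ μ.real (E j (n j)) * μ.real (E j (n j))ᶜ + _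
  rw [hc1, hc2]
  have h3 := abs_lt.1 (hn1 j)
  have h4 : μ.real (E j (n j)) ≤ 1 := measureReal_le_one
  have h5 : m.real (S j) ≤ 1 := measureReal_le_one
  have h6 : 0 ≤ μ.real (E j (n j)) := measureReal_nonneg
  have h7 : 0 ≤ m.real (S j) := measureReal_nonneg
  set f := μ.real (E j (n j))
  set s := m.real (S j)
  -- `s (1 - s) - f (1 - f) = (s - f) (1 - s - f)` is at most `|s - f|` for `s, f ∈ [0, 1]`.
  have h8 : |(s - f) * (1 - s - f)| ≤ |f - s| * 1 := by
    rw [abs_mul, abs_sub_comm]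
    exact mul_le_mul_of_nonneg_left (abs_le.2 ⟨by linarith, by linarith⟩) (abs_nonneg _)
  have h9 := le_abs_self ((s - f) * (1 - s - f))
  have h10 := hn1 j
  nlinarith

end Theta

/-! ### Families invariant under two groups -/

/-- Two groups acting on `P` and preserving `Q` give an action of their free product. -/
theorem exists_coprod_lift {Γ Λ P : Type} [Group Γ] [Group Λ]
    (Q : P → Prop) (f : Γ → P → P) (k : Λ → P → P) (hf1 : ∀ p, f 1 p = p)
    (hf : ∀ a b p, f (a * b) p = f a (f b p)) (hk1 : ∀ p, k 1 p = p)
    (hk : ∀ a b p, k (a * b) p = k a (k b p)) (hfQ : ∀ a p, Q p → Q (f a p))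
    (hkQ : ∀ a p, Q p → Q (k a p)) :
    ∃ L : Monoid.Coprod Γ Λ →* Function.End P, (∀ a, L (Monoid.Coprod.inl a) = f a) ∧
      (∀ a, L (Monoid.Coprod.inr a) = k a) ∧ ∀ w p, Q p → Q (L w p) := by
  obtain ⟨F, hF⟩ : ∃ F : Γ →* Function.End P, ∀ a, F a = f a :=
    ⟨⟨⟨f, funext hf1⟩, fun a b => funext (hf a b)⟩, fun a => rfl⟩
  obtain ⟨G, hG⟩ : ∃ F : Λ →* Function.End P, ∀ a, F a = k a :=
    ⟨⟨⟨k, funext hk1⟩, fun a b => funext (hk a b)⟩, fun a => rfl⟩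
  refine ⟨Monoid.Coprod.lift F G, fun a => ?_, fun a => ?_, fun w => ?_⟩
  · rw [Monoid.Coprod.lift_apply_inl, hF]
  · rw [Monoid.Coprod.lift_apply_inr, hG]
  · induction w using Monoid.Coprod.induction_on with
    | inl a => exact fun p hp => by rw [Monoid.Coprod.lift_apply_inl, hF]; exact hfQ a p hp
    | inr a => exact fun p hp => by rw [Monoid.Coprod.lift_apply_inr, hG]; exact hkQ a p hp
    | mul v w hv hw => exact fun p hp => by rw [map_mul]; exact hv _ (hw p hp)

instance countable_coprod {Γ Λ : Type} [Group Γ] [Group Λ] [Countable Γ] [Countable Λ] :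
    Countable (Monoid.Coprod Γ Λ) := Monoid.Coprod.mk_surjective.countable

/-- The action of `Γ` on `J × W` by left translations of the second factor, along `i : Γ → W`. -/
abbrev leftTranslation {Γ W : Type} [Monoid Γ] [Monoid W] (i : Γ →* W) (J : Type) :
    MulAction Γ (J × W) where
  smul a x := (x.1, i a * x.2)
  one_smul x := Prod.ext rfl ((congrArg (· * x.2) (map_one i)).trans (one_mul _))
  mul_smul a b x := Prod.ext rfl ((congrArg (· * x.2) (map_mul i a b)).trans (mul_assoc _ _ _))

/-- A countable family of elements of a set on which two countable groups act is contained in a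
countable family which is invariant under both actions. It is indexed by pairs `(j, w)` with `w` in
the free product of the groups, so that the two groups act on the index set. -/
theorem exists_saturation {Γ Λ P J : Type} [Group Γ] [Group Λ] [Countable Γ] [Countable Λ]
    [Countable J] (Q : P → Prop) (f : Γ → P → P) (k : Λ → P → P) (hf1 : ∀ p, f 1 p = p)
    (hf : ∀ a b p, f (a * b) p = f a (f b p)) (hk1 : ∀ p, k 1 p = p)
    (hk : ∀ a b p, k (a * b) p = k a (k b p)) (hfQ : ∀ a p, Q p → Q (f a p))
    (hkQ : ∀ a p, Q p → Q (k a p)) (s : J → P) (hs : ∀ j, Q (s j)) :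
    ∃ (I : Type) (_ : Countable I) (_ : MulAction Γ I) (_ : MulAction Λ I) (e : J → I) (d : I → P),
      (∀ j, d (e j) = s j) ∧ (∀ (a : Γ) i, d (a • i) = f a (d i)) ∧
      (∀ (a : Λ) i, d (a • i) = k a (d i)) ∧ ∀ i, Q (d i) := by
  obtain ⟨L, hl, hr, hQ⟩ := exists_coprod_lift Q f k hf1 hf hk1 hk hfQ hkQ
  refine ⟨J × Monoid.Coprod Γ Λ, inferInstance, leftTranslation Monoid.Coprod.inl J,
    leftTranslation Monoid.Coprod.inr J,
    fun j => (j, 1), fun i => L i.2 (s i.1), fun j => ?_, fun a i => ?_, fun a i => ?_,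
    fun i => hQ _ _ (hs _)⟩
  · exact congrArg (fun F : Function.End P => F (s j)) (map_one L)
  · rw [← hl]
    exact congrArg (fun F : Function.End P => F (s i.1)) (map_mul L _ _)
  · rw [← hr]
    exact congrArg (fun F : Function.End P => F (s i.1)) (map_mul L _ _)

/-! ### Projections coding an `ω`-orbit equivalence -/

section Coding

variable {Γ : Type} [Group Γ] [Countable Γ] [MeasurableSpace Γ] [DiscreteMeasurableSpace Γ]
  {X : Type} [MeasurableSpace X] {μ : Measure X} [IsProbabilityMeasure μ]
  [MulAction Γ X] [MeasurableConstSMul Γ X] [SMulInvariantMeasure Γ X μ]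
  {Λ : Type} [Group Λ] [Countable Λ] [MeasurableSpace Λ] [DiscreteMeasurableSpace Λ]
  {Y : Type} [MeasurableSpace Y] {ν : Measure Y} [IsProbabilityMeasure ν]
  [MulAction Λ Y] [MeasurableConstSMul Λ Y] [SMulInvariantMeasure Λ Y ν] {ω : Ultrafilter ℕ}
  {θ : APow Γ μ ω ≃⋆ₐ[ℂ] APow Λ ν ω}

/-- A family of projections of `B^ω` which is invariant under the actions `θ σ^ω θ⁻¹` of `Γ` and
`ρ^ω` of `Λ`, is large enough to witness that these actions are free, and contains the pieces on
which an automorphism of the one action is given by automorphisms of the other action. -/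
structure IsCoding {I : Type} [MulAction Γ I] [MulAction Λ I]
    (θ : APow Γ μ ω ≃⋆ₐ[ℂ] APow Λ ν ω) (d : I → APow Λ ν ω) : Prop where
  mul_self : ∀ i, d i * d i = d i
  map_left : ∀ (g : Γ) i, conjAction θ g (d i) = d (g • i)
  map_right : ∀ (h : Λ) i, ultraAction ν ω h (d i) = d (h • i)
  free_left : ∃ k : ℕ × Bool → I, ∀ g : Γ, g ≠ 1 →
    Full fun i => d (k i) * (1 - conjAction θ g (d (k i)))
  free_right : ∃ k : ℕ × Bool → I, ∀ h : Λ, h ≠ 1 →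
    Full fun i => d (k i) * (1 - ultraAction ν ω h (d (k i)))
  orbit_left : ∀ g : Γ, ∃ k : Λ × ℕ → I, (Full fun i => d (k i)) ∧
    ∀ i y, conjAction θ g y * d (k i) = ultraAction ν ω i.1 y * d (k i)
  orbit_right : ∀ h : Λ, ∃ k : Γ × ℕ → I, (Full fun i => d (k i)) ∧
    ∀ i y, ultraAction ν ω h y * d (k i) = conjAction θ i.1 y * d (k i)

theorem Full.map {ι : Type} {t : ι → APow Γ μ ω} (ht : Full t)
    (θ : APow Γ μ ω ≃⋆ₐ[ℂ] APow Λ ν ω) : Full fun i => θ (t i) := by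
  intro x hx
  have h : θ.symm x = 0 := ht _ fun i => by
    have h1 := congrArg θ.symm (hx i)
    beta_reduce at h1
    rwa [map_mul, StarAlgEquiv.symm_apply_apply, map_zero] at h1
  rw [← θ.apply_symm_apply x, h, map_zero]

theorem conjAction_one (b : APow Λ ν ω) : conjAction θ 1 b = b := by
  rw [conjAction_apply, ultraAction_one, StarAlgEquiv.apply_symm_apply]

theorem conjAction_mul (g h : Γ) (b : APow Λ ν ω) :
    conjAction θ (g * h) b = conjAction θ g (conjAction θ h b) := by
  rw [conjAction_apply, conjAction_apply, conjAction_apply, ultraAction_mul,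
    StarAlgEquiv.symm_apply_apply]

/-- The action `θ σ^ω θ⁻¹` is piecewise given by `ρ^ω`. -/
theorem ImplementsOmegaOE.exists_orbit_left (hθ : ImplementsOmegaOE μ ν θ) (g : Γ) :
    ∃ r : Λ × ℕ → APow Λ ν ω, Full r ∧ (∀ i, r i * r i = r i) ∧
      ∀ i y, conjAction θ g y * r i = ultraAction ν ω i.1 y * r i := by
  obtain ⟨w, hw, hw', hAd⟩ := hθ.exists_normalizer g
  obtain ⟨r, h1, h2, h3⟩ := exists_piecewise_ultraAction hw hw'
  exact ⟨r, h1, h2, fun i y => by rw [← hAd, h3]⟩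

/-- The action `ρ^ω` is piecewise given by `θ σ^ω θ⁻¹`. -/
theorem ImplementsOmegaOE.exists_orbit_right (hθ : ImplementsOmegaOE μ ν θ) (h : Λ) :
    ∃ s : Γ × ℕ → APow Λ ν ω, Full s ∧ (∀ i, s i * s i = s i) ∧
      ∀ i y, ultraAction ν ω h y * s i = conjAction θ i.1 y * s i := by
  obtain ⟨r, h1, h2, h3⟩ := hθ.symm.exists_orbit_left h
  refine ⟨fun i => θ (r i), h1.map θ, fun i => by rw [← map_mul, h2], fun i y => ?_⟩
  have h4 := congrArg θ (h3 i (θ.symm y))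
  rw [map_mul, map_mul, conjAction_apply, StarAlgEquiv.apply_symm_apply] at h4
  have h5 : θ.symm.symm (θ.symm y) = y := θ.apply_symm_apply y
  rwa [h5] at h4

/-- A coding family exists: take the projections witnessing freeness of both actions and the pieces of
both orbit decompositions, which are countably many, and saturate. -/
theorem ImplementsOmegaOE.exists_isCoding [StandardBorelSpace X] [StandardBorelSpace Y]
    (hθ : ImplementsOmegaOE μ ν θ) (hΓ : IsFree Γ μ) (hΛ : IsFree Λ ν) :
    ∃ (I : Type) (_ : Countable I) (_ : MulAction Γ I) (_ : MulAction Λ I) (d : I → APow Λ ν ω),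
      IsCoding θ d := by
  obtain ⟨aX, haX, hfX⟩ := exists_full_of_isFree hΓ ω
  obtain ⟨aY, haY, hfY⟩ := exists_full_of_isFree hΛ ω
  choose r hr1 hr2 hr3 using hθ.exists_orbit_left
  choose s hs1 hs2 hs3 using hθ.exists_orbit_right
  obtain ⟨I, hI, aΓ, aΛ, e, d, he, hd1, hd2, hQ⟩ := exists_saturation
    (J := (ℕ × Bool) ⊕ (ℕ × Bool) ⊕ (Γ × Λ × ℕ) ⊕ (Λ × Γ × ℕ))
    (fun p : APow Λ ν ω => p * p = p)
    (fun (g : Γ) p => conjAction θ g p) (fun (h : Λ) p => ultraAction ν ω h p)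
    conjAction_one conjAction_mul ultraAction_one ultraAction_mul
    (fun g p hp => by rw [← map_mul, hp]) (fun h p hp => by rw [← map_mul, hp])
    (Sum.elim (fun i => θ (aX i)) (Sum.elim aY
      (Sum.elim (fun i => r i.1 i.2) (fun i => s i.1 i.2)))) (by
      rintro (i | i | i | i)
      · exact (map_mul θ _ _).symm.trans (congrArg θ (haX i))
      · exact haY i
      · exact hr2 i.1 i.2
      · exact hs2 i.1 i.2)
  refine ⟨I, hI, aΓ, aΛ, d, hQ, fun g i => (hd1 g i).symm, fun h i => (hd2 h i).symm,
    ⟨fun i => e (Sum.inl i), fun g hg => ?_⟩,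
    ⟨fun i => e (Sum.inr (Sum.inl i)), fun h hh => ?_⟩,
    fun g => ⟨fun i => e (Sum.inr (Sum.inr (Sum.inl (g, i)))), ?_, fun i y => ?_⟩,
    fun h => ⟨fun i => e (Sum.inr (Sum.inr (Sum.inr (h, i)))), ?_, fun i y => ?_⟩⟩
  · have h2 := (hfX g hg).map θ
    refine fun x hx => h2 x fun i => ?_
    have h3 := hx i
    simp only [he, Sum.elim_inl, conjAction_apply, StarAlgEquiv.symm_apply_apply] at h3
    beta_reduce
    rwa [map_mul, map_sub, map_one]
  · simp only [he]
    exact hfY h hh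
  · simp only [he]
    exact hr1 g
  · simp only [he]
    exact hr3 g i y
  · simp only [he]
    exact hs1 h
  · simp only [he]
    exact hs3 h i y

end Coding

/-! ### Conjugating unitaries -/

section Rigidity

variable {Γ : Type} [Group Γ] [Countable Γ] [MeasurableSpace Γ] [DiscreteMeasurableSpace Γ]
  {X : Type} [MeasurableSpace X] {μ : Measure X} [IsProbabilityMeasure μ]
  [MulAction Γ X] [MeasurableConstSMul Γ X] [SMulInvariantMeasure Γ X μ]
  {Λ : Type} [Group Λ] [Countable Λ] [MeasurableSpace Λ] [DiscreteMeasurableSpace Λ]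
  {Y : Type} [MeasurableSpace Y] {ν : Measure Y} [IsProbabilityMeasure ν]
  [MulAction Λ Y] [MeasurableConstSMul Λ Y] [SMulInvariantMeasure Λ Y ν] {ω : Ultrafilter ℕ}
  {θ : APow Γ μ ω ≃⋆ₐ[ℂ] APow Λ ν ω}
  {I : Type} [Countable I] {m : Measure (I → Bool)} [IsProbabilityMeasure m]
  {d : I → APow Λ ν ω} {Φ : Set (I → Bool) → APow Λ ν ω}

theorem twoNorm_Ad {u : unitary (MPow Λ ν ω)} (hu : u ∈ normalizer (APow Λ ν ω)) (b : APow Λ ν ω) :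
    twoNorm _ (traceVec Λ ν) ω (Ad u hu b : MPow Λ ν ω) =
      twoNorm _ (traceVec Λ ν) ω (b : MPow Λ ν ω) := by
  rw [coe_Ad, ← Unitary.coe_star, twoNorm_mul_unitary, twoNorm_unitary_mul]

theorem star_eq_self_of_mul_self {t : APow Λ ν ω} (ht : t * t = t) : star t = t := by
  obtain ⟨E, hE, rfl⟩ := exists_setU_of_mul_self ht
  exact star_setU hE

theorem Ad_star {u : unitary (MPow Λ ν ω)} (hu : u ∈ normalizer (APow Λ ν ω)) (b : APow Λ ν ω) :
    Ad (star u) (star_mem_normalizer hu) b = (Ad u hu).symm b := by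
  refine Subtype.ext ?_
  change _ = (Unitary.conjStarAlgAut ℂ (MPow Λ ν ω) u).symm (b : MPow Λ ν ω)
  rw [Unitary.conjStarAlgAut_symm_apply, coe_Ad, Unitary.coe_star, star_star]

/-- `Ad(u)` agrees with `Ad(v)` under a projection `t` with `t u = t v`. -/
theorem Ad_mul_eq {u v : unitary (MPow Λ ν ω)} (hu : u ∈ normalizer (APow Λ ν ω))
    (hv : v ∈ normalizer (APow Λ ν ω)) {t : APow Λ ν ω} (ht : t * t = t)
    (h : (t : MPow Λ ν ω) * u = (t : MPow Λ ν ω) * v) (b : APow Λ ν ω) :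
    Ad u hu b * t = Ad v hv b * t := by
  have hs : star (t : MPow Λ ν ω) = t := congrArg Subtype.val (star_eq_self_of_mul_self ht)
  have h' : star (u : MPow Λ ν ω) * t = star (v : MPow Λ ν ω) * t := by
    have := congrArg star h
    rwa [star_mul, star_mul, hs] at this
  have key : ∀ (w : unitary (MPow Λ ν ω)) (hw : w ∈ normalizer (APow Λ ν ω)),
      ((Ad w hw b * t : APow Λ ν ω) : MPow Λ ν ω) =
        ((t : MPow Λ ν ω) * w) * b * (star (w : MPow Λ ν ω) * t) := by
    intro w hw
    have h1 : Ad w hw b * t = t * Ad w hw b * t := by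
      rw [APow_mul_comm t, mul_assoc, ht]
    rw [h1]
    change (t : MPow Λ ν ω) * (w * b * star (w : MPow Λ ν ω)) * t = _
    simp only [mul_assoc]
  exact Subtype.ext (by rw [key, key, h, h'])

/-- An automorphism `Ad(z)`, `z ∈ N_{N(ω)}(B^ω)`, which fixes a family of projections witnessing
that the action is free is trivial. -/
theorem Ad_eq_self {z : unitary (MPow Λ ν ω)} (hz : z ∈ normalizer (APow Λ ν ω))
    (hz' : (z : MPow Λ ν ω) ∈ MOmega Λ ν ω) {ι : Type} {a : ι → APow Λ ν ω}
    (ha : ∀ i, a i * a i = a i)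
    (hfull : ∀ h : Λ, h ≠ 1 → Full fun i => a i * (1 - ultraAction ν ω h (a i)))
    (hfix : ∀ i, Ad z hz (a i) = a i) (b : APow Λ ν ω) : Ad z hz b = b := by
  -- On the `h`-th piece `ρ^ω_h` fixes the projections `a i`, which forces this piece to be zero
  -- unless `h = 1`.
  obtain ⟨r, hr, -, hr3⟩ := exists_piecewise_ultraAction hz hz'
  rw [← sub_eq_zero]
  refine hr _ fun ⟨h, n⟩ => ?_
  by_cases hh : h = 1
  · rw [sub_mul, hr3, hh, ultraAction_one, sub_self]
  · have h0 : r (h, n) = 0 := by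
      refine hfull h hh _ fun i => ?_
      have h1 := hr3 (h, n) (a i)
      rw [hfix] at h1
      rw [APow_mul_comm, mul_assoc, sub_mul, one_mul, ← h1, mul_sub, ← mul_assoc, ha, sub_self]
    rw [h0, mul_zero]

-- A group acting on `I` acts on `{0,1}^I` by `(g • x)_i = x_{g⁻¹ i}`. The preimage under `g` of the
-- `i`-th coordinate set is the one with index `g⁻¹ i`, so that `x ↦ g • x` realizes the
-- automorphism of `B^ω` given by `g⁻¹`.
attribute [local instance] arrowAction

theorem measurableConstSMul_arrow {G : Type} [Group G] [MulAction G I] :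
    MeasurableConstSMul G (I → Bool) :=
  ⟨fun g => measurable_pi_iff.2 fun i => measurable_pi_apply (g⁻¹ • i)⟩

namespace IsCoding

variable [MulAction Γ I] [MulAction Λ I]

theorem realizes_left (hC : IsCoding θ d) (hM : IsModel d m Φ) (g : Γ) :
    Realizes Φ (fun x => g • x) (conjAction θ g⁻¹) :=
  hM.realizes_coord (e := fun i => g⁻¹ • i) fun i => hC.map_left g⁻¹ i

theorem realizes_right (hC : IsCoding θ d) (hM : IsModel d m Φ) (h : Λ) :
    Realizes Φ (fun x => h • x) (ultraAction ν ω h⁻¹) :=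
  hM.realizes_coord (e := fun i => h⁻¹ • i) fun i => hC.map_right h⁻¹ i

theorem measurePreserving_right (hC : IsCoding θ d) (hM : IsModel d m Φ) (h : Λ) :
    MeasurePreserving (fun x : I → Bool => h • x) m m :=
  hM.measurePreserving (hC.realizes_right hM h) fun a => twoNorm_Ad (uU_mem_normalizer h⁻¹) a

theorem measurePreserving_left (hC : IsCoding θ d) (hM : IsModel d m Φ)
    (hθ : ImplementsOmegaOE μ ν θ) (g : Γ) :
    MeasurePreserving (fun x : I → Bool => g • x) m m := by
  obtain ⟨w, hw, -, h⟩ := hθ.exists_normalizer g⁻¹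
  exact hM.measurePreserving (hC.realizes_left hM g) fun a => by rw [← h, twoNorm_Ad]

theorem isFree_left (hC : IsCoding θ d) (hM : IsModel d m Φ) :
    ∀ᵐ x : I → Bool ∂m, ∀ g : Γ, g ≠ 1 → g • x ≠ x := by
  obtain ⟨k, hk⟩ := hC.free_left
  refine ae_all_iff.2 fun g => ?_
  by_cases hg : g = 1
  · exact .of_forall fun x h => absurd hg h
  · filter_upwards [hM.ae_ne (hk g⁻¹ (by simpa using hg)) (hC.realizes_left hM g)] with x hx _
    exact hx

theorem isFree_right (hC : IsCoding θ d) (hM : IsModel d m Φ) :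
    ∀ᵐ x : I → Bool ∂m, ∀ h : Λ, h ≠ 1 → h • x ≠ x := by
  obtain ⟨k, hk⟩ := hC.free_right
  refine ae_all_iff.2 fun g => ?_
  by_cases hg : g = 1
  · exact .of_forall fun x h => absurd hg h
  · filter_upwards [hM.ae_ne (hk g⁻¹ (by simpa using hg)) (hC.realizes_right hM g)] with x hx _
    exact hx

/-- On the model, the orbits of `Γ` are contained in those of `Λ`. -/
theorem orbit_left_ae (hC : IsCoding θ d) (hM : IsModel d m Φ) (g : Γ) :
    ∀ᵐ x : I → Bool ∂m, ∃ h : Λ, g • x = h • x := by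
  obtain ⟨k, hk, hk'⟩ := hC.orbit_left g⁻¹
  have := hM.ae_exists_eq (γ' := fun i : Λ × ℕ => ultraAction ν ω i.1) hk hk'
    (hC.realizes_left hM g) (f' := fun i x => i.1⁻¹ • x) fun i => by
      simpa only [inv_inv] using hC.realizes_right hM i.1⁻¹
  exact this.mono fun x ⟨i, hi⟩ => ⟨i.1⁻¹, hi⟩

/-- On the model, the orbits of `Λ` are contained in those of `Γ`. -/
theorem orbit_right_ae (hC : IsCoding θ d) (hM : IsModel d m Φ) (h : Λ) :
    ∀ᵐ x : I → Bool ∂m, ∃ g : Γ, h • x = g • x := by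
  obtain ⟨k, hk, hk'⟩ := hC.orbit_right h⁻¹
  have := hM.ae_exists_eq (γ' := fun i : Γ × ℕ => conjAction θ i.1) hk hk'
    (hC.realizes_right hM h) (f' := fun i x => i.1⁻¹ • x) fun i => by
      simpa only [inv_inv] using hC.realizes_left hM i.1⁻¹
  exact this.mono fun x ⟨i, hi⟩ => ⟨i.1⁻¹, hi⟩

/-- The hypothesis on `Γ`, applied to the action of `Γ` on the model, conjugates it to the action of
`Λ` by an element `ψ` of the full group. -/
theorem exists_conjugacy (hC : IsCoding θ d) (hM : IsModel d m Φ)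
    (hΓ : ∀ (X : Type) [MeasurableSpace X] [StandardBorelSpace X] [MulAction Γ X]
      [MeasurableConstSMul Γ X] (μ : Measure X) [IsProbabilityMeasure μ]
      [SMulInvariantMeasure Γ X μ], IsFree Γ μ → StronglyErgodic Γ μ → OESuperrigid Γ μ)
    (hθ : ImplementsOmegaOE μ ν θ) (hse : StronglyErgodic Γ μ) :
    ∃ (φ ψ : (I → Bool) → I → Bool) (δ : Γ ≃* Λ), MeasurePreserving ψ m m ∧
      (∀ᵐ x ∂m, φ (ψ x) = x) ∧ (∀ᵐ x ∂m, ∃ k : Λ, ψ x = k⁻¹ • x) ∧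
      ∀ g : Γ, ∀ᵐ x ∂m, ψ (δ g • x) = g • ψ x := by
  have : MeasurableConstSMul Γ (I → Bool) := measurableConstSMul_arrow
  have : MeasurableConstSMul Λ (I → Bool) := measurableConstSMul_arrow
  have : SMulInvariantMeasure Γ (I → Bool) m :=
    ⟨fun g S hS => (hC.measurePreserving_left hM hθ g).measure_preimage hS.nullMeasurableSet⟩
  have : SMulInvariantMeasure Λ (I → Bool) m :=
    ⟨fun g S hS => (hC.measurePreserving_right hM g).measure_preimage hS.nullMeasurableSet⟩
  exact (hΓ (I → Bool) m (hC.isFree_left hM) (hM.stronglyErgodic hθ hse fun g S hS =>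
    (hC.realizes_left hM g).2 S hS)).exists_conjugacy (hC.isFree_right hM) (hC.orbit_left_ae hM)
      (hC.orbit_right_ae hM)

/-- An automorphism `ψ` in the full group of the action of `Λ` on the model is implemented by a
sequence of unitaries in the normalizer of `B`. -/
theorem exists_realizes (hC : IsCoding θ d) (hM : IsModel d m Φ) (hω : (ω : Filter ℕ) ≤ cofinite)
    {φ ψ : (I → Bool) → I → Bool} (hψ : MeasurePreserving ψ m m) (hφψ : ∀ᵐ x ∂m, φ (ψ x) = x)
    (horb : ∀ᵐ x ∂m, ∃ k : Λ, ψ x = k⁻¹ • x) :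
    ∃ (u : ℕ → unitary (crossedProduct Λ ν)) (hu : ∀ n, u n ∈ normalizer (cartan Λ ν)),
      (seqUnitary (traceVec Λ ν) ω u : MPow Λ ν ω) ∈ MOmega Λ ν ω ∧
      Realizes Φ ψ (Ad (seqUnitary (traceVec Λ ν) ω u) (seqUnitary_mem_normalizer hu)) := by
  have hact : ∀ h : Λ, Measurable fun x : I → Bool => h • x := fun h =>
    (hC.realizes_right hM h).1
  -- On `T h` the map `ψ` acts by `h⁻¹`, hence `Ad(u)` has to agree with `ρ^ω_h` under `Φ (T h)`.
  -- The sets `T h` are disjoint since the action of `Λ` is free, and so are the images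
  -- `ψ (T h) = h⁻¹ T h`, since `ψ` is injective.
  set T : Λ → Set (I → Bool) := fun h => {x | ψ x = h⁻¹ • x} with hT
  have hTm : ∀ h, MeasurableSet (T h) := fun h => measurableSet_eq_fun hψ.measurable (hact h⁻¹)
  have hfree := hC.isFree_right hM
  have hne : ∀ (x : I → Bool), (∀ h : Λ, h ≠ 1 → h • x ≠ x) → ∀ h k : Λ, h • x = k • x → h = k := by
    intro x hx h k hhk
    by_contra hcon
    refine hx (k⁻¹ * h) (fun h1 => hcon (inv_mul_eq_one.1 h1).symm) ?_
    rw [mul_smul, hhk, inv_smul_smul]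
  have hdisj : ∀ h k, h ≠ k → m (T h ∩ T k) = 0 := by
    intro h k hhk
    refine measure_eq_zero_iff_ae_notMem.2 (hfree.mono fun x hx hxT => hhk ?_)
    exact inv_injective (hne x hx _ _ (hxT.1.symm.trans hxT.2))
  have hcov : m (⋃ h, T h)ᶜ = 0 := by
    refine measure_eq_zero_iff_ae_notMem.2 (horb.mono fun x hx => ?_)
    rw [Set.notMem_compl_iff]
    exact Set.mem_iUnion.2 hx
  have hdisj' : ∀ h k, h ≠ k →
      m (((fun x => h • x) ⁻¹' T h) ∩ ((fun x => k • x) ⁻¹' T k)) = 0 := by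
    intro h k hhk
    refine measure_eq_zero_iff_ae_notMem.2 ?_
    filter_upwards [hfree, (hC.measurePreserving_right hM h).quasiMeasurePreserving.ae hφψ,
      (hC.measurePreserving_right hM k).quasiMeasurePreserving.ae hφψ] with x hx h1 h2 hxT
    have h3 : ψ (h • x) = h⁻¹ • h • x := hxT.1
    have h4 : ψ (k • x) = k⁻¹ • k • x := hxT.2
    rw [inv_smul_smul] at h3 h4
    rw [h3] at h1
    rw [h4] at h2
    exact hhk (hne x hx _ _ (h1.symm.trans h2))
  have hβ : ∀ h, ultraAction ν ω h⁻¹ (Φ (T h)) = Φ ((fun x => h • x) ⁻¹' T h) := fun h =>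
    ((hC.realizes_right hM h).2 _ (hTm h)).symm
  obtain ⟨u, hu, hu', hut⟩ := exists_unitary_lift hω (t := fun h => Φ (T h))
    (fun h => hM.mul_self (hTm h))
    (fun h k hhk => by
      rw [← hM.inter _ _ (hTm h) (hTm k), hM.eq_zero_iff ((hTm h).inter (hTm k)), hdisj h k hhk])
    (fun h k hhk => by
      rw [hβ, hβ, ← hM.inter _ _ (hact h (hTm h)) (hact k (hTm k)),
        hM.eq_zero_iff ((hact h (hTm h)).inter (hact k (hTm k))), hdisj' h k hhk])
    (fun ε hε => hM.exists_sum_lt hTm hdisj hcov hε)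
  refine ⟨u, hu, hu', hψ.measurable, fun S hS => ?_⟩
  rw [← sub_eq_zero]
  refine hM.full T hTm hcov _ fun h => ?_
  rw [sub_mul, Ad_mul_eq (seqUnitary_mem_normalizer hu) (uU_mem_normalizer h) (hM.mul_self (hTm h))
    (hut h), sub_eq_zero]
  have h1 := (hC.realizes_right hM h⁻¹).2 S hS
  rw [inv_inv] at h1
  refine Eq.trans ?_ (congrArg (· * Φ (T h)) h1)
  rw [← hM.inter _ _ (hψ.measurable hS) (hTm h), ← hM.inter _ _ (hact h⁻¹ hS) (hTm h)]
  congr 1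
  ext x
  simp only [hT, Set.mem_inter_iff, Set.mem_preimage, Set.mem_ofPred_eq]
  exact and_congr_left fun hx => by rw [hx]

/-- If `ψ` conjugates the actions on the model and `Ad(u)` implements `ψ`, then `Ad(u)` conjugates
the actions on the projections of the model. -/
theorem Ad_conjAction (hC : IsCoding θ d) (hM : IsModel d m Φ) {ψ : (I → Bool) → I → Bool}
    {δ : Γ ≃* Λ} (hδ : ∀ g : Γ, ∀ᵐ x ∂m, ψ (δ g • x) = g • ψ x)
    {γ : APow Λ ν ω ≃⋆ₐ[ℂ] APow Λ ν ω} (hγ : Realizes Φ ψ γ) (g : Γ) (i : I) :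
    γ (conjAction θ g (d i)) = ultraAction ν ω (δ g) (γ (d i)) := by
  have hS := measurableSet_coord i
  have h1 := (hC.realizes_left hM g⁻¹).2 _ hS
  have h2 := hγ.2 _ ((hC.realizes_left hM g⁻¹).1 hS)
  have h3 := (hC.realizes_right hM (δ g)⁻¹).2 _ (hγ.1 hS)
  rw [inv_inv] at h1 h3
  rw [← hM.coord, ← h1, ← h2, ← hγ.2 _ hS, ← h3]
  refine hM.congr_ae (hγ.1 ((hC.realizes_left hM g⁻¹).1 hS))
    ((hC.realizes_right hM (δ g)⁻¹).1 (hγ.1 hS)) ?_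
  filter_upwards [hδ g⁻¹] with x hx
  rw [map_inv] at hx
  simp only [Set.mem_preimage, hx]

end IsCoding

/-- The relation `Ad(u) α_g = β_h Ad(u)` holds on `B^ω` once it holds on a family of projections
witnessing that the action of `Λ` is free: the automorphism `α_g⁻¹ Ad(u)⁻¹ β_h Ad(u)` is then
implemented by an element of `N(ω)` and fixes this family. -/
theorem Ad_conj_eq_of_family {u w : unitary (MPow Λ ν ω)} (hu : u ∈ normalizer (APow Λ ν ω))
    (hu' : (u : MPow Λ ν ω) ∈ MOmega Λ ν ω) (hw : w ∈ normalizer (APow Λ ν ω))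
    (hw' : (w : MPow Λ ν ω) ∈ MOmega Λ ν ω) {ι : Type} {a : ι → APow Λ ν ω}
    (ha : ∀ i, a i * a i = a i)
    (hfull : ∀ h : Λ, h ≠ 1 → Full fun i => a i * (1 - ultraAction ν ω h (a i))) {h : Λ}
    (heq : ∀ i, Ad u hu (Ad w hw (a i)) = ultraAction ν ω h (Ad u hu (a i))) (b : APow Λ ν ω) :
    Ad u hu (Ad w hw b) = ultraAction ν ω h (Ad u hu b) := by
  -- `Ad(z) = Ad(w)⁻¹ Ad(u)⁻¹ ρ^ω_h Ad(u)` for `z = w^* u^* u_h u`.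
  have hz : star w * (star u * (uU ν ω h * u)) ∈ normalizer (APow Λ ν ω) :=
    mul_mem_normalizer (star_mem_normalizer hw) (mul_mem_normalizer (star_mem_normalizer hu)
      (mul_mem_normalizer (uU_mem_normalizer h) hu))
  have hz' : ((star w * (star u * (uU ν ω h * u)) : unitary (MPow Λ ν ω)) : MPow Λ ν ω) ∈
      MOmega Λ ν ω :=
    mul_mem (star_mem hw') (mul_mem (star_mem hu') (mul_mem (uU_mem_MOmega h) hu'))
  have hsplit : ∀ c, Ad _ hz c = (Ad w hw).symm ((Ad u hu).symm (ultraAction ν ω h (Ad u hu c))) := by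
    intro c
    rw [← Ad_star hw, ← Ad_star hu]
    refine Subtype.ext ?_
    simp only [coe_Ad, coe_ultraAction, Submonoid.coe_mul, star_mul, mul_assoc]
  have hid := Ad_eq_self hz hz' ha hfull (fun i => by
    rw [hsplit, ← heq, StarAlgEquiv.symm_apply_apply, StarAlgEquiv.symm_apply_apply]) b
  rw [hsplit] at hid
  have h2 := congrArg (Ad u hu) (congrArg (Ad w hw) hid)
  rw [StarAlgEquiv.apply_symm_apply, StarAlgEquiv.apply_symm_apply] at h2
  exact h2.symm

/-- The conjugating unitary, with its sequence of representatives in the normalizer of `B`. -/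
theorem exists_conjugating_sequence [StandardBorelSpace X] [StandardBorelSpace Y]
    (hΓ : ∀ (X : Type) [MeasurableSpace X] [StandardBorelSpace X] [MulAction Γ X]
      [MeasurableConstSMul Γ X] (μ : Measure X) [IsProbabilityMeasure μ]
      [SMulInvariantMeasure Γ X μ], IsFree Γ μ → StronglyErgodic Γ μ → OESuperrigid Γ μ)
    (hfree : IsFree Γ μ) (hse : StronglyErgodic Γ μ) (hω : (ω : Filter ℕ) ≤ cofinite)
    (hfree' : IsFree Λ ν) (hθ : ImplementsOmegaOE μ ν θ) :
    ∃ (u : ℕ → unitary (crossedProduct Λ ν)) (hu : ∀ n, u n ∈ normalizer (cartan Λ ν))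
      (δ : Γ ≃* Λ), (seqUnitary (traceVec Λ ν) ω u : MPow Λ ν ω) ∈ MOmega Λ ν ω ∧
      ∀ g b, Ad (seqUnitary (traceVec Λ ν) ω u) (seqUnitary_mem_normalizer hu)
        (conjAction θ g b) = ultraAction ν ω (δ g)
          (Ad (seqUnitary (traceVec Λ ν) ω u) (seqUnitary_mem_normalizer hu) b) := by
  obtain ⟨I, hI, _, _, d, hC⟩ := hθ.exists_isCoding hfree hfree'
  obtain ⟨m, Φ, _, hM⟩ := exists_isModel hω hC.mul_self
  obtain ⟨φ, ψ, δ, hψ, hφψ, horb, hδ⟩ := hC.exists_conjugacy hM hΓ hθ hse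
  obtain ⟨u, hu, hu', hR⟩ := hC.exists_realizes hM hω hψ hφψ horb
  refine ⟨u, hu, δ, hu', fun g b => ?_⟩
  obtain ⟨w, hw, hw', hAd⟩ := hθ.exists_normalizer g
  obtain ⟨k, hk⟩ := hC.free_right
  rw [← hAd]
  exact Ad_conj_eq_of_family (seqUnitary_mem_normalizer hu) hu' hw hw' (a := fun i => d (k i))
    (fun i => hC.mul_self (k i)) hk
    (fun i => by rw [hAd]; exact hC.Ad_conjAction hM hδ hR g (k i)) b

end Rigidity

/-! ### Conjugation by sequences of unitaries -/

section Conjugation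

variable {H : Type} [NormedAddCommGroup H] [InnerProductSpace ℂ H] [CompleteSpace H]
  {M : StarSubalgebra ℂ (H →L[ℂ] H)} {Ω : H} [IsTraceVector M Ω] {ω : Ultrafilter ℕ}

theorem seqUnitary_conj_mkU (u : ℕ → unitary M) {y z : boundedSeq M}
    (h : ∀ n, (z : ℕ → M) n = (u n : M) * (y : ℕ → M) n * star (u n : M)) :
    (seqUnitary Ω ω u : Ultrapower M Ω ω) * mkU M Ω ω y *
      star (seqUnitary Ω ω u : Ultrapower M Ω ω) = mkU M Ω ω z := by
  have h1 : z = unitarySeq u * y * star (unitarySeq u) := Subtype.ext (funext h)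
  rw [h1]
  rfl

/-- The sequence `(u_n^* z_n u_n)_n`. -/
def starConjSeq (u : ℕ → unitary M) (z : boundedSeq M) : boundedSeq M :=
  star (unitarySeq u) * z * unitarySeq u

theorem starConjSeq_eq {u : ℕ → unitary M} {z : boundedSeq M} {n : ℕ} {a : M}
    (h : (z : ℕ → M) n = (u n : M) * a * star (u n : M)) : (starConjSeq u z : ℕ → M) n = a := by
  change star (u n : M) * (z : ℕ → M) n * (u n : M) = a
  have h1 : star (u n : M) * (u n : M) = 1 := Unitary.coe_star_mul_self (u n)
  rw [h, mul_assoc, mul_assoc, h1, mul_one, ← mul_assoc, h1, one_mul]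

end Conjugation

/-! ### Isomorphisms of ultraproduct form -/

section UltraproductForm

variable {Γ : Type} [Group Γ] [Countable Γ] [MeasurableSpace Γ] [DiscreteMeasurableSpace Γ]
  {X : Type} [MeasurableSpace X] {μ : Measure X} [IsProbabilityMeasure μ]
  [MulAction Γ X] [MeasurableConstSMul Γ X] [SMulInvariantMeasure Γ X μ]
  {Λ : Type} [Group Λ] [Countable Λ] [MeasurableSpace Λ] [DiscreteMeasurableSpace Λ]
  {Y : Type} [MeasurableSpace Y] {ν : Measure Y} [IsProbabilityMeasure ν]
  [MulAction Λ Y] [MeasurableConstSMul Λ Y] [SMulInvariantMeasure Λ Y ν] {ω : Ultrafilter ℕ}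
  {θ : APow Γ μ ω ≃⋆ₐ[ℂ] APow Λ ν ω}

theorem crossedTrace_Ad {u : unitary (crossedProduct Λ ν)} (hu : u ∈ normalizer (cartan Λ ν))
    (a : cartan Λ ν) : crossedTrace Λ ν (Ad u hu a) = crossedTrace Λ ν a := by
  have h := inner_trace_comm (Ω := traceVec Λ ν) ((u : crossedProduct Λ ν) * (a : crossedProduct Λ ν))
    (star (u : crossedProduct Λ ν))
  rw [← mul_assoc, Unitary.coe_star_mul_self, one_mul] at h
  exact h

/-- If `θ = (θ_n)_n` and `u = (u_n)_n` with `u_n` normalizing `B`, then `Ad(u) θ` is given by the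
isomorphisms `Ad(u_n) θ_n`. -/
theorem IsUltraproductForm.trans_Ad (h : IsUltraproductForm μ ν θ)
    {u : ℕ → unitary (crossedProduct Λ ν)} (hu : ∀ n, u n ∈ normalizer (cartan Λ ν)) :
    IsUltraproductForm μ ν
      (θ.trans (Ad (seqUnitary (traceVec Λ ν) ω u) (seqUnitary_mem_normalizer hu))) := by
  obtain ⟨θn, h1, h2⟩ := h
  refine ⟨fun n => (θn n).trans (Ad (u n) (hu n)), fun n a => ?_, fun x z hx hz => ?_⟩
  · exact (crossedTrace_Ad (hu n) _).trans (h1 n a)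
  · have hz' : ∀ n, (z : ℕ → crossedProduct Λ ν) n = (u n : crossedProduct Λ ν) *
        (θn n ⟨(x : ℕ → crossedProduct Γ μ) n, hx n⟩ : crossedProduct Λ ν) *
          star (u n : crossedProduct Λ ν) := hz
    have hy : ∀ n, (starConjSeq u z : ℕ → crossedProduct Λ ν) n =
        θn n ⟨(x : ℕ → crossedProduct Γ μ) n, hx n⟩ := fun n => starConjSeq_eq (hz' n)
    refine Eq.trans (congrArg (fun q : MPow Λ ν ω =>
      (seqUnitary (traceVec Λ ν) ω u : MPow Λ ν ω) * q *
        star (seqUnitary (traceVec Λ ν) ω u : MPow Λ ν ω)) (h2 x (starConjSeq u z) hx hy)) ?_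
    exact seqUnitary_conj_mkU u fun n =>
      (hz' n).trans (congrArg (fun a => (u n : crossedProduct Λ ν) * a *
        star (u n : crossedProduct Λ ν)) (hy n).symm)

/-- The unitary `u` is the same for all three conclusions. -/
theorem exists_conjugating_unitary [StandardBorelSpace X] [StandardBorelSpace Y]
    (hΓ : ∀ (X : Type) [MeasurableSpace X] [StandardBorelSpace X] [MulAction Γ X]
      [MeasurableConstSMul Γ X] (μ : Measure X) [IsProbabilityMeasure μ]
      [SMulInvariantMeasure Γ X μ], IsFree Γ μ → StronglyErgodic Γ μ → OESuperrigid Γ μ)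
    (hfree : IsFree Γ μ) (hse : StronglyErgodic Γ μ) (hω : (ω : Filter ℕ) ≤ cofinite)
    (hfree' : IsFree Λ ν) (hθ : ImplementsOmegaOE μ ν θ) :
    ∃ (u : unitary (MPow Λ ν ω)) (hu : u ∈ normalizerOmega Λ ν ω),
      (fun α : APow Λ ν ω ≃⋆ₐ[ℂ] APow Λ ν ω => Ad u hu.1 * α * (Ad u hu.1)⁻¹) ''
        Set.range (fun g : Γ => (θ.symm.trans (ultraAction μ ω g)).trans θ) =
      Set.range (fun h : Λ => ultraAction ν ω h) ∧
      IsOmegaConjugacy μ ν (θ.trans (Ad u hu.1)) ∧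
      (IsUltraproductForm μ ν θ → IsUltraproductForm μ ν (θ.trans (Ad u hu.1))) := by
  obtain ⟨u, hu, δ, hu', hδ⟩ := exists_conjugating_sequence hΓ hfree hse hω hfree' hθ
  refine ⟨seqUnitary (traceVec Λ ν) ω u, ⟨seqUnitary_mem_normalizer hu, hu'⟩, ?_,
    ⟨fun a => ?_, δ, fun g a => ?_⟩, fun h => h.trans_Ad hu⟩
  · have hconj : ∀ g : Γ, Ad (seqUnitary (traceVec Λ ν) ω u) (seqUnitary_mem_normalizer hu) *
        conjAction θ g *
        (Ad (seqUnitary (traceVec Λ ν) ω u) (seqUnitary_mem_normalizer hu))⁻¹ =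
          ultraAction ν ω (δ g) := fun g =>
      mul_inv_eq_of_eq_mul (StarAlgEquiv.ext (hδ g))
    rw [← Set.range_comp]
    refine (congrArg Set.range (funext hconj)).trans ?_
    exact δ.surjective.range_comp fun h : Λ => ultraAction ν ω h
  · exact (utrace_conj _ _).trans (hθ.utrace_eq a)
  · have h1 := hδ g (θ a)
    rwa [conjAction_apply, StarAlgEquiv.symm_apply_apply] at h1

end UltraproductForm

end

end UltraOE

open UltraOE

theorem proposition5p1
    (Γ : Type) [Group Γ] [Countable Γ] [MeasurableSpace Γ] [DiscreteMeasurableSpace Γ]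
    (hΓ : ∀ (X : Type) [MeasurableSpace X] [StandardBorelSpace X] [MulAction Γ X]
      [MeasurableConstSMul Γ X] (μ : Measure X) [IsProbabilityMeasure μ]
      [SMulInvariantMeasure Γ X μ], IsFree Γ μ → StronglyErgodic Γ μ → OESuperrigid Γ μ)
    (X : Type) [MeasurableSpace X] [StandardBorelSpace X] [MulAction Γ X]
    [MeasurableConstSMul Γ X] (μ : Measure X) [IsProbabilityMeasure μ]
    [SMulInvariantMeasure Γ X μ] (hfree : IsFree Γ μ) (hse : StronglyErgodic Γ μ)
    (ω : Ultrafilter ℕ) (hω : (ω : Filter ℕ) ≤ Filter.cofinite) :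
    OmegaOESuperrigid Γ μ ω ∧ AppOESuperrigid Γ μ ω ∧
    ∀ (Λ : Type) [Group Λ] [Countable Λ] [MeasurableSpace Λ] [DiscreteMeasurableSpace Λ]
      (Y : Type) [MeasurableSpace Y] [StandardBorelSpace Y] [MulAction Λ Y]
      [MeasurableConstSMul Λ Y] (ν : Measure Y) [IsProbabilityMeasure ν]
      [SMulInvariantMeasure Λ Y ν], IsFree Λ ν →
      ∀ θ : APow Γ μ ω ≃⋆ₐ[ℂ] APow Λ ν ω, ImplementsOmegaOE μ ν θ →
        ∃ (u : unitary (MPow Λ ν ω)) (hu : u ∈ normalizerOmega Λ ν ω),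
          (fun α : APow Λ ν ω ≃⋆ₐ[ℂ] APow Λ ν ω => Ad u hu.1 * α * (Ad u hu.1)⁻¹) ''
            Set.range (fun g : Γ => (θ.symm.trans (ultraAction μ ω g)).trans θ) =
          Set.range (fun h : Λ => ultraAction ν ω h) ∧
          IsOmegaConjugacy μ ν (θ.trans (Ad u hu.1)) ∧
          (IsUltraproductForm μ ν θ → IsUltraproductForm μ ν (θ.trans (Ad u hu.1))) := by
  refine ⟨?_, ?_, ?_⟩
  · intro Λ _ _ _ _ Y _ _ _ _ ν _ _ hfree' θ hθ
    obtain ⟨u, hu, -, h, -⟩ := exists_conjugating_unitary hΓ hfree hse hω hfree' hθ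
    exact ⟨u, hu, h⟩
  · intro Λ _ _ _ _ Y _ _ _ _ ν _ _ hfree' θ hθ hform
    obtain ⟨u, hu, -, h, h'⟩ := exists_conjugating_unitary hΓ hfree hse hω hfree' hθ
    exact ⟨u, hu, h, h' hform⟩
  · intro Λ _ _ _ _ Y _ _ _ _ ν _ _ hfree' θ hθ
    exact exists_conjugating_unitary hΓ hfree hse hω hfree' hθ
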